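/- Let $G$ be a simple undirected graph with vertex set $V$, $|V|=n\ge 3$, and let $t:V\to\mathbb{N}$. A vector dominating set of $(G,t)$ is a set $S\subseteq V$ such that every $v\in V\setminus S$ has at least $t(v)$ neighbours in $S$; let $opt(G,t)$ be the minimum size of such a set. A tree decomposition of $G$ is a rooted tree $T$ with bags $X_\alpha\subseteq V$ $(\alpha\in V(T))$ such that every vertex and every edge of $G$ is contained in some bag and, for every $v\in V$, the nodes $\alpha$ with $v\in X_\alpha$ form a subtree of $T$; its width is $\max_\alpha|X_\alpha|-1$. There are constants $c>0$, $C>0$ and an algorithm (a program for the random access machine with unit-cost addition and subtraction) that takes as input an instance $(G,t)$ of Vector Dominating Set with $n\ge 3$ vertices together with a tree decomposition of $G$ of width $w\ge 1$ whose tree has $m$ nodes, and finds a vector dominating set of size at most $$\Bigl(1+\frac{1}{(w\log_2\log_2 n)^{c}}\Bigr)\cdot opt(G,t)$$ in time at most $2^{C\,w^5\log_2 w\,\log_2\log_2 n}\,(n+m)^{C}$. In particular, if $m=n^{O(1)}$, the running time is $2^{O(w^5\log w\log\log n)}\,n^{O(1)}$. -/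

import Mathlib

/-!
Random access machine with unit cost.  Memory consists of registers and of one-dimensional arrays,
all holding natural numbers; the only arithmetic operations are addition and truncated
subtraction (no multiplication), so that unit cost is polynomially equivalent to
Turing machine time.  A program is a fixed finite object, mentioning finitely many registers and
arrays.
-/
namespace RAM

/-- Contents of the memory: `reg r` is the value of register `r`, and `arr a i` is the entry with
index `i` of array `a`. -/
structure State where
  reg : ℕ → ℕ
  arr : ℕ → ℕ → ℕ

/-- Arithmetic expressions; `get a i` reads the entry of array `a` whose index is the value
of `i` (indirect addressing). -/
inductive Expr where
  | const (k : ℕ)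
  | reg (r : ℕ)
  | get (a : ℕ) (i : Expr)
  | add (x y : Expr)
  | sub (x y : Expr)

/-- Value of an expression. -/
def Expr.eval (s : State) : Expr → ℕ
  | .const k => k
  | .reg r => s.reg r
  | .get a i => s.arr a (i.eval s)
  | .add x y => x.eval s + y.eval s
  | .sub x y => x.eval s - y.eval s

/-- Number of elementary operations needed to evaluate an expression: one for each of its nodes. -/
def Expr.cost : Expr → ℕ
  | .const _ => 1
  | .reg _ => 1
  | .get _ i => i.cost + 1
  | .add x y => x.cost + y.cost + 1
  | .sub x y => x.cost + y.cost + 1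

/-- Programs. -/
inductive Prog where
  /-- do nothing -/
  | skip
  /-- `reg r := e` -/
  | assign (r : ℕ) (e : Expr)
  /-- `arr a [i] := e` -/
  | store (a : ℕ) (i e : Expr)
  /-- first `p`, then `q` -/
  | seq (p q : Prog)
  /-- if `e ≠ 0` then `p` else `q` -/
  | cond (e : Expr) (p q : Prog)
  /-- while `e ≠ 0` do `p` -/
  | loop (e : Expr) (p : Prog)

/-- The memory after writing `x` into register `r`. -/
def State.setReg (s : State) (r x : ℕ) : State :=
  { s with reg := Function.update s.reg r x }

/-- The memory after writing `x` into entry `i` of array `a`. -/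
def State.setArr (s : State) (a i x : ℕ) : State :=
  { s with arr := Function.update s.arr a (Function.update (s.arr a) i x) }

/-- `RunsIn p s T s'`: the program `p`, started on memory `s`, halts after exactly `T` steps with
memory `s'`.  A program that does not halt is in no such relation. -/
inductive RunsIn : Prog → State → ℕ → State → Prop where
  | skip (s : State) : RunsIn .skip s 1 s
  | assign (r : ℕ) (e : Expr) (s : State) :
      RunsIn (.assign r e) s (e.cost + 1) (s.setReg r (e.eval s))
  | store (a : ℕ) (i e : Expr) (s : State) :
      RunsIn (.store a i e) s (i.cost + e.cost + 1) (s.setArr a (i.eval s) (e.eval s))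
  | seq {p q : Prog} {s s' s'' : State} {T T' : ℕ} :
      RunsIn p s T s' → RunsIn q s' T' s'' → RunsIn (.seq p q) s (T + T') s''
  | condTrue {e : Expr} {p q : Prog} {s s' : State} {T : ℕ} :
      e.eval s ≠ 0 → RunsIn p s T s' → RunsIn (.cond e p q) s (e.cost + 1 + T) s'
  | condFalse {e : Expr} {p q : Prog} {s s' : State} {T : ℕ} :
      e.eval s = 0 → RunsIn q s T s' → RunsIn (.cond e p q) s (e.cost + 1 + T) s'
  | loopDone {e : Expr} {p : Prog} {s : State} :
      e.eval s = 0 → RunsIn (.loop e p) s (e.cost + 1) s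
  | loopStep {e : Expr} {p : Prog} {s s' s'' : State} {T T' : ℕ} :
      e.eval s ≠ 0 → RunsIn p s T s' → RunsIn (.loop e p) s' T' s'' →
      RunsIn (.loop e p) s (e.cost + 1 + T + T') s''

/-- The machine is deterministic: step count and final memory are determined by the program and
the initial memory. -/
theorem RunsIn.unique {p : Prog} {s s₁ s₂ : State} {T₁ T₂ : ℕ}
    (h₁ : RunsIn p s T₁ s₁) (h₂ : RunsIn p s T₂ s₂) : T₁ = T₂ ∧ s₁ = s₂ := by
  induction h₁ generalizing s₂ T₂ with
  | skip | assign | store => cases h₂; exact ⟨rfl, rfl⟩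
  | seq _ _ ih ih' =>
    cases h₂ with
    | seq a b =>
      obtain ⟨rfl, rfl⟩ := ih a
      obtain ⟨rfl, rfl⟩ := ih' b
      exact ⟨rfl, rfl⟩
  | condTrue he _ ih =>
    cases h₂ with
    | condTrue _ a => obtain ⟨rfl, rfl⟩ := ih a; exact ⟨rfl, rfl⟩
    | condFalse he' _ => exact absurd he' he
  | condFalse he _ ih =>
    cases h₂ with
    | condTrue he' _ => exact absurd he he'
    | condFalse _ a => obtain ⟨rfl, rfl⟩ := ih a; exact ⟨rfl, rfl⟩
  | loopDone he =>
    cases h₂ with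
    | loopDone _ => exact ⟨rfl, rfl⟩
    | loopStep he' _ _ => exact absurd he he'
  | loopStep he _ _ ih ih' =>
    cases h₂ with
    | loopDone he' => exact absurd he' he
    | loopStep _ a b =>
      obtain ⟨rfl, rfl⟩ := ih a
      obtain ⟨rfl, rfl⟩ := ih' b
      exact ⟨rfl, rfl⟩

end RAM

namespace VDS

open Classical in
/-- `S` is a vector dominating set of the instance `(G, t)`: every vertex `v` outside `S` has
at least `t v` neighbours in `S`. -/
def IsSolution {n : ℕ} (G : SimpleGraph (Fin n)) (t : Fin n → ℕ) (S : Finset (Fin n)) : Prop :=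
  ∀ v : Fin n, v ∉ S → t v ≤ (S.filter (fun u => G.Adj v u)).card

/-- Minimum size of a vector dominating set (the set of all vertices is always one, so this is the
minimum of a nonempty set). -/
noncomputable def opt {n : ℕ} (G : SimpleGraph (Fin n)) (t : Fin n → ℕ) : ℕ :=
  sInf {k : ℕ | ∃ S : Finset (Fin n), IsSolution G t S ∧ S.card = k}

/-- Tree decompositions of `G` whose rooted tree has the `m` nodes `0, …, m - 1`. -/
structure TreeDecomposition {n : ℕ} (G : SimpleGraph (Fin n)) (m : ℕ) where
  tree : SimpleGraph (Fin m)
  isTree : tree.IsTree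
  root : Fin m
  bag : Fin m → Finset (Fin n)
  cover_vertex : ∀ v : Fin n, ∃ α : Fin m, v ∈ bag α
  cover_edge : ∀ u v : Fin n, G.Adj u v → ∃ α : Fin m, u ∈ bag α ∧ v ∈ bag α
  connected : ∀ v : Fin n, (tree.induce {α : Fin m | v ∈ bag α}).Connected

/-- The maximum size of a bag, minus one. -/
def TreeDecomposition.width {n m : ℕ} {G : SimpleGraph (Fin n)}
    (D : TreeDecomposition G m) : ℕ :=
  Finset.univ.sup (fun α : Fin m => (D.bag α).card) - 1

open Classical in
/-- Initial memory for the instance `(G, t)` with the tree decomposition `D`.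
Registers: `0` holds the number `n` of vertices, `1` the number `m` of nodes, `2` the root.
Arrays: `0` holds the adjacency matrix of `G` (`n × n`), `1` the thresholds, `2` the adjacency
matrix of the tree (`m × m`), `3` the incidence matrix of nodes and vertices given by the bags
(`m × n`), all matrices row by row.  The rest of the memory is zero. -/
noncomputable def input {n m : ℕ} (G : SimpleGraph (Fin n)) (t : Fin n → ℕ)
    (D : TreeDecomposition G m) : RAM.State where
  reg r :=
    match r with
    | 0 => n
    | 1 => m
    | 2 => D.root
    | _ => 0
  arr a i :=
    match a with
    | 0 => if ∃ u v : Fin n, i = u * n + v ∧ G.Adj u v then 1 else 0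
    | 1 => if h : i < n then t ⟨i, h⟩ else 0
    | 2 => if ∃ α β : Fin m, i = α * m + β ∧ D.tree.Adj α β then 1 else 0
    | 3 => if ∃ (α : Fin m) (v : Fin n), i = α * n + v ∧ v ∈ D.bag α then 1 else 0
    | _ => 0

/-- The vertex set output by a computation: array `4` holds (the characteristic function of) it. -/
def output (n : ℕ) (s : RAM.State) : Finset (Fin n) :=
  Finset.univ.filter (fun v : Fin n => s.arr 4 v ≠ 0)

end VDS

/-! Let w be the width, L = ⌈log₂ n⌉ and K = (w+1)²L. The algorithm takes every vertex of threshold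
above K and optimizes exactly over the sets that contain all of these (`KGood`).

The loss is small. Assigning to each vertex the bag of its subtree closest to the root shows that
there are at most w(|A|+|S|) edges between disjoint A and S (`sum_cnt_le`). If S is optimal and A
consists of the vertices outside S with threshold above K, each vertex of A has more than K
neighbours in S, so K|A| ≤ w(|A|+|S|) and hence |A| ≤ |S|/(wL) (`exists_kGood`). Since log log n ≤
L, this gives the ratio with c = 1.

The optimization is a dynamic program over the tree. Inside a good set all thresholds that matter
are at most K, so neighbour counts are needed only up to K. A partial solution on the vertex set V
of a piece of the tree meets the rest of the graph only in one bag X. What matters of it is its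
size, its trace on X and the capped counts at X (`SameSig`). There are at most (n+1)(2(K+1))^(w+1)
such signatures (`card_le_sigBound`), and one partial solution per signature is kept. Correctness is
phrased as an exchange property, `Represents`: it survives combining two families
(`Represents.merge`) and discarding duplicates (`Represents.prune`).

The tree is processed by contracting leaves into their neighbours in any order. `Elimination`
records this process, and `mem_partVerts_of_adj` supplies the separation property that pruning
needs. Each bag is first entered vertex by vertex, a single vertex being a part of its own, so the
one routine `absorb` performs every merge. When one node is left, its family represents all good
sets on the whole graph, and the best good member is output.

On the machine, `Spec` is a Hoare logic with step counts. The total is O(B⁶) with B = n + m + 1 +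
the number of signatures. As (2(K+1))^(w+1) is 2^O(w(log w + log log n)), this is far below the
claimed bound for w ≥ 2. For w = 1 the claimed exponent is zero, but then the factor is just a power
of log n, which (n+m)^C absorbs. -/

namespace SimpleGraph

/-! ### Trees: distance to the root, and leaf elimination -/

/-- A property that is inherited by neighbours inside a set `C` holds on all of `C` as soon as it
holds somewhere on `C`, if `C` induces a connected graph. -/
theorem Connected.forall_of_induce {V : Type*} {T : SimpleGraph V} {C : Set V}
    (hC : (T.induce C).Connected) (P : V → Prop)
    (hstep : ∀ x ∈ C, ∀ y ∈ C, T.Adj x y → P x → P y) {x : V} (hx : x ∈ C) (hP : P x) :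
    ∀ y ∈ C, P y := by
  intro y hy
  obtain ⟨p⟩ := hC.preconnected ⟨x, hx⟩ ⟨y, hy⟩
  have key : ∀ {a b : C}, (T.induce C).Walk a b → P a → P b := by
    intro a b p
    induction p with
    | nil => exact id
    | cons h _ ih => exact fun ha => ih (hstep _ (Subtype.mem _) _ (Subtype.mem _) h ha)
  exact key p hP

/-- Parents are unique: a neighbour of `x` closer to `r` must be the penultimate vertex of the
shortest path from `r` to `x`. Otherwise `x` would lie on the shortest path to that neighbour, which
is too short for this. -/
theorem IsTree.eq_of_adj_of_dist_lt {V : Type*} {T : SimpleGraph V} (hT : T.IsTree) (r : V)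
    {x y z : V} (hy : T.Adj x y) (hz : T.Adj x z) (hy' : T.dist r y < T.dist r x)
    (hz' : T.dist r z < T.dist r x) : y = z := by
  obtain ⟨p, hp, hpl⟩ := (hT.connected r x).exists_path_of_dist
  have key : ∀ {y : V}, T.Adj x y → T.dist r y < T.dist r x → y = p.penultimate := by
    intro y hy hy'
    obtain ⟨q, hq, hql⟩ := (hT.connected r y).exists_path_of_dist
    refine hT.isAcyclic.eq_penultimate_of_adj_end hp hy ?_
    by_contra hyp
    have hxq : x ∈ q.support :=
      hT.isAcyclic.mem_support_of_ne_mem_support_of_adj_of_isPath hq hp hy.symm hyp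
    classical
    have h1 := dist_le (q.takeUntil x hxq)
    have h2 := q.length_takeUntil_le_length hxq
    omega
  rw [key hy hy', key hz hz']

/-- A connected set of nodes of a tree has exactly one node without a neighbour in the set that is
closer to the root. -/
theorem IsTree.exists_adj_dist_lt_or {V : Type*} {T : SimpleGraph V} (hT : T.IsTree) (r : V)
    {C : Set V} (hC : (T.induce C).Connected) {x : V} (hx : x ∈ C) :
    (∃ z ∈ C, T.Adj x z ∧ T.dist r z < T.dist r x) ∨ ∀ y ∈ C, y = x ∨ T.dist r x < T.dist r y := by
  by_contra! hcon
  obtain ⟨hlow, y, hy, hyx, hyd⟩ := hcon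
  -- `P z` says that a path descending towards the root leads from `z` to `x`. It spreads over `C`:
  -- a step away from the root is prepended to the path, and a step towards the root must follow the
  -- path, because parents are unique.
  let P : V → Prop := fun z =>
    Relation.ReflTransGen (fun a b => T.Adj a b ∧ T.dist r b < T.dist r a) z x
  have hall : ∀ z ∈ C, P z := by
    refine hC.forall_of_induce P ?_ hx .refl
    intro z hz z' hz' hadj hPz
    rcases lt_or_gt_of_ne (hT.dist_ne_of_adj r hadj) with h | h
    · exact hPz.head ⟨hadj.symm, h⟩
    · rcases Relation.ReflTransGen.cases_head hPz with rfl | ⟨z₁, hz₁, hP₁⟩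
      · exact absurd h (not_lt.2 (hlow z' hz' hadj))
      · rwa [hT.eq_of_adj_of_dist_lt r hadj hz₁.1 h hz₁.2]
  have hdist : ∀ z, P z → z = x ∨ T.dist r x < T.dist r z := by
    intro z hz
    induction hz using Relation.ReflTransGen.head_induction_on with
    | refl => exact .inl rfl
    | head hab _ ih =>
      rcases ih with rfl | h
      · exact .inr hab.2
      · exact .inr (h.trans hab.2)
  rcases hdist y (hall y hy) with h | h
  · exact hyx h
  · exact absurd h (not_lt.2 hyd)

/-- State of the elimination of the nodes of a tree, leaf by leaf: the eliminated nodes are those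
in `dead`, and each node has been merged into the remaining node `ρ x`. -/
structure Elimination {V : Type*} (T : SimpleGraph V) (dead : Set V) (ρ : V → V) : Prop where
  alive : ∀ x, ρ x ∉ dead
  fixed : ∀ x, x ∉ dead → ρ x = x
  adj : ∀ x y, x ∈ dead → T.Adj x y → ρ x = ρ y

theorem Elimination.start {V : Type*} (T : SimpleGraph V) : T.Elimination ∅ id where
  alive _ := id
  fixed _ _ := rfl
  adj _ _ h := h.elim

/-- Everything merged into `a` is redirected to `b`. For the newly dead `a`, a dead neighbour was
already merged into `a` and moves along with it, while an alive neighbour is `b` itself. If `a` was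
dead before, nothing changes. -/
theorem Elimination.step {V : Type*} [DecidableEq V] {T : SimpleGraph V} {dead : Set V} {ρ : V → V}
    (h : T.Elimination dead ρ) {a b : V} (hb : b ∉ dead) (hab : T.Adj a b)
    (huniq : ∀ y, T.Adj a y → y ∉ dead → y = b) :
    T.Elimination (insert a dead) (fun x => if ρ x = a then b else ρ x) := by
  by_cases ha : a ∈ dead
  · have hne : ∀ x, ρ x ≠ a := fun x hx => h.alive x (hx ▸ ha)
    simpa [hne, Set.insert_eq_of_mem ha] using h
  have hba : b ≠ a := hab.ne'
  refine ⟨fun x => ?_, fun x hx => ?_, fun x y hx hxy => ?_⟩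
  · split_ifs with hx
    · simp [hba, hb]
    · simp [hx, h.alive x]
  · rw [Set.mem_insert_iff, not_or] at hx
    simp [h.fixed x hx.2, hx.1]
  · rcases Set.mem_insert_iff.1 hx with rfl | hx
    · rw [if_pos (h.fixed _ ha)]
      by_cases hy : y ∈ dead
      · rw [if_pos]
        rw [h.adj y x hy hxy.symm, h.fixed x ha]
      · rw [huniq y hxy hy, h.fixed b hb, if_neg hba]
    · rw [h.adj x y hx hxy]

/-- An alive node `a` at maximal distance from `x₁` works: its alive neighbours are all closer to
`x₁`, and there is at most one closer neighbour. If there were none, `ρ` would be constantly `a`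
along every walk from `a`, hence everywhere, although it fixes the two distinct alive nodes. -/
theorem Elimination.exists_leaf {V : Type*} [Finite V] {T : SimpleGraph V} (hT : T.IsTree)
    {dead : Set V} {ρ : V → V} (h : T.Elimination dead ρ) {x₁ x₂ : V} (h₁ : x₁ ∉ dead)
    (h₂ : x₂ ∉ dead) (hne : x₁ ≠ x₂) :
    ∃ a, a ∉ dead ∧ ∃ b, (T.Adj a b ∧ b ∉ dead) ∧ ∀ y, T.Adj a y → y ∉ dead → y = b := by
  obtain ⟨a, ha, hmax⟩ := Set.exists_max_image {x | x ∉ dead} (T.dist x₁) (Set.toFinite _)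
    ⟨x₁, h₁⟩
  have hlt : ∀ y, T.Adj a y → y ∉ dead → T.dist x₁ y < T.dist x₁ a := fun y hy hyd =>
    lt_of_le_of_ne (hmax y hyd) (hT.dist_ne_of_adj x₁ hy).symm
  refine ⟨a, ha, ?_⟩
  by_contra! hcon
  have hno : ∀ y, T.Adj a y → y ∈ dead := by
    intro y hy
    by_contra hyd
    obtain ⟨z, hz, hzd, hzy⟩ := hcon y ⟨hy, hyd⟩
    exact hzy (hT.eq_of_adj_of_dist_lt x₁ hz hy (hlt z hz hzd) (hlt y hy hyd))
  have hall : ∀ y, ρ y = a := by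
    intro y
    obtain ⟨p⟩ := hT.connected a y
    have key : ∀ {u v : V}, T.Walk u v → ρ u = a → ρ v = a := by
      intro u v p
      induction p with
      | nil => exact id
      | @cons u v _ huv _ ih =>
        intro hu
        refine ih ?_
        by_cases hud : u ∈ dead
        · rw [← h.adj u v hud huv, hu]
        · rw [h.fixed u hud] at hu
          subst hu
          rw [h.adj v u (hno v huv) huv.symm, h.fixed u hud]
    exact key p (h.fixed a ha)
  exact hne (by rw [← h.fixed x₁ h₁, ← h.fixed x₂ h₂, hall, hall])

end SimpleGraph

/-! ### Edge counting, good sets and the exchange argument -/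

namespace VDS

variable {n m : ℕ} {G : SimpleGraph (Fin n)} {t : Fin n → ℕ}

theorem TreeDecomposition.card_bag_le (D : TreeDecomposition G m) (α : Fin m) :
    (D.bag α).card ≤ D.width + 1 := by
  have := Finset.le_sup (f := fun α : Fin m => (D.bag α).card) (Finset.mem_univ α)
  unfold TreeDecomposition.width
  omega

/-- Every vertex is assigned one of its bags, so that of any two adjacent vertices one
lies in the bag assigned to the other. -/
theorem TreeDecomposition.exists_orientation (D : TreeDecomposition G m) :
    ∃ top : Fin n → Fin m, (∀ v, v ∈ D.bag (top v)) ∧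
      ∀ u v, G.Adj u v → v ∈ D.bag (top u) ∨ u ∈ D.bag (top v) := by
  have hmin : ∀ v : Fin n, ∃ a, v ∈ D.bag a ∧
      ∀ b, v ∈ D.bag b → D.tree.dist D.root a ≤ D.tree.dist D.root b := fun v => by
    obtain ⟨a, ha, h⟩ := Set.exists_min_image {a | v ∈ D.bag a} (D.tree.dist D.root)
      (Set.toFinite _) (D.cover_vertex v)
    exact ⟨a, ha, h⟩
  choose top htop hle using hmin
  refine ⟨top, htop, fun u v huv => ?_⟩
  -- Let `c` be a node closest to the root whose bag contains both endpoints. If it were the top of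
  -- neither subtree, its parent would lie in both, contradicting minimality.
  obtain ⟨c, ⟨hcu, hcv⟩, hc⟩ := Set.exists_min_image {a | u ∈ D.bag a ∧ v ∈ D.bag a}
    (D.tree.dist D.root) (Set.toFinite _) (D.cover_edge u v huv)
  have key : ∀ x : Fin n, x ∈ D.bag c →
      (∀ y ∈ {a | x ∈ D.bag a}, y = c ∨ D.tree.dist D.root c < D.tree.dist D.root y) →
      top x = c := by
    intro x hx h
    rcases h (top x) (htop x) with h | h
    · exact h
    · exact absurd h (not_lt.2 (hle x c hx))
  rcases D.isTree.exists_adj_dist_lt_or D.root (D.connected u) hcu with ⟨y, hy, hcy, hyd⟩ | h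
  · rcases D.isTree.exists_adj_dist_lt_or D.root (D.connected v) hcv with ⟨z, hz, hcz, hzd⟩ | h
    · obtain rfl := D.isTree.eq_of_adj_of_dist_lt D.root hcy hcz hyd hzd
      exact absurd hyd (not_lt.2 (hc y ⟨hy, hz⟩))
    · exact .inr (key v hcv h ▸ hcu)
  · exact .inl (key u hcu h ▸ hcv)

open Classical in
/-- Number of neighbours of `v` in `S`. -/
noncomputable def cnt (G : SimpleGraph (Fin n)) (S : Finset (Fin n)) (v : Fin n) : ℕ :=
  (S.filter (fun u => G.Adj v u)).card

/-- Vector dominating sets that contain all vertices with threshold above `K`. -/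
def KGood (G : SimpleGraph (Fin n)) (t : Fin n → ℕ) (K : ℕ) (S : Finset (Fin n)) : Prop :=
  ∀ v, v ∉ S → t v ≤ min K (cnt G S v)

theorem KGood.isSolution {K : ℕ} {S : Finset (Fin n)} (h : KGood G t K S) : IsSolution G t S :=
  fun v hv => (h v hv).trans (min_le_right _ _)

theorem exists_isSolution_card_eq_opt (G : SimpleGraph (Fin n)) (t : Fin n → ℕ) :
    ∃ S : Finset (Fin n), IsSolution G t S ∧ S.card = opt G t :=
  Nat.sInf_mem (s := {k : ℕ | ∃ S : Finset (Fin n), IsSolution G t S ∧ S.card = k})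
    ⟨_, Finset.univ, fun v hv => absurd (Finset.mem_univ v) hv, rfl⟩

open Classical in
/-- A graph of tree width `w` has at most `w (|A| + |S|)` edges between disjoint sets
`A` and `S`. -/
theorem TreeDecomposition.sum_cnt_le (D : TreeDecomposition G m) (A S : Finset (Fin n)) :
    ∑ v ∈ A, cnt G S v ≤ D.width * (A.card + S.card) := by
  obtain ⟨top, htop, hor⟩ := D.exists_orientation
  have hbag : ∀ v, ((D.bag (top v)).erase v).card ≤ D.width := fun v => by
    have := D.card_bag_le (top v)
    rw [Finset.card_erase_of_mem (htop v)]
    omega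
  -- Every edge is charged to the endpoint whose assigned bag contains the other one: `E₁` collects
  -- charges to `A` and `E₂` charges to `S`. A bag without its owner has at most `D.width` elements.
  let E₁ := A.sigma fun v => (D.bag (top v)).erase v
  let E₂ := S.sigma fun v => (D.bag (top v)).erase v
  have hE₁ : E₁.card ≤ D.width * A.card := by
    rw [Finset.card_sigma, mul_comm]
    exact Finset.sum_le_card_nsmul _ _ _ fun v _ => hbag v
  have hE₂ : E₂.card ≤ D.width * S.card := by
    rw [Finset.card_sigma, mul_comm]
    exact Finset.sum_le_card_nsmul _ _ _ fun v _ => hbag v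
  have hsum : ∑ v ∈ A, cnt G S v = (A.sigma fun v => S.filter fun u => G.Adj v u).card := by
    rw [Finset.card_sigma]; rfl
  rw [hsum, mul_add]
  refine le_trans ?_ (Nat.add_le_add hE₁ hE₂)
  let sw : (_ : Fin n) × Fin n ↪ (_ : Fin n) × Fin n :=
    ⟨fun e => ⟨e.2, e.1⟩, fun a b h => by
      cases a; cases b; simp at h; simp [h]⟩
  rw [← Finset.card_map (s := E₂) sw]
  refine (Finset.card_le_card ?_).trans (Finset.card_union_le _ _)
  rintro ⟨v, u⟩ h
  simp only [Finset.mem_sigma, Finset.mem_filter] at h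
  obtain ⟨hv, hu, hadj⟩ := h
  rw [Finset.mem_union]
  rcases hor v u hadj with h | h
  · left
    simp only [E₁, Finset.mem_sigma, Finset.mem_erase]
    exact ⟨hv, hadj.ne', h⟩
  · right
    rw [Finset.mem_map]
    refine ⟨⟨u, v⟩, ?_, rfl⟩
    simp only [E₂, Finset.mem_sigma, Finset.mem_erase]
    exact ⟨hu, hadj.ne, h⟩

open Classical in
theorem cnt_mono {S S' : Finset (Fin n)} (h : S ⊆ S') (v : Fin n) : cnt G S v ≤ cnt G S' v :=
  Finset.card_le_card (Finset.filter_subset_filter _ h)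

open Classical in
/-- Taking all vertices with large thresholds is cheap. -/
theorem exists_kGood (D : TreeDecomposition G m) (t : Fin n → ℕ) {q : ℕ} {K : ℕ}
    (hK : D.width * q + D.width ≤ K) :
    ∃ S, KGood G t K S ∧ D.width * q * S.card ≤ D.width * (q + 1) * opt G t := by
  obtain ⟨S, hS, hcard⟩ := exists_isSolution_card_eq_opt G t
  let A := Finset.univ.filter fun v => K < t v ∧ v ∉ S
  refine ⟨S ∪ A, fun v hv => ?_, ?_⟩
  · rw [Finset.mem_union, not_or] at hv
    have h1 := (hS v hv.1).trans (cnt_mono (G := G) (Finset.subset_union_left (s₂ := A)) v)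
    have h2 : ¬ K < t v := fun h => hv.2 (by simp [A, h, hv.1])
    exact le_min (not_lt.1 h2) h1
  · have h1 : K * A.card ≤ ∑ v ∈ A, cnt G S v := by
      rw [mul_comm]
      refine Finset.card_nsmul_le_sum _ _ _ fun v hv => ?_
      simp only [A, Finset.mem_filter, Finset.mem_univ, true_and] at hv
      exact hv.1.le.trans (hS v hv.2)
    have h2 := h1.trans (D.sum_cnt_le A S)
    have h3 := Finset.card_union_le S A
    rw [← hcard]
    -- With w = `D.width`, (wq + w)|A| ≤ K|A| ≤ w(|A| + |S|) leaves wq|A| ≤ w|S|. The factor w is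
    -- kept on both sides because it may be zero here.
    nlinarith [Nat.mul_le_mul_right A.card hK, Nat.mul_le_mul_left (D.width * q) h3]

/-- `F` contains enough restrictions to `V` of good sets: every good set can be altered
inside `V` so that it agrees there with a member of `F`, remaining good and of the same size. -/
def Represents (G : SimpleGraph (Fin n)) (t : Fin n → ℕ) (K : ℕ) (V : Finset (Fin n))
    (F : Set (Finset (Fin n))) : Prop :=
  ∀ S, KGood G t K S → ∃ A ∈ F, KGood G t K (S \ V ∪ A ∩ V) ∧ (S \ V ∪ A ∩ V).card = S.card

theorem represents_empty {K : ℕ} {F : Set (Finset (Fin n))} (hF : F.Nonempty) :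
    Represents G t K ∅ F := by
  obtain ⟨A, hA⟩ := hF
  intro S hS
  exact ⟨A, hA, by simpa using hS⟩

/-- Only the trace of a member of `F` on `{v}` is used, so `∅` and `Finset.univ` stand for leaving
out and taking any single vertex. -/
theorem represents_singleton {K : ℕ} {F : Set (Finset (Fin n))} (v : Fin n) (h0 : ∅ ∈ F)
    (h1 : Finset.univ ∈ F) : Represents G t K {v} F := by
  intro S hS
  by_cases hv : v ∈ S
  · refine ⟨_, h1, ?_⟩
    have : S \ {v} ∪ Finset.univ ∩ {v} = S := by ext x; by_cases hx : x = v <;> simp [hx, hv]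
    rw [this]
    exact ⟨hS, rfl⟩
  · refine ⟨_, h0, ?_⟩
    have : S \ {v} ∪ ∅ ∩ {v} = S := by
      ext x
      by_cases hx : x = v <;> simp [hx, hv]
    rw [this]
    exact ⟨hS, rfl⟩

/-- The two exchanges are carried out one after the other, first inside `V₂`, then inside `V₁`. The
sets may overlap, and on the overlap the later choice wins, which dictates the form `A ∩ V₁ ∪ B \
V₁`. -/
theorem Represents.merge {K : ℕ} {V₁ V₂ : Finset (Fin n)} {F₁ F₂ : Set (Finset (Fin n))}
    (h₁ : Represents G t K V₁ F₁) (h₂ : Represents G t K V₂ F₂) :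
    Represents G t K (V₂ ∪ V₁) {C | ∃ A ∈ F₁, ∃ B ∈ F₂, C = A ∩ V₁ ∪ B \ V₁} := by
  intro S hS
  obtain ⟨B, hB, hSB, hcB⟩ := h₂ S hS
  obtain ⟨A, hA, hSA, hcA⟩ := h₁ _ hSB
  refine ⟨_, ⟨A, hA, B, hB, rfl⟩, ?_⟩
  have : S \ (V₂ ∪ V₁) ∪ (A ∩ V₁ ∪ B \ V₁) ∩ (V₂ ∪ V₁) = (S \ V₂ ∪ B ∩ V₂) \ V₁ ∪ A ∩ V₁ := by
    ext x
    simp only [Finset.mem_union, Finset.mem_sdiff, Finset.mem_inter]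
    tauto
  rw [this]
  exact ⟨hSA, hcA.trans hcB⟩

/-- The vertices of `V` outside the bag `X` are dominated by `A`. -/
def InnerGood (G : SimpleGraph (Fin n)) (t : Fin n → ℕ) (K : ℕ) (V X A : Finset (Fin n)) : Prop :=
  ∀ v ∈ V, v ∉ X → v ∉ A → t v ≤ min K (cnt G A v)

/-- `A` and `B` look the same from outside, through the bag `X`. -/
def SameSig (G : SimpleGraph (Fin n)) (K : ℕ) (X A B : Finset (Fin n)) : Prop :=
  A.card = B.card ∧ ∀ v ∈ X, (v ∈ A ↔ v ∈ B) ∧ min K (cnt G A v) = min K (cnt G B v)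

open Classical in
theorem cnt_union {A B : Finset (Fin n)} (h : Disjoint A B) (v : Fin n) :
    cnt G (A ∪ B) v = cnt G A v + cnt G B v := by
  unfold cnt
  rw [Finset.filter_union, Finset.card_union_of_disjoint (Finset.disjoint_filter_filter h)]

open Classical in
theorem cnt_congr {A B : Finset (Fin n)} {v : Fin n} (h : ∀ u, G.Adj v u → (u ∈ A ↔ u ∈ B)) :
    cnt G A v = cnt G B v := by
  unfold cnt
  congr 1
  ext u
  simp only [Finset.mem_filter]
  exact ⟨fun hu => ⟨(h u hu.2).1 hu.1, hu.2⟩, fun hu => ⟨(h u hu.2).2 hu.1, hu.2⟩⟩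

/-- Replacing `A` by `B` of the same signature preserves goodness. A vertex of `V` outside `X` has
all its neighbours in `V`, so inner goodness of `B` settles it. A vertex outside `V` sees `V` only
through `X`, where `A` and `B` agree. On `X` the capped counts agree, and the contribution from
outside `V` is unchanged. -/
theorem Represents.prune {K : ℕ} {V X : Finset (Fin n)} {F₀ F : Set (Finset (Fin n))}
    (h : Represents G t K V F₀) (hX : ∀ v ∈ V, v ∉ X → ∀ u, G.Adj v u → u ∈ V)
    (hF₀ : ∀ A ∈ F₀, A ⊆ V)
    (hF : ∀ A ∈ F₀, InnerGood G t K V X A →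
      ∃ B ∈ F, B ⊆ V ∧ InnerGood G t K V X B ∧ SameSig G K X A B) :
    Represents G t K V F := by
  intro S hS
  obtain ⟨A, hA, hgood, hcard⟩ := h S hS
  have hAV := hF₀ A hA
  rw [Finset.inter_eq_left.2 hAV] at hgood hcard
  have hdisj : ∀ C ⊆ V, Disjoint (S \ V) C := fun C hC =>
    Finset.disjoint_of_subset_right hC Finset.sdiff_disjoint
  have hinner : InnerGood G t K V X A := by
    intro v hv hvX hvA
    have h1 := hgood v (by simp [hv, hvA])
    rwa [cnt_congr (B := A) fun u hu => by simp [hX v hv hvX u hu]] at h1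
  obtain ⟨B, hB, hBV, hBi, hsz, hsig⟩ := hF A hA hinner
  refine ⟨B, hB, ?_⟩
  rw [Finset.inter_eq_left.2 hBV]
  constructor
  · intro v hv
    rw [Finset.mem_union, not_or] at hv
    by_cases hvV : v ∈ V
    · by_cases hvX : v ∈ X
      · obtain ⟨hm, hc⟩ := hsig v hvX
        have h1 := hgood v (by simp [hvV, hm, hv.2])
        rw [cnt_union (hdisj A hAV)] at h1
        rw [cnt_union (hdisj B hBV)]
        -- Capped counts suffice, since min K (a + x) depends only on a and min K x.
        omega
      · rw [cnt_congr (B := B) fun u hu => by simp [hX v hvV hvX u hu]]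
        exact hBi v hvV hvX hv.2
    · have h1 := hgood v (by
        rw [Finset.mem_union, not_or]
        exact ⟨hv.1, fun h => hvV (hAV h)⟩)
      rwa [cnt_congr (B := S \ V ∪ B)] at h1
      intro u hu
      by_cases huX : u ∈ X
      · simp [(hsig u huX).1]
      · have huV : u ∉ V := fun h => hvV (hX u h huX v hu.symm)
        have hA' : u ∉ A := fun h => huV (hAV h)
        have hB' : u ∉ B := fun h => huV (hBV h)
        simp [hA', hB']
  · rw [← hcard, Finset.card_union_of_disjoint (hdisj A hAV),
      Finset.card_union_of_disjoint (hdisj B hBV), hsz]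

/-- Upper bound for the number of signatures. -/
def sigBound (n K W : ℕ) : ℕ := (n + 1) * (2 * (K + 1)) ^ W

open Classical in
-- A signature consists of a cardinality up to `n` and, for each vertex of `X`, a membership bit and
-- a count up to `K`. Sets with pairwise different signatures inject into such data.
theorem card_le_sigBound {K W k : ℕ} {X : Finset (Fin n)} (hX : X.card ≤ W)
    (A : ℕ → Finset (Fin n)) (h : ∀ i j, i < j → j < k → ¬ SameSig G K X (A i) (A j)) :
    k ≤ sigBound n K W := by
  let f : Fin k → Fin (n + 1) × (X → Bool × Fin (K + 1)) := fun i =>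
    (⟨(A i).card, by have := Finset.card_le_univ (A i); simp at this; omega⟩,
      fun v => (decide (v.1 ∈ A i), ⟨min K (cnt G (A i) v), by omega⟩))
  have hsig : ∀ i j, f i = f j → SameSig G K X (A i) (A j) := by
    intro i j hij
    simp only [f, Prod.mk.injEq, Fin.mk.injEq, funext_iff, decide_eq_decide] at hij
    exact ⟨hij.1, fun v hv => hij.2 ⟨v, hv⟩⟩
  have hinj : Function.Injective f := by
    intro i j hij
    by_contra hne
    rcases lt_or_gt_of_ne hne with hlt | hlt
    · exact h i j hlt j.2 (hsig i j hij)
    · exact h j i hlt i.2 (hsig j i hij.symm)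
  have hc := Fintype.card_le_of_injective f hinj
  simp only [Fintype.card_fin, Fintype.card_prod, Fintype.card_fun, Fintype.card_bool,
    Fintype.card_coe] at hc
  refine hc.trans (Nat.mul_le_mul_left _ ?_)
  exact Nat.pow_le_pow_right (by omega) hX

open Classical in
/-- The union of the bags of the nodes that have been merged into `p`. -/
noncomputable def partVerts (D : TreeDecomposition G m) (ρ : Fin m → Fin m) (p : Fin m) :
    Finset (Fin n) :=
  Finset.univ.filter fun v => ∃ x, ρ x = p ∧ v ∈ D.bag x

theorem mem_partVerts {D : TreeDecomposition G m} {ρ : Fin m → Fin m} {p : Fin m} {v : Fin n} :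
    v ∈ partVerts D ρ p ↔ ∃ x, ρ x = p ∧ v ∈ D.bag x := by
  simp [partVerts]

/-- The separation property. A node that contains `v` and was merged into `p` differs from `p`, as
`v` is not in the bag of `p`; so it is dead, and its neighbours were merged into `p` too. By
connectedness all nodes containing `v` belong to the part, among them one that covers the edge to
`u`. -/
theorem mem_partVerts_of_adj {D : TreeDecomposition G m} {dead : Set (Fin m)}
    {ρ : Fin m → Fin m} (h : D.tree.Elimination dead ρ) {p : Fin m} {v u : Fin n}
    (hv : v ∈ partVerts D ρ p) (hvp : v ∉ D.bag p) (hadj : G.Adj v u) : u ∈ partVerts D ρ p := by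
  obtain ⟨x, hx, hvx⟩ := mem_partVerts.1 hv
  obtain ⟨c, hcv, hcu⟩ := D.cover_edge v u hadj
  refine mem_partVerts.2 ⟨c, ?_, hcu⟩
  refine (D.connected v).forall_of_induce (fun z => ρ z = p) ?_ (x := x) hvx hx c hcv
  intro z hz z' _ hzz hzp
  have hzd : z ∈ dead := by
    by_contra hzd
    rw [h.fixed z hzd] at hzp
    exact hvp (hzp ▸ hz)
  rw [← h.adj z z' hzd hzz, hzp]

end VDS

/-! ### Hoare logic with step counts -/

namespace RAM

@[ext]
theorem State.ext' {s s' : State} (hr : ∀ r, s.reg r = s'.reg r)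
    (ha : ∀ a i, s.arr a i = s'.arr a i) : s = s' := by
  cases s; cases s'
  congr
  · exact funext hr
  · exact funext fun a => funext (ha a)

@[simp]
theorem State.reg_setReg (s : State) (r x r' : ℕ) :
    (s.setReg r x).reg r' = if r' = r then x else s.reg r' := by
  simp [State.setReg, Function.update_apply]

@[simp]
theorem State.arr_setReg (s : State) (r x : ℕ) : (s.setReg r x).arr = s.arr := rfl

@[simp]
theorem State.reg_setArr (s : State) (a i x : ℕ) : (s.setArr a i x).reg = s.reg := rfl

@[simp]
theorem State.arr_setArr (s : State) (a i x a' j : ℕ) :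
    (s.setArr a i x).arr a' j = if a' = a ∧ j = i then x else s.arr a' j := by
  simp only [State.setArr, Function.update_apply]
  by_cases h : a' = a
  · subst h; simp [Function.update_apply]
  · simp [h]

/-- The memory after the entries of array `a` with indices `b, …, b + k - 1` have been set to
`f 0, …, f (k - 1)` by a loop with counter `r`. -/
def State.fill (s : State) (r a b k : ℕ) (f : ℕ → ℕ) : State where
  reg := Function.update s.reg r k
  arr := Function.update s.arr a fun j => if b ≤ j ∧ j < b + k then f (j - b) else s.arr a j

@[simp]
theorem State.reg_fill (s : State) (r a b k : ℕ) (f : ℕ → ℕ) (r' : ℕ) :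
    (s.fill r a b k f).reg r' = if r' = r then k else s.reg r' := by
  simp [State.fill, Function.update_apply]

@[simp]
theorem State.arr_fill (s : State) (r a b k : ℕ) (f : ℕ → ℕ) (a' j : ℕ) :
    (s.fill r a b k f).arr a' j =
      if a' = a ∧ b ≤ j ∧ j < b + k then f (j - b) else s.arr a' j := by
  simp only [State.fill, Function.update_apply]
  by_cases h : a' = a
  · subst h; simp
  · simp [h]

attribute [simp] Expr.eval

/-- Started on memory `s`, the program `p` halts within `T` steps, and the final memory
satisfies `Q`. -/
def Spec (p : Prog) (s : State) (T : ℕ) (Q : State → Prop) : Prop :=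
  ∃ T' s', RunsIn p s T' s' ∧ T' ≤ T ∧ Q s'

variable {p q : Prog} {s : State} {T T₁ T₂ : ℕ} {Q Q' : State → Prop}

theorem Spec.weaken (h : Spec p s T₁ Q) (hT : T₁ ≤ T) : Spec p s T Q := by
  obtain ⟨T', s', hr, hT', hQ⟩ := h
  exact ⟨T', s', hr, hT'.trans hT, hQ⟩

theorem Spec.post (h : Spec p s T Q) (hQ : ∀ s', Q s' → Q' s') : Spec p s T Q' := by
  obtain ⟨T', s', hr, hT', h⟩ := h
  exact ⟨T', s', hr, hT', hQ _ h⟩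

theorem Spec.congr_state {s' : State} (hs : s' = s) (h : Spec p s T Q) : Spec p s' T Q := hs ▸ h

theorem Spec.skip (h : Q s) : Spec .skip s 1 Q := ⟨_, _, .skip s, le_rfl, h⟩

theorem Spec.assign {r : ℕ} {e : Expr} (h : Q (s.setReg r (e.eval s))) :
    Spec (.assign r e) s (e.cost + 1) Q := ⟨_, _, .assign r e s, le_rfl, h⟩

theorem Spec.store {a : ℕ} {i e : Expr} (h : Q (s.setArr a (i.eval s) (e.eval s))) :
    Spec (.store a i e) s (i.cost + e.cost + 1) Q := ⟨_, _, .store a i e s, le_rfl, h⟩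

theorem Spec.seq (h : Spec p s T₁ fun s' => Spec q s' T₂ Q) : Spec (.seq p q) s (T₁ + T₂) Q := by
  obtain ⟨T', s', hr, hT', T'', s'', hr', hT'', h⟩ := h
  exact ⟨_, _, .seq hr hr', Nat.add_le_add hT' hT'', h⟩

theorem Spec.seq_of (h : Spec p s T₁ Q') (h' : ∀ s', Q' s' → Spec q s' T₂ Q) :
    Spec (.seq p q) s (T₁ + T₂) Q :=
  Spec.seq (h.post h')

theorem Spec.cond {e : Expr} (h₁ : e.eval s ≠ 0 → Spec p s T Q) (h₂ : e.eval s = 0 → Spec q s T Q) :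
    Spec (.cond e p q) s (e.cost + 1 + T) Q := by
  by_cases he : e.eval s = 0
  · obtain ⟨T', s', hr, hT', h⟩ := h₂ he
    exact ⟨_, _, .condFalse he hr, by omega, h⟩
  · obtain ⟨T', s', hr, hT', h⟩ := h₁ he
    exact ⟨_, _, .condTrue he hr, by omega, h⟩

/-- The invariant is indexed by the number of completed rounds, so that it also determines
termination: the guard holds before round `k` and fails after it. The induction shifts the index. -/
theorem Spec.loop {e : Expr} (I : ℕ → State → Prop) {k : ℕ} (h0 : I 0 s)
    (he : ∀ i s, i < k → I i s → e.eval s ≠ 0) (hk : ∀ s, I k s → e.eval s = 0)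
    (hb : ∀ i s, i < k → I i s → Spec p s T (I (i + 1))) :
    Spec (.loop e p) s (k * (T + e.cost + 1) + e.cost + 1) (I k) := by
  induction k generalizing s I with
  | zero => exact ⟨_, _, .loopDone (hk s h0), by omega, h0⟩
  | succ k ih =>
    obtain ⟨T', s', hr, hT', h⟩ := hb 0 s (by omega) h0
    obtain ⟨T'', s'', hr', hT'', h'⟩ := ih (fun i => I (i + 1)) h (fun i s hi => he (i + 1) s (by omega))
      hk (fun i s hi => hb (i + 1) s (by omega))
    refine ⟨_, _, .loopStep (he 0 s (by omega) h0) hr hr', ?_, h'⟩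
    rw [Nat.add_mul]
    omega

/-- `for r := lo; r < hi; r := r + step do body`. -/
def forLoop (r : ℕ) (lo hi step : Expr) (body : Prog) : Prog :=
  .seq (.assign r lo) (.loop (.sub hi (.reg r)) (.seq body (.assign r (.add (.reg r) step))))

theorem Spec.forLoop {r : ℕ} {lo hi step : Expr} {l d k : ℕ} (I : ℕ → State → Prop) (hd : 0 < d)
    (h0 : I 0 (s.setReg r (lo.eval s)))
    (hI : ∀ i s, i ≤ k → I i s → s.reg r = l + d * i ∧ hi.eval s = l + d * k)
    (hb : ∀ i s, i < k → I i s →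
      Spec p s T fun s' => I (i + 1) (s'.setReg r (s'.reg r + step.eval s'))) :
    Spec (forLoop r lo hi step p) s (k * (T + (hi.cost + step.cost + 6)) + (lo.cost + hi.cost + 4))
      (I k) := by
  refine Spec.weaken (Spec.seq (Spec.assign (Spec.loop I h0 ?_ ?_
    (fun i s hi h => Spec.seq (Spec.post (hb i s hi h) fun s' h' => Spec.assign h'))))) ?_
  · intro i s hik h
    obtain ⟨h1, h2⟩ := hI i s hik.le h
    have : d * i < d * k := by gcongr
    simp only [Expr.eval, h1, h2]
    omega
  · intro s h
    obtain ⟨h1, h2⟩ := hI k s le_rfl h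
    simp only [Expr.eval, h1, h2]
    omega
  · simp only [Expr.cost]
    ring_nf
    omega

/-- `for r := 0; r < hi; r := r + 1 do body`. -/
abbrev countLoop (r : ℕ) (hi : Expr) (body : Prog) : Prog := forLoop r (.const 0) hi (.const 1) body

theorem Spec.countLoop {r : ℕ} {hi : Expr} {k : ℕ} (I : ℕ → State → Prop)
    (h0 : I 0 (s.setReg r 0)) (hI : ∀ i s, i ≤ k → I i s → s.reg r = i ∧ hi.eval s = k)
    (hb : ∀ i s, i < k → I i s → Spec p s T fun s' => I (i + 1) (s'.setReg r (s'.reg r + 1))) :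
    Spec (countLoop r hi p) s (k * (T + (hi.cost + 7)) + (hi.cost + 5)) (I k) := by
  refine Spec.weaken (Spec.forLoop (l := 0) (d := 1) (T := T) I one_pos h0 ?_ hb) ?_
  · intro i s hi h
    simpa using hI i s hi h
  · simp only [Expr.cost]
    ring_nf
    omega

/-- Add the values of `e` for `r = 0, …, hi - 1`, where `g ≠ 0`, to `acc`. -/
def sumLoop (r acc : ℕ) (hi g e : Expr) : Prog :=
  countLoop r hi (.cond g (.assign acc (.add (.reg acc) e)) .skip)

/-- The memory is known exactly after each round, differing from `s` only in counter and
accumulator. Hence guard and summand must give `f i` whatever the accumulator contains. -/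
theorem Spec.sumLoop {r acc : ℕ} {hi g e : Expr} {k : ℕ} (f : ℕ → ℕ) (hne : r ≠ acc)
    (hk : ∀ i x, hi.eval ((s.setReg acc x).setReg r i) = k)
    (hf : ∀ i x, i < k → (if g.eval ((s.setReg acc x).setReg r i) ≠ 0 then
      e.eval ((s.setReg acc x).setReg r i) else 0) = f i)
    (hQ : Q ((s.setReg acc (s.reg acc + ∑ i ∈ Finset.range k, f i)).setReg r k)) :
    Spec (sumLoop r acc hi g e) s
      (k * (g.cost + e.cost + hi.cost + 12) + (hi.cost + 5)) Q := by
  refine Spec.weaken (Spec.post (Spec.countLoop (T := g.cost + 1 + (e.cost + 3))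
    (fun i s' => s' = (s.setReg acc (s.reg acc + ∑ i ∈ Finset.range i, f i)).setReg r i)
    (k := k) ?_ ?_ ?_) ?_) ?_
  · ext r' <;> simp
    split_ifs <;> simp_all
  · rintro i s' hi rfl
    exact ⟨by simp, hk _ _⟩
  · rintro i s' hi rfl
    have hf' := hf i (s.reg acc + ∑ i ∈ Finset.range i, f i) hi
    refine Spec.cond (fun hg => ?_) (fun hg => ?_)
    · refine Spec.weaken (Spec.assign ?_) (by simp only [Expr.cost]; omega)
      rw [if_pos hg] at hf'
      simp only [Expr.eval, hf']
      ext r' <;> simp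
      split_ifs <;> simp_all [Finset.sum_range_succ, add_assoc]
    · refine Spec.weaken (Spec.skip ?_) (by omega)
      rw [if_neg (by simpa using hg)] at hf'
      ext r' <;> simp [Finset.sum_range_succ, ← hf']
      split_ifs <;> simp_all
  · rintro s' rfl; exact hQ
  · ring_nf
    omega

/-- For `r = 0, …, hi - 1`, set the entry `base + r` of array `a` to `e` or `e'`, depending
on whether `g ≠ 0`. -/
def fillLoop (r a : ℕ) (hi base g e e' : Expr) : Prog :=
  countLoop r hi (.cond g (.store a (.add base (.reg r)) e) (.store a (.add base (.reg r)) e'))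

/-- The expressions are evaluated in the partially filled memory, so an entry may be computed from
earlier entries of the same array; this yields tables of multiples without multiplication. -/
theorem Spec.fillLoop {r a : ℕ} {hi base g e e' : Expr} {b k : ℕ} (f : ℕ → ℕ)
    (hk : ∀ i, i ≤ k → hi.eval (s.fill r a b i f) = k)
    (hbase : ∀ i, i < k → base.eval (s.fill r a b i f) = b)
    (hf : ∀ i, i < k → (if g.eval (s.fill r a b i f) ≠ 0 then e.eval (s.fill r a b i f) else
      e'.eval (s.fill r a b i f)) = f i)
    (hQ : Q (s.fill r a b k f)) :
    Spec (fillLoop r a hi base g e e') s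
      (k * (g.cost + base.cost + e.cost + e'.cost + hi.cost + 12) + (hi.cost + 5)) Q := by
  have hstep : ∀ i, ((s.fill r a b i f).setArr a (b + i) (f i)).setReg r (i + 1) =
      s.fill r a b (i + 1) f := by
    intro i
    ext r' j
    · simp; split_ifs <;> simp_all
    · simp only [State.arr_setReg, State.arr_setArr, State.arr_fill]
      by_cases h : r' = a
      · subst h
        by_cases hj : j = b + i
        · subst hj; simp
        · have : (b ≤ j ∧ j < b + (i + 1)) ↔ (b ≤ j ∧ j < b + i) := by omega
          simp [hj, this]
      · simp [h]
  refine Spec.weaken (Spec.post (Spec.countLoop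
    (T := g.cost + 1 + (base.cost + e.cost + e'.cost + 3))
    (fun i s' => s' = s.fill r a b i f) (k := k) ?_ ?_ ?_) ?_) ?_
  · ext r' j <;> simp
  · rintro i s' hi rfl
    exact ⟨by simp, hk _ hi⟩
  · rintro i s' hi rfl
    have hf' := hf i hi
    refine Spec.cond (fun hg => ?_) (fun hg => ?_)
    · refine Spec.weaken (Spec.store ?_) (by simp only [Expr.cost]; omega)
      rw [if_pos hg] at hf'
      simp only [Expr.eval, hbase i hi, hf', State.reg_fill, if_true, State.reg_setArr]
      exact hstep i
    · refine Spec.weaken (Spec.store ?_) (by simp only [Expr.cost]; omega)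
      rw [if_neg (by simpa using hg)] at hf'
      simp only [Expr.eval, hbase i hi, hf', State.reg_fill, if_true, State.reg_setArr]
      exact hstep i
  · rintro s' rfl; exact hQ
  · ring_nf
    omega

/-- `s'` differs from `s` only in the registers in `R` and the arrays in `A`. -/
structure Frame (R A : List ℕ) (s s' : State) : Prop where
  reg : ∀ r, r ∉ R → s'.reg r = s.reg r
  arr : ∀ a, a ∉ A → s'.arr a = s.arr a

theorem Frame.refl (R A : List ℕ) (s : State) : Frame R A s s := ⟨fun _ _ => rfl, fun _ _ => rfl⟩

theorem Frame.trans {R A : List ℕ} {s s' s'' : State} (h : Frame R A s s') (h' : Frame R A s' s'') :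
    Frame R A s s'' :=
  ⟨fun r hr => (h'.reg r hr).trans (h.reg r hr), fun a ha => (h'.arr a ha).trans (h.arr a ha)⟩

theorem Frame.mono {R A R' A' : List ℕ} {s s' : State} (h : Frame R A s s') (hR : R ⊆ R')
    (hA : A ⊆ A') : Frame R' A' s s' :=
  ⟨fun r hr => h.reg r fun h => hr (hR h), fun a ha => h.arr a fun h => ha (hA h)⟩

theorem Frame.setReg {R A : List ℕ} {s s' : State} (h : Frame R A s s') {r x : ℕ} (hr : r ∈ R) :
    Frame R A s (s'.setReg r x) :=
  ⟨fun r' hr' => by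
    rw [State.reg_setReg, if_neg (by rintro rfl; exact hr' hr), h.reg r' hr'], h.arr⟩

theorem Frame.setArr {R A : List ℕ} {s s' : State} (h : Frame R A s s') {a i x : ℕ} (ha : a ∈ A) :
    Frame R A s (s'.setArr a i x) :=
  ⟨h.reg, fun a' ha' => by
    funext j
    rw [State.arr_setArr, if_neg (by rintro ⟨rfl, -⟩; exact ha' ha), h.arr a' ha']⟩

theorem Frame.fill {R A : List ℕ} {s s' : State} (h : Frame R A s s') {r a b k : ℕ} {f : ℕ → ℕ}
    (hr : r ∈ R) (ha : a ∈ A) : Frame R A s (s'.fill r a b k f) :=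
  ⟨fun r' hr' => by
    rw [State.reg_fill, if_neg (by rintro rfl; exact hr' hr), h.reg r' hr'],
  fun a' ha' => by
    funext j
    rw [State.arr_fill, if_neg (by rintro ⟨rfl, -⟩; exact ha' ha), h.arr a' ha']⟩

/-- Bookkeeping for running times: each nested loop with at most `B` rounds raises the power of `B`
by one, and the overheads go into the coefficient. -/
theorem loop_bound {B k T c d e j : ℕ} (hB : 1 ≤ B) (hk : k ≤ B) (hT : T ≤ c * B ^ j) :
    k * (T + d) + e ≤ (c + d + e) * B ^ (j + 1) := by
  have h1 : 1 ≤ B ^ j := Nat.one_le_pow _ _ hB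
  calc k * (T + d) + e ≤ B * (c * B ^ j + d) + e := by gcongr
    _ ≤ B * (c * B ^ j + d * B ^ j) + e * (B * B ^ j) := by
        gcongr
        · exact Nat.le_mul_of_pos_right _ h1
        · exact Nat.le_mul_of_pos_right _ (Nat.mul_pos hB h1)
    _ = _ := by ring

end RAM

/-! ### The program, and correctness of the operations on a single row -/

namespace VDS

open RAM RAM.Expr RAM.Prog

/-! Layout of the memory.

Registers: `3` the cap `K` on neighbour counts, `7` the first free row address, `8` and `9` the
parts to be merged (the first one into the second), `10` the address of the first new row, `11` and
`12` the addresses of the rows to be combined, `13`, `14`, `17` loop counters,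
`15`, `16`, `18` accumulators.

Arrays: `5` multiples of `n`, `6` multiples of `m`, `7` and `8` first and last address of the
family of a part, `9` vertex sets of the parts, `10` rows, i.e. characteristic vectors of vertex
sets, each occupying `n` consecutive entries, `11` the corresponding capped neighbour counts, `12`
the cardinality of the set of each row, `13` the eliminated nodes. Part `m` is auxiliary. -/

/-- Entry for the vertex in register `v` of the mask of the part in register `p`. -/
abbrev maskAt (p v : ℕ) : Expr := get 9 (add (get 5 (reg p)) (reg v))

/-- Entry for the vertex in register `v` of the bag of the node in register `p`. -/
abbrev bagAt (p v : ℕ) : Expr := get 3 (add (get 5 (reg p)) (reg v))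

/-- Adjacency of the vertices in registers `v` and `u`. -/
abbrev adjAt (v u : ℕ) : Expr := get 0 (add (get 5 (reg v)) (reg u))

/-- Entry for the vertex in register `v` of the row with address in register `b`. -/
abbrev rowAt (b v : ℕ) : Expr := get 10 (add (reg b) (reg v))

/-- Capped number of neighbours of the vertex in register `v` in the row with address in
register `b`. -/
abbrev cntAt (b v : ℕ) : Expr := get 11 (add (reg b) (reg v))

/-- Absolute difference. -/
abbrev absDiff (x y : Expr) : Expr := add (sub x y) (sub y x)

/-- Write the combination of the rows at `11` and `12` to the first free row. -/
def buildRow : Prog :=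
  fillLoop 13 10 (reg 0) (reg 7) (maskAt 8 13) (rowAt 11 13) (rowAt 12 13)

/-- Compute the capped neighbour counts of the first free row. -/
def countRow : Prog :=
  countLoop 13 (reg 0) (seq (assign 15 (const 0)) (seq
    (sumLoop 14 15 (reg 0) (adjAt 13 14) (rowAt 7 14))
    (store 11 (add (reg 7) (reg 13)) (sub (reg 3) (sub (reg 3) (reg 15))))))

/-- Compute the cardinality of the set of the first free row. -/
def sizeRow : Prog :=
  seq (assign 15 (const 0)) (seq (sumLoop 13 15 (reg 0) (const 1) (rowAt 7 13))
    (store 12 (reg 7) (reg 15)))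

/-- Set register `16` to zero iff the first free row is good outside the bag. -/
def checkRow : Prog :=
  seq (assign 16 (const 0)) (sumLoop 13 16 (reg 0)
    (sub (sub (maskAt 9 13) (bagAt 9 13)) (rowAt 7 13)) (sub (get 1 (reg 13)) (cntAt 7 13)))

/-- Increase register `16` if one of the new rows has the same signature as the first free row. -/
def searchRow : Prog :=
  forLoop 17 (reg 10) (reg 7) (reg 0) (seq
    (assign 18 (absDiff (get 12 (reg 17)) (get 12 (reg 7)))) (seq
    (sumLoop 13 18 (reg 0) (bagAt 9 13)
      (add (absDiff (rowAt 17 13) (rowAt 7 13)) (absDiff (cntAt 17 13) (cntAt 7 13))))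
    (cond (reg 18) skip (assign 16 (add (reg 16) (const 1))))))

/-- Combine the rows at `11` and `12`, and keep the combination if it is useful. -/
def tryRow : Prog :=
  seq buildRow (seq countRow (seq sizeRow (seq checkRow (seq searchRow
    (cond (reg 16) skip (assign 7 (add (reg 7) (reg 0))))))))

/-- Merge the part in register `8` into the part in register `9`. -/
def absorb : Prog :=
  seq (fillLoop 13 9 (reg 0) (get 5 (reg 9)) (maskAt 8 13) (const 1) (maskAt 9 13)) (seq
    (assign 10 (reg 7)) (seq
    (forLoop 11 (get 7 (reg 8)) (get 8 (reg 8)) (reg 0)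
      (forLoop 12 (get 7 (reg 9)) (get 8 (reg 9)) (reg 0) tryRow)) (seq
    (store 7 (reg 9) (reg 10))
    (store 8 (reg 9) (reg 7)))))

variable {n m : ℕ} {G : SimpleGraph (Fin n)} {t : Fin n → ℕ} {D : TreeDecomposition G m} {K : ℕ}

open Classical in
/-- The part of the memory that is not altered any more after preprocessing. -/
structure Static (G : SimpleGraph (Fin n)) (t : Fin n → ℕ) (D : TreeDecomposition G m) (K : ℕ)
    (s : State) : Prop where
  reg0 : s.reg 0 = n
  reg1 : s.reg 1 = m
  reg3 : s.reg 3 = K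
  adj : ∀ u v : Fin n, s.arr 0 (u * n + v) = if G.Adj u v then 1 else 0
  thr : ∀ v : Fin n, s.arr 1 v = t v
  tree : ∀ x y : Fin m, s.arr 2 (x * m + y) = if D.tree.Adj x y then 1 else 0
  bag : ∀ (x : Fin m) (v : Fin n), s.arr 3 (x * n + v) = if v ∈ D.bag x then 1 else 0
  muln : ∀ p, p ≤ n + m → s.arr 5 p = p * n
  mulm : ∀ p, p ≤ n + m → s.arr 6 p = p * m

theorem Static.frame {R A : List ℕ} {s s' : State} (h : Static G t D K s) (hF : Frame R A s s')
    (hR : ∀ r ∈ [0, 1, 3], r ∉ R := by decide) (hA : ∀ a ∈ [0, 1, 2, 3, 5, 6], a ∉ A := by decide) :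
    Static G t D K s' := by
  simp only [List.mem_cons, List.not_mem_nil, or_false, forall_eq_or_imp, forall_eq] at hR hA
  obtain ⟨r0, r1, r3⟩ := hR
  obtain ⟨a0, a1, a2, a3, a5, a6⟩ := hA
  constructor
  · rw [hF.reg _ r0, h.reg0]
  · rw [hF.reg _ r1, h.reg1]
  · rw [hF.reg _ r3, h.reg3]
  · rw [hF.arr _ a0]; exact h.adj
  · rw [hF.arr _ a1]; exact h.thr
  · rw [hF.arr _ a2]; exact h.tree
  · rw [hF.arr _ a3]; exact h.bag
  · rw [hF.arr _ a5]; exact h.muln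
  · rw [hF.arr _ a6]; exact h.mulm

/-- The set stored in the row with address `b`. -/
def rowSet (n : ℕ) (s : State) (b : ℕ) : Finset (Fin n) :=
  Finset.univ.filter fun v => s.arr 10 (b + v) ≠ 0

/-- The vertex set of part `p`. -/
def maskSet (n : ℕ) (s : State) (p : ℕ) : Finset (Fin n) :=
  Finset.univ.filter fun v => s.arr 9 (p * n + v) ≠ 0

@[simp]
theorem mem_rowSet {s : State} {b : ℕ} {v : Fin n} : v ∈ rowSet n s b ↔ s.arr 10 (b + v) ≠ 0 := by
  simp [rowSet]

@[simp]
theorem mem_maskSet {s : State} {p : ℕ} {v : Fin n} :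
    v ∈ maskSet n s p ↔ s.arr 9 (p * n + v) ≠ 0 := by
  simp [maskSet]

/-- The row with address `b` is a characteristic vector. -/
def IsBool (n : ℕ) (s : State) (b : ℕ) : Prop := ∀ v : Fin n, s.arr 10 (b + v) ≤ 1

/-- The row with address `b` is a characteristic vector, with correct cardinality and counts. -/
structure RowOK (G : SimpleGraph (Fin n)) (K : ℕ) (s : State) (b : ℕ) : Prop where
  bool : IsBool n s b
  cnt : ∀ v : Fin n, s.arr 11 (b + v) = min K (cnt G (rowSet n s b) v)
  size : s.arr 12 b = (rowSet n s b).card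

open Classical in
theorem sum_adj_eq_cnt {s : State} {b : ℕ} (hs : Static G t D K s) (hb : IsBool n s b)
    (v : Fin n) : (∑ u ∈ Finset.range n,
      if s.arr 0 (v * n + u) ≠ 0 then s.arr 10 (b + u) else 0) = cnt G (rowSet n s b) v := by
  rw [Finset.sum_range (fun u => if s.arr 0 (v * n + u) ≠ 0 then s.arr 10 (b + u) else 0), cnt,
    rowSet, Finset.filter_filter, Finset.card_filter]
  refine Finset.sum_congr rfl fun u _ => ?_
  rw [hs.adj]
  have := hb u
  by_cases h : G.Adj v u <;> simp [h]
  split_ifs <;> omega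

theorem sum_row_eq_card {s : State} {b : ℕ} (hb : IsBool n s b) :
    ∑ u ∈ Finset.range n, s.arr 10 (b + u) = (rowSet n s b).card := by
  rw [Finset.sum_range (fun u => s.arr 10 (b + u)), rowSet, Finset.card_filter]
  refine Finset.sum_congr rfl fun u _ => ?_
  have := hb u
  split_ifs <;> omega

theorem sum_range_eq_zero_iff {f : ℕ → ℕ} :
    ∑ i ∈ Finset.range n, f i = 0 ↔ ∀ v : Fin n, f v = 0 := by
  simp only [Finset.sum_eq_zero_iff, Finset.mem_range]
  exact ⟨fun h v => h v v.2, fun h i hi => h ⟨i, hi⟩⟩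

/-- The value computed in register `16` by `checkRow`. -/
def badness (n : ℕ) (s : State) (p b : ℕ) : ℕ :=
  ∑ v ∈ Finset.range n,
    if s.arr 9 (p * n + v) - s.arr 3 (p * n + v) - s.arr 10 (b + v) ≠ 0 then
      s.arr 1 v - s.arr 11 (b + v) else 0

/-- Inequalities are tested by truncated subtraction: `t v - c` vanishes iff `t v ≤ c`, and for
entries that are 0 or 1 the guard is nonzero exactly when `v` is in the mask but in neither bag nor
row. -/
theorem badness_eq_zero_iff {s : State} {p : Fin m} {b : ℕ} (hs : Static G t D K s)
    (hm : ∀ v : Fin n, s.arr 9 (p * n + v) ≤ 1) (hb : RowOK G K s b) :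
    badness n s p b = 0 ↔ InnerGood G t K (maskSet n s p) (D.bag p) (rowSet n s b) := by
  rw [badness, sum_range_eq_zero_iff]
  refine forall_congr' fun v => ?_
  have h1 := hm v
  have h2 := hb.bool v
  rw [hs.bag, hs.thr, hb.cnt, mem_maskSet, mem_rowSet]
  by_cases h : v ∈ D.bag p
  · simp [h]
    omega
  · simp only [h, if_false, not_false_eq_true, true_imp_iff]
    split_ifs <;> omega

/-- The value computed in register `18` by `searchRow`. -/
def sigDist (n : ℕ) (s : State) (p b b' : ℕ) : ℕ :=
  s.arr 12 b - s.arr 12 b' + (s.arr 12 b' - s.arr 12 b) + ∑ v ∈ Finset.range n,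
    if s.arr 3 (p * n + v) ≠ 0 then
      s.arr 10 (b + v) - s.arr 10 (b' + v) + (s.arr 10 (b' + v) - s.arr 10 (b + v)) +
        (s.arr 11 (b + v) - s.arr 11 (b' + v) + (s.arr 11 (b' + v) - s.arr 11 (b + v))) else 0

theorem sigDist_eq_zero_iff {s : State} {p : Fin m} {b b' : ℕ} (hs : Static G t D K s)
    (hb : RowOK G K s b) (hb' : RowOK G K s b') :
    sigDist n s p b b' = 0 ↔ SameSig G K (D.bag p) (rowSet n s b) (rowSet n s b') := by
  rw [sigDist, Nat.add_eq_zero_iff, sum_range_eq_zero_iff]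
  refine and_congr ?_ (forall_congr' fun v => ?_)
  · rw [hb.size, hb'.size]
    omega
  · have h1 := hb.bool v
    have h2 := hb'.bool v
    rw [hs.bag, hb.cnt, hb'.cnt, mem_rowSet, mem_rowSet]
    by_cases h : v ∈ D.bag p
    · simp only [h, if_true, true_imp_iff, ne_eq, one_ne_zero, not_false_eq_true]
      omega
    · simp [h]

theorem countRow_spec {s : State} {B : ℕ} (hs : Static G t D K s) (hn : n ≤ B) (hB : 1 ≤ B) :
    Spec countRow s (100 * B ^ 2) fun s' => Frame [13, 14, 15] [11] s s' ∧
      ∀ j, s'.arr 11 j = if s.reg 7 ≤ j ∧ j < s.reg 7 + n then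
        min K (∑ u ∈ Finset.range n,
          if s.arr 0 ((j - s.reg 7) * n + u) ≠ 0 then s.arr 10 (s.reg 7 + u) else 0)
        else s.arr 11 j := by
  refine Spec.weaken (Spec.post (Spec.countLoop (T := 60 * B ^ 1) (k := n) (fun i s' =>
    s'.reg 13 = i ∧ Frame [13, 14, 15] [11] s s' ∧
      ∀ j, s'.arr 11 j = if s.reg 7 ≤ j ∧ j < s.reg 7 + i then
        min K (∑ u ∈ Finset.range n,
          if s.arr 0 ((j - s.reg 7) * n + u) ≠ 0 then s.arr 10 (s.reg 7 + u) else 0)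
        else s.arr 11 j) ?_ ?_ ?_) ?_) ?_
  · refine ⟨by simp, (Frame.refl _ _ _).setReg (by simp), fun j => ?_⟩
    rw [if_neg (by omega)]
    rfl
  · rintro i s' - ⟨h13, hF, -⟩
    exact ⟨h13, by simpa [hF.reg 0] using hs.reg0⟩
  · rintro i s' hi ⟨h13, hF, h11⟩
    have hs' := hs.frame hF
    have hmul := hs'.muln i (by omega)
    have h7 := hF.reg 7 (by decide)
    have e0 := hF.arr 0 (by decide)
    have e10 := hF.arr 10 (by decide)
    refine Spec.weaken (Spec.seq (Spec.assign (Spec.seq (Spec.sumLoop (k := n)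
      (fun u => if s.arr 0 (i * n + u) ≠ 0 then s.arr 10 (s.reg 7 + u) else 0) (by decide) ?_ ?_
      (Spec.store ?_))))) ?_
    · intro j x
      simp [hs'.reg0]
    · intro j x hj
      simp [h13, hmul, e0, e10, h7]
    · refine ⟨by simp [h13], ((((hF.setReg (by simp)).setReg (by simp)).setReg (by simp)).setArr
        (by simp)).setReg (by simp), fun j => ?_⟩
      simp only [State.arr_setReg, State.arr_setArr, Expr.eval, State.reg_setReg, h11, h13, h7,
        hs'.reg3]
      by_cases hj : j = s.reg 7 + i
      -- The program obtains the minimum of K and x as K - (K - x).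
      · subst hj
        simp
        omega
      · have : (s.reg 7 ≤ j ∧ j < s.reg 7 + (i + 1)) ↔ (s.reg 7 ≤ j ∧ j < s.reg 7 + i) := by omega
        simp [hj, this]
    · simp only [Expr.cost, pow_one]
      omega
  · rintro s' ⟨-, h⟩
    exact h
  · refine (loop_bound hB hn le_rfl).trans ?_
    simp only [Expr.cost]
    gcongr
    omega

theorem sizeRow_spec {s : State} {B : ℕ} (hs : s.reg 0 = n) (hn : n ≤ B) (hB : 1 ≤ B) :
    Spec sizeRow s (60 * B) fun s' => Frame [13, 15] [12] s s' ∧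
      ∀ j, s'.arr 12 j = if j = s.reg 7 then ∑ u ∈ Finset.range n, s.arr 10 (s.reg 7 + u)
        else s.arr 12 j := by
  refine Spec.weaken (Spec.seq (Spec.assign (Spec.seq (Spec.sumLoop (k := n)
      (fun u => s.arr 10 (s.reg 7 + u)) (by decide) ?_ ?_ (Spec.store ?_))))) ?_
  · intro i x
    simp [hs]
  · intro i x hi
    simp
  · refine ⟨((((Frame.refl _ _ _).setReg (by simp)).setReg (by simp)).setReg (by simp)).setArr
      (by simp), fun j => ?_⟩
    simp
  · simp only [Expr.cost]
    omega

theorem checkRow_spec {s : State} {B p : ℕ} (hs : Static G t D K s) (hp : s.reg 9 = p)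
    (hpm : p ≤ m) (hn : n ≤ B) (hB : 1 ≤ B) :
    Spec checkRow s (60 * B) fun s' => Frame [13, 16] [] s s' ∧
      s'.reg 16 = badness n s p (s.reg 7) := by
  have hmul := hs.muln p (by omega)
  refine Spec.weaken (Spec.seq (Spec.assign (Spec.sumLoop (k := n)
      (fun v => if s.arr 9 (p * n + v) - s.arr 3 (p * n + v) - s.arr 10 (s.reg 7 + v) ≠ 0 then
      s.arr 1 v - s.arr 11 (s.reg 7 + v) else 0) (by decide) ?_ ?_ ?_))) ?_
  · intro i x
    simp [hs.reg0]
  · intro i x hi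
    simp [hp, hmul]
  · refine ⟨(((Frame.refl _ _ _).setReg (by simp)).setReg (by simp)).setReg (by simp), ?_⟩
    simp [badness]
  · simp only [Expr.cost]
    omega

theorem searchRow_spec {s : State} {B p k : ℕ} (hs : Static G t D K s) (hp : s.reg 9 = p)
    (hpm : p ≤ m) (hk : s.reg 7 = s.reg 10 + n * k) (hn0 : 0 < n) (hn : n ≤ B) (hkB : k ≤ B) :
    Spec searchRow s (200 * B ^ 2) fun s' => Frame [13, 16, 17, 18] [] s s' ∧
      (s'.reg 16 = 0 ↔ s.reg 16 = 0 ∧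
        ∀ j < k, sigDist n s p (s.reg 10 + n * j) (s.reg 7) ≠ 0) := by
  have hmul := hs.muln p (by omega)
  have hB : 1 ≤ B := by omega
  refine Spec.weaken (Spec.post (Spec.forLoop (T := 120 * B ^ 1) (k := k) (l := s.reg 10) (d := n)
    (fun i s' => s'.reg 17 = s.reg 10 + n * i ∧ Frame [13, 16, 17, 18] [] s s' ∧
      (s'.reg 16 = 0 ↔ s.reg 16 = 0 ∧
        ∀ j < i, sigDist n s p (s.reg 10 + n * j) (s.reg 7) ≠ 0)) hn0 ?_ ?_ ?_) ?_) ?_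
  · refine ⟨by simp, (Frame.refl _ _ _).setReg (by simp), ?_⟩
    simp
  · rintro i s' - ⟨h17, hF, -⟩
    exact ⟨h17, by simpa [hF.reg 7] using hk⟩
  · rintro i s' hi ⟨h17, hF, h16⟩
    have hs' := hs.frame hF
    have h7 := hF.reg 7 (by decide)
    have h9 := hF.reg 9 (by decide)
    have harr : s'.arr = s.arr := funext fun a => hF.arr a (by simp)
    refine Spec.weaken (Spec.seq (Spec.assign (Spec.seq (Spec.sumLoop (k := n)
      (fun v => if s.arr 3 (p * n + v) ≠ 0 then
        s.arr 10 (s.reg 10 + n * i + v) - s.arr 10 (s.reg 7 + v) +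
          (s.arr 10 (s.reg 7 + v) - s.arr 10 (s.reg 10 + n * i + v)) +
        (s.arr 11 (s.reg 10 + n * i + v) - s.arr 11 (s.reg 7 + v) +
          (s.arr 11 (s.reg 7 + v) - s.arr 11 (s.reg 10 + n * i + v))) else 0)
      (by decide) ?_ ?_ (Spec.cond (T := 6) (fun hc => ?_) (fun hc => ?_)))))) ?_
    · intro j x
      simp [hs'.reg0]
    · intro j x hj
      simp [harr, h17, h7, h9, hp, hmul]
    · refine Spec.weaken (Spec.skip ?_) (by omega)
      have hc' : sigDist n s p (s.reg 10 + n * i) (s.reg 7) ≠ 0 := by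
        simpa [sigDist, harr, h17, h7] using hc
      refine ⟨by simp [h17, hs'.reg0, mul_add, add_assoc],
        (((hF.setReg (by simp)).setReg (by simp)).setReg (by simp)).setReg (by simp), ?_⟩
      simp only [State.reg_setReg]
      norm_num
      rw [h16]
      refine and_congr_right fun _ => ⟨fun h j hj => ?_, fun h j hj => h j (by omega)⟩
      rcases Nat.lt_or_ge j i with hji | hji
      · exact h j hji
      · obtain rfl : j = i := by omega
        exact hc'
    · refine Spec.weaken (Spec.assign ?_) (by simp only [Expr.cost]; omega)
      have hc' : sigDist n s p (s.reg 10 + n * i) (s.reg 7) = 0 := by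
        simpa [sigDist, harr, h17, h7] using hc
      refine ⟨by simp [h17, hs'.reg0, mul_add, add_assoc],
        ((((hF.setReg (by simp)).setReg (by simp)).setReg (by simp)).setReg (by simp)).setReg
          (by simp), ?_⟩
      simp only [State.reg_setReg, Expr.eval]
      norm_num
      exact fun _ => ⟨i, by omega, hc'⟩
    · simp only [Expr.cost, pow_one]
      omega
  · rintro s' ⟨-, h⟩
    exact h
  · refine (loop_bound hB hkB le_rfl).trans ?_
    simp only [Expr.cost]
    gcongr
    omega

/-- The rows with addresses below `R` are the same. -/
def Below (R : ℕ) (s s' : State) : Prop :=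
  ∀ i < R, s'.arr 10 i = s.arr 10 i ∧ s'.arr 11 i = s.arr 11 i ∧ s'.arr 12 i = s.arr 12 i

theorem Below.trans {R R' : ℕ} {s s' s'' : State} (h : Below R s s') (h' : Below R' s' s'')
    (hR : R ≤ R') : Below R s s'' := fun i hi => by
  obtain ⟨h1, h2, h3⟩ := h i hi
  obtain ⟨h1', h2', h3'⟩ := h' i (hi.trans_le hR)
  exact ⟨h1'.trans h1, h2'.trans h2, h3'.trans h3⟩

theorem below_of_arr_eq {R : ℕ} {s s' : State} (h10 : s'.arr 10 = s.arr 10)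
    (h11 : s'.arr 11 = s.arr 11) (h12 : s'.arr 12 = s.arr 12) : Below R s s' := fun i _ => by
  rw [h10, h11, h12]; exact ⟨rfl, rfl, rfl⟩

theorem Below.rowSet_eq {R b : ℕ} {s s' : State} (h : Below R s s') (hb : b + n ≤ R) :
    rowSet n s' b = rowSet n s b := by
  ext v
  rw [mem_rowSet, mem_rowSet, (h (b + v) (by omega)).1]

theorem Below.isBool {R b : ℕ} {s s' : State} (h : Below R s s') (hb : b + n ≤ R)
    (hs : IsBool n s b) : IsBool n s' b := fun v => by
  rw [(h (b + v) (by omega)).1]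
  exact hs v

theorem Below.rowOK {R b : ℕ} {s s' : State} (h : Below R s s') (hn : 0 < n) (hb : b + n ≤ R)
    (hs : RowOK G K s b) : RowOK G K s' b where
  bool := h.isBool hb hs.bool
  cnt v := by rw [(h (b + v) (by omega)).2.1, h.rowSet_eq hb, hs.cnt]
  size := by rw [(h b (by omega)).2.2, h.rowSet_eq hb, hs.size]

theorem maskSet_congr {s s' : State} (h : s'.arr 9 = s.arr 9) (p : ℕ) :
    maskSet n s' p = maskSet n s p := by
  rw [maskSet, h, maskSet]

/-- All masks are characteristic vectors. -/
def MasksBool (n m : ℕ) (s : State) : Prop := ∀ q ≤ m, ∀ v : Fin n, s.arr 9 (q * n + v) ≤ 1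

/-- The candidate is written at the first free address and is kept merely by advancing register `7`,
which happens iff it is inner good and its signature is new. A rejected candidate stays as garbage
at an address that still counts as free, so the rows below are unaffected in either case. -/
theorem tryRow_spec {s : State} {B k a : ℕ} {p : Fin m} (hs : Static G t D K s)
    (ha : s.reg 8 = a) (ham : a ≤ m) (hp : s.reg 9 = p) (hk : s.reg 7 = s.reg 10 + n * k)
    (hn0 : 0 < n) (hn : n ≤ B) (hkB : k ≤ B) (hmask : MasksBool n m s)
    (h1 : s.reg 11 + n ≤ s.reg 7) (h2 : s.reg 12 + n ≤ s.reg 7)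
    (hb1 : IsBool n s (s.reg 11)) (hb2 : IsBool n s (s.reg 12))
    (hrows : ∀ j < k, RowOK G K s (s.reg 10 + n * j)) {C : Finset (Fin n)}
    (hC : C = rowSet n s (s.reg 11) ∩ maskSet n s a ∪ rowSet n s (s.reg 12) \ maskSet n s a) :
    Spec tryRow s (600 * B ^ 2) fun s' =>
      Frame [7, 13, 14, 15, 16, 17, 18] [10, 11, 12] s s' ∧ Below (s.reg 7) s s' ∧
      ((s'.reg 7 = s.reg 7 ∧ ¬ (InnerGood G t K (maskSet n s p) (D.bag p) C ∧
          ∀ j < k, ¬ SameSig G K (D.bag p) (rowSet n s (s.reg 10 + n * j)) C)) ∨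
        (s'.reg 7 = s.reg 7 + n ∧ RowOK G K s' (s.reg 7) ∧ rowSet n s' (s.reg 7) = C ∧
          InnerGood G t K (maskSet n s p) (D.bag p) C ∧
          ∀ j < k, ¬ SameSig G K (D.bag p) (rowSet n s (s.reg 10 + n * j)) C)) := by
  have hB : 1 ≤ B := by omega
  have hmul := hs.muln a (by omega)
  set R := s.reg 7 with hR
  let f : ℕ → ℕ := fun v => if s.arr 9 (a * n + v) ≠ 0 then s.arr 10 (s.reg 11 + v) else
    s.arr 10 (s.reg 12 + v)
  have hjR : ∀ j < k, s.reg 10 + n * j + n ≤ R := fun j hj => by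
    have := Nat.mul_le_mul_left n (Nat.succ_le_of_lt hj)
    rw [hk]
    rw [Nat.mul_succ] at this
    omega
  refine Spec.weaken (Spec.seq (Spec.fillLoop (b := R) (k := n) f ?_ ?_ ?_ ?_)) ?_
    (T₁ := _ + (100 * B ^ 2 + (60 * B + (60 * B + (200 * B ^ 2 + 10)))))
  · intro i hi
    simp [hs.reg0]
  · intro i hi
    simp [hR]
  · intro i hi
    have e1 : ¬ R ≤ s.reg 11 + i := by omega
    have e2 : ¬ R ≤ s.reg 12 + i := by omega
    simp [ha, hmul, e1, e2, f]
  · generalize hs1 : s.fill 13 10 R n f = s1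
    have F1 : Frame [7, 13, 14, 15, 16, 17, 18] [10, 11, 12] s s1 := by
      rw [← hs1]
      exact (Frame.refl _ _ _).fill (by simp) (by simp)
    have R1 : s1.reg 7 = R := by rw [← hs1]; simp [hR]
    have B1 : Below R s s1 := by
      intro i hi
      have : ¬ R ≤ i := by omega
      rw [← hs1]
      simp [this]
    have row1 : ∀ v : Fin n, s1.arr 10 (R + v) = f v := by
      intro v
      rw [← hs1]
      simp
    have bool1 : IsBool n s1 R := by
      intro v
      rw [row1]
      simp only [f]
      split_ifs
      · exact hb1 v
      · exact hb2 v
    have C1 : rowSet n s1 R = C := by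
      ext v
      rw [mem_rowSet, row1, hC]
      simp only [f, Finset.mem_union, Finset.mem_inter, Finset.mem_sdiff, mem_rowSet, mem_maskSet]
      split_ifs <;> tauto
    have S1 := hs.frame F1
    refine Spec.seq_of (countRow_spec S1 hn hB) ?_
    rintro s2 ⟨F2', cnt2⟩
    have F2 := F1.trans (F2'.mono (by decide) (by decide))
    have S2 := hs.frame F2
    have R2 : s2.reg 7 = R := by rw [F2'.reg _ (by decide), R1]
    refine Spec.seq_of (sizeRow_spec S2.reg0 hn hB) ?_
    rintro s3 ⟨F3', size3⟩
    have F3 := F2.trans (F3'.mono (by decide) (by decide))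
    have S3 := hs.frame F3
    have R3 : s3.reg 7 = R := by rw [F3'.reg _ (by decide), R2]
    rw [R1] at cnt2
    rw [R2] at size3
    have e310 : s3.arr 10 = s1.arr 10 := by rw [F3'.arr _ (by decide), F2'.arr _ (by decide)]
    have e210 : s2.arr 10 = s1.arr 10 := by rw [F2'.arr _ (by decide)]
    have B3 : Below R s s3 := by
      intro i hi
      obtain ⟨h1, h2, h3⟩ := B1 i hi
      refine ⟨by rw [e310, h1], ?_, ?_⟩
      · rw [F3'.arr 11 (by decide), cnt2, if_neg (by omega), h2]
      · rw [size3, if_neg (by omega), F2'.arr 12 (by decide), h3]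
    have C3' : rowSet n s3 R = rowSet n s1 R := by rw [rowSet, e310, rowSet]
    have ok3 : RowOK G K s3 R := by
      refine ⟨?_, ?_, ?_⟩
      · rw [IsBool, e310]
        exact bool1
      · intro v
        rw [F3'.arr 11 (by decide), cnt2, if_pos (by omega), C3', ← sum_adj_eq_cnt S1 bool1,
          Nat.add_sub_cancel_left]
      · rw [size3, if_pos rfl, e210, C3', sum_row_eq_card bool1]
    have mask3 : maskSet n s3 p = maskSet n s p := maskSet_congr (F3.arr 9 (by decide)) p
    refine Spec.seq_of (checkRow_spec S3 (by rw [F3.reg _ (by decide), hp]) p.2.le hn hB) ?_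
    rintro s4 ⟨F4', bad4⟩
    have F4 := F3.trans (F4'.mono (by decide) (by decide))
    have S4 := hs.frame F4
    have harr : s4.arr = s3.arr := funext fun a => F4'.arr a (by simp)
    have R4 : s4.reg 7 = R := by rw [F4'.reg _ (by decide), R3]
    have B43 : ∀ X, Below X s3 s4 := fun X => below_of_arr_eq (by rw [harr]) (by rw [harr])
      (by rw [harr])
    have r10 : s4.reg 10 = s.reg 10 := F4.reg _ (by decide)
    refine Spec.seq_of (searchRow_spec (k := k) S4 (by rw [F4.reg _ (by decide), hp]) p.2.le
      (by rw [R4, r10, hk]) hn0 hn hkB) ?_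
    rintro s5 ⟨F5', bad5⟩
    have F5 := F4.trans (F5'.mono (by decide) (by decide))
    have harr5 : s5.arr = s4.arr := funext fun a => F5'.arr a (by simp)
    have R5 : s5.reg 7 = R := by rw [F5'.reg _ (by decide), R4]
    have B53 : ∀ X, Below X s3 s5 := fun X => below_of_arr_eq (by rw [harr5, harr])
      (by rw [harr5, harr]) (by rw [harr5, harr])
    have hm3 : ∀ v : Fin n, s3.arr 9 (p * n + v) ≤ 1 := fun v => by
      rw [F3.arr 9 (by decide)]
      exact hmask p p.2.le v
    have key : s5.reg 16 = 0 ↔ InnerGood G t K (maskSet n s p) (D.bag p) C ∧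
        ∀ j < k, ¬ SameSig G K (D.bag p) (rowSet n s (s.reg 10 + n * j)) C := by
      rw [bad5, bad4, R3, badness_eq_zero_iff S3 hm3 ok3, mask3, C3', C1]
      refine and_congr_right fun _ => forall₂_congr fun j hj => ?_
      have okj : RowOK G K s4 (s.reg 10 + n * j) :=
        (B3.trans (B43 R) le_rfl).rowOK hn0 (hjR j hj) (hrows j hj)
      rw [R4, r10, ne_eq, sigDist_eq_zero_iff S4 okj ((B43 (R + n)).rowOK hn0 le_rfl ok3),
        (B3.trans (B43 R) le_rfl).rowSet_eq (hjR j hj), (B43 (R + n)).rowSet_eq le_rfl, C3', C1]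
    refine Spec.weaken (Spec.cond (T := 4) (fun hc => ?_) (fun hc => ?_)) (by simp [Expr.cost])
    · refine Spec.weaken (Spec.skip ⟨F5, B3.trans (B53 R) le_rfl, .inl ⟨R5, ?_⟩⟩) (by omega)
      rw [← key]
      exact hc
    · refine Spec.weaken (Spec.assign ⟨F5.setReg (by simp), ?_, .inr ⟨?_, ?_, ?_, key.1 hc⟩⟩)
        (by simp [Expr.cost])
      · exact B3.trans (B53 R) le_rfl
      · simp [R5, F5.reg 0, hs.reg0]
      · exact Below.rowOK (s' := s5.setReg 7 _) (B53 (R + n)) hn0 le_rfl ok3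
      · refine ((B53 (R + n)).rowSet_eq le_rfl).trans ?_
        rw [C3', C1]
  · have : B ≤ B ^ 2 := by nlinarith
    simp only [Expr.cost]
    omega

/-! ### Merging two parts -/

/-- Invariant of the loops of `absorb`: the combinations `cand i j` of the rows that satisfy `P i j`
have been treated.  The memory before the loops is `s₁`. -/
structure AbsorbInv (G : SimpleGraph (Fin n)) (t : Fin n → ℕ) (K : ℕ) (V X : Finset (Fin n))
    (cand : ℕ → ℕ → Finset (Fin n)) (ka kb : ℕ) (s₁ : State) (P : ℕ → ℕ → Prop) (k : ℕ)
    (s : State) : Prop where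
  reg7 : s.reg 7 = s₁.reg 7 + n * k
  frame : Frame [7, 11, 12, 13, 14, 15, 16, 17, 18] [10, 11, 12] s₁ s
  below : Below (s₁.reg 7) s₁ s
  ok : ∀ j < k, RowOK G K s (s₁.reg 7 + n * j)
  good : ∀ j < k, InnerGood G t K V X (rowSet n s (s₁.reg 7 + n * j))
  isCand : ∀ j < k, ∃ i₁ < ka, ∃ i₂ < kb, rowSet n s (s₁.reg 7 + n * j) = cand i₁ i₂
  distinct : ∀ i j, i < j → j < k →
    ¬ SameSig G K X (rowSet n s (s₁.reg 7 + n * i)) (rowSet n s (s₁.reg 7 + n * j))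
  complete : ∀ i₁ < ka, ∀ i₂ < kb, P i₁ i₂ → InnerGood G t K V X (cand i₁ i₂) →
    ∃ j < k, SameSig G K X (cand i₁ i₂) (rowSet n s (s₁.reg 7 + n * j))

theorem SameSig.refl (K : ℕ) (X A : Finset (Fin n)) : SameSig G K X A A :=
  ⟨rfl, fun _ _ => ⟨Iff.rfl, rfl⟩⟩

theorem SameSig.symm {X A B : Finset (Fin n)} (h : SameSig G K X A B) : SameSig G K X B A :=
  ⟨h.1.symm, fun v hv => ⟨(h.2 v hv).1.symm, (h.2 v hv).2.symm⟩⟩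

theorem AbsorbInv.setReg {V X : Finset (Fin n)} {cand : ℕ → ℕ → Finset (Fin n)} {ka kb : ℕ}
    {s₁ : State} {P P' : ℕ → ℕ → Prop} {k : ℕ} {s : State}
    (h : AbsorbInv G t K V X cand ka kb s₁ P k s)
    (hP : ∀ i₁ < ka, ∀ i₂ < kb, P' i₁ i₂ → P i₁ i₂) {r : ℕ} (hr : r = 11 ∨ r = 12) (x : ℕ) :
    AbsorbInv G t K V X cand ka kb s₁ P' k (s.setReg r x) where
  reg7 := by
    rw [State.reg_setReg, if_neg (by omega), h.reg7]
  frame := h.frame.setReg (by rcases hr with rfl | rfl <;> simp)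
  below := h.below
  ok j hj := ⟨(h.ok j hj).bool, (h.ok j hj).cnt, (h.ok j hj).size⟩
  good := h.good
  isCand := h.isCand
  distinct := h.distinct
  complete i₁ h₁ i₂ h₂ hp := h.complete i₁ h₁ i₂ h₂ (hP i₁ h₁ i₂ h₂ hp)

theorem AbsorbInv.tryRow_spec {s₁ s : State} {B k a la lb ka kb : ℕ} {p : Fin m} {P : ℕ → ℕ → Prop}
    {cand : ℕ → ℕ → Finset (Fin n)} (hs₁ : Static G t D K s₁)
    (ha : s₁.reg 8 = a) (ham : a ≤ m) (hp : s₁.reg 9 = p) (h10 : s₁.reg 10 = s₁.reg 7)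
    (hn0 : 0 < n) (hn : n ≤ B) (hN : sigBound n K (D.width + 1) ≤ B) (hmask : MasksBool n m s₁)
    (hla : la + n * ka ≤ s₁.reg 7) (hlb : lb + n * kb ≤ s₁.reg 7)
    (hba : ∀ i < ka, IsBool n s₁ (la + n * i)) (hbb : ∀ i < kb, IsBool n s₁ (lb + n * i))
    (hcand : ∀ i j, cand i j = rowSet n s₁ (la + n * i) ∩ maskSet n s₁ a ∪
      rowSet n s₁ (lb + n * j) \ maskSet n s₁ a)
    (h : AbsorbInv G t K (maskSet n s₁ p) (D.bag p) cand ka kb s₁ P k s)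
    {i j : ℕ} (hi : i < ka) (hj : j < kb) (h11 : s.reg 11 = la + n * i)
    (h12 : s.reg 12 = lb + n * j) :
    Spec tryRow s (600 * B ^ 2) fun s' => s'.reg 11 = la + n * i ∧ s'.reg 12 = lb + n * j ∧
      ∃ k', AbsorbInv G t K (maskSet n s₁ p) (D.bag p) cand ka kb s₁
        (fun i₁ i₂ => P i₁ i₂ ∨ i₁ = i ∧ i₂ = j) k' s' := by
  have hle : ∀ {l x k : ℕ}, x < k → l + n * k ≤ s₁.reg 7 → l + n * x + n ≤ s₁.reg 7 := by
    intro l x k hx hl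
    have := Nat.mul_le_mul_left n (Nat.succ_le_of_lt hx)
    rw [Nat.mul_succ] at this
    omega
  have hR : s₁.reg 7 ≤ s.reg 7 := by rw [h.reg7]; omega
  have hm : s.arr 9 = s₁.arr 9 := h.frame.arr 9 (by decide)
  have hi' := hle hi hla
  have hj' := hle hj hlb
  -- Since the kept rows have pairwise different signatures, their number never exceeds the
  -- signature bound. This keeps the search through them within the time bound.
  have hkB : k ≤ B := (card_le_sigBound (D.card_bag_le p) _ h.distinct).trans hN
  have r10 : s.reg 10 = s₁.reg 7 := by rw [h.frame.reg 10 (by decide), h10]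
  refine (VDS.tryRow_spec (k := k) (a := a) (p := p) (hs₁.frame h.frame)
    (by rw [h.frame.reg 8 (by decide), ha]) ham (by rw [h.frame.reg 9 (by decide), hp])
    (by rw [h.reg7, r10]) hn0 hn hkB (by rw [MasksBool, hm]; exact hmask)
    (by rw [h11]; omega) (by rw [h12]; omega)
    (by rw [h11]; exact h.below.isBool hi' (hba i hi))
    (by rw [h12]; exact h.below.isBool hj' (hbb j hj)) (by rw [r10]; exact h.ok)
    (C := cand i j) ?_).post ?_
  · rw [hcand, h11, h12, h.below.rowSet_eq hi', h.below.rowSet_eq hj', maskSet_congr hm]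
  · rintro s' ⟨hF, hB', hcase⟩
    rw [r10, maskSet_congr hm] at hcase
    refine ⟨by rw [hF.reg 11 (by decide), h11], by rw [hF.reg 12 (by decide), h12], ?_⟩
    have F' := h.frame.trans (hF.mono (by decide) (by decide))
    have B'' := h.below.trans hB' hR
    have hx : ∀ x < k, s₁.reg 7 + n * x + n ≤ s.reg 7 := fun x hx => by
      have := Nat.mul_le_mul_left n (Nat.succ_le_of_lt hx)
      rw [h.reg7]
      rw [Nat.mul_succ] at this
      omega
    have hrow : ∀ x < k, rowSet n s' (s₁.reg 7 + n * x) = rowSet n s (s₁.reg 7 + n * x) :=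
      fun x hxk => hB'.rowSet_eq (hx x hxk)
    rcases hcase with ⟨h7, hnot⟩ | ⟨h7, hok, hC, hgood, hnew⟩
    · refine ⟨k, by rw [h7, h.reg7], F', B'', fun x hxk => hB'.rowOK hn0 (hx x hxk) (h.ok x hxk),
        fun x hxk => ?_, fun x hxk => ?_, fun x y hxy hyk => ?_, fun i₁ h₁ i₂ h₂ hP hg => ?_⟩
      · rw [hrow x hxk]
        exact h.good x hxk
      · rw [hrow x hxk]
        exact h.isCand x hxk
      · rw [hrow x (hxy.trans hyk), hrow y hyk]
        exact h.distinct x y hxy hyk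
      · rcases hP with hP | ⟨rfl, rfl⟩
        · obtain ⟨x, hxk, hsig⟩ := h.complete i₁ h₁ i₂ h₂ hP hg
          exact ⟨x, hxk, by rwa [hrow x hxk]⟩
        · have : ¬ ∀ j < k, ¬ SameSig G K (D.bag p) (rowSet n s (s₁.reg 7 + n * j)) (cand i₁ i₂) :=
            fun h => hnot ⟨hg, h⟩
          push Not at this
          obtain ⟨x, hxk, hsig⟩ := this
          exact ⟨x, hxk, by rw [hrow x hxk]; exact hsig.symm⟩
    · rw [h.reg7] at hok hC
      have hlast : ∀ x, x < k + 1 → x < k ∨ x = k := fun x hx => by omega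
      refine ⟨k + 1, by rw [h7, h.reg7]; ring, F', B'', fun x hxk => ?_,
        fun x hxk => ?_, fun x hxk => ?_, fun x y hxy hyk => ?_, fun i₁ h₁ i₂ h₂ hP hg => ?_⟩
      · rcases hlast x hxk with hxk | rfl
        · exact hB'.rowOK hn0 (hx x hxk) (h.ok x hxk)
        · exact hok
      · rcases hlast x hxk with hxk | rfl
        · rw [hrow x hxk]
          exact h.good x hxk
        · rw [hC]
          exact hgood
      · rcases hlast x hxk with hxk | rfl
        · rw [hrow x hxk]
          exact h.isCand x hxk
        · exact ⟨i, hi, j, hj, hC⟩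
      · rcases hlast y hyk with hyk | rfl
        · rw [hrow x (hxy.trans hyk), hrow y hyk]
          exact h.distinct x y hxy hyk
        · rw [hC, hrow x hxy]
          exact hnew x hxy
      · rcases hP with hP | ⟨rfl, rfl⟩
        · obtain ⟨x, hxk, hsig⟩ := h.complete i₁ h₁ i₂ h₂ hP hg
          exact ⟨x, hxk.trans (Nat.lt_succ_self k), by rwa [hrow x hxk]⟩
        · exact ⟨k, Nat.lt_succ_self k, by rw [hC]; exact SameSig.refl _ _ _⟩

/-- The at most B² pairs of rows are tried at a cost of O(B²) each. The mask of `p` is enlarged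
before the loops, so that the goodness test already refers to the merged part; combining rows reads
only the mask of `a`, which is unchanged because `a ≠ p`. -/
theorem absorb_spec {s : State} {B a la lb ka kb : ℕ} {p : Fin m} (hs : Static G t D K s)
    (ha : s.reg 8 = a) (ham : a ≤ m) (hp : s.reg 9 = p) (hap : a ≠ p)
    (hn0 : 0 < n) (hn : n ≤ B) (hN : sigBound n K (D.width + 1) ≤ B) (hmask : MasksBool n m s)
    (hla : s.arr 7 a = la) (hla' : s.arr 8 a = la + n * ka) (hlb : s.arr 7 p = lb)
    (hlb' : s.arr 8 p = lb + n * kb) (hka : ka ≤ B) (hkb : kb ≤ B)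
    (haR : la + n * ka ≤ s.reg 7) (hbR : lb + n * kb ≤ s.reg 7)
    (hba : ∀ i < ka, IsBool n s (la + n * i)) (hbb : ∀ i < kb, IsBool n s (lb + n * i)) :
    Spec absorb s (1100 * B ^ 4) fun s' =>
      Frame [7, 10, 11, 12, 13, 14, 15, 16, 17, 18] [7, 8, 9, 10, 11, 12] s s' ∧
      Below (s.reg 7) s s' ∧ MasksBool n m s' ∧
      (∀ q ≤ m, maskSet n s' q =
        if q = p then maskSet n s p ∪ maskSet n s a else maskSet n s q) ∧
      ∃ k ≤ sigBound n K (D.width + 1), s'.reg 7 = s.reg 7 + n * k ∧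
        (∀ q, s'.arr 7 q = if q = p then s.reg 7 else s.arr 7 q) ∧
        (∀ q, s'.arr 8 q = if q = p then s.reg 7 + n * k else s.arr 8 q) ∧
        (∀ j < k, RowOK G K s' (s.reg 7 + n * j)) ∧
        (∀ j < k, InnerGood G t K (maskSet n s p ∪ maskSet n s a) (D.bag p)
          (rowSet n s' (s.reg 7 + n * j))) ∧
        (∀ j < k, ∃ i₁ < ka, ∃ i₂ < kb, rowSet n s' (s.reg 7 + n * j) =
          rowSet n s (la + n * i₁) ∩ maskSet n s a ∪ rowSet n s (lb + n * i₂) \ maskSet n s a) ∧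
        (∀ i₁ < ka, ∀ i₂ < kb, InnerGood G t K (maskSet n s p ∪ maskSet n s a) (D.bag p)
          (rowSet n s (la + n * i₁) ∩ maskSet n s a ∪ rowSet n s (lb + n * i₂) \ maskSet n s a) →
          ∃ j < k, SameSig G K (D.bag p)
            (rowSet n s (la + n * i₁) ∩ maskSet n s a ∪ rowSet n s (lb + n * i₂) \ maskSet n s a)
            (rowSet n s' (s.reg 7 + n * j))) := by
  have hB : 1 ≤ B := by omega
  have hmula := hs.muln a (by omega)
  have hmulp := hs.muln p (by omega)
  -- The blocks of the mask array that belong to different parts are disjoint.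
  have hblock : ∀ q, q ≠ (p : ℕ) → ∀ v : ℕ, v < n → ¬ (p * n ≤ q * n + v ∧ q * n + v < p * n + n) := by
    rintro q hq v hv ⟨h1, h2⟩
    apply hq
    rcases lt_trichotomy q p with h | h | h
    · have := Nat.mul_le_mul_right n (Nat.succ_le_of_lt h)
      rw [Nat.succ_mul] at this
      omega
    · exact h
    · have := Nat.mul_le_mul_right n (Nat.succ_le_of_lt h)
      rw [Nat.succ_mul] at this
      omega
  let f : ℕ → ℕ := fun v => if s.arr 9 (a * n + v) ≠ 0 then 1 else s.arr 9 (p * n + v)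
  refine Spec.weaken (Spec.seq (Spec.fillLoop (b := p * n) (k := n) f ?_ ?_ ?_
    (Spec.seq (Spec.assign ?_)))) ?_
    (T₁ := _ + (_ + (980 * B ^ 4)))
  · intro i hi
    simp [hs.reg0]
  · intro i hi
    simp [hp, hmulp]
  · intro i hi
    have h1 : ¬ (p * n ≤ a * n + i ∧ a * n < p * n) := by
      have := hblock a hap i hi
      omega
    simp [ha, hp, hmula, hmulp, h1, f]
  · generalize hs1 : (s.fill 13 9 (p * n) n f).setReg 10
      ((Expr.reg 7).eval (s.fill 13 9 (p * n) n f)) = s₁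
    have F1 : Frame [7, 10, 11, 12, 13, 14, 15, 16, 17, 18] [7, 8, 9, 10, 11, 12] s s₁ := by
      rw [← hs1]
      exact ((Frame.refl _ _ _).fill (by simp) (by simp)).setReg (by simp)
    have S1 := hs.frame F1
    have r7 : s₁.reg 7 = s.reg 7 := by rw [← hs1]; simp
    have r10 : s₁.reg 10 = s₁.reg 7 := by rw [← hs1]; simp
    have r8 : s₁.reg 8 = a := by rw [F1.reg _ (by decide), ha]
    have r9 : s₁.reg 9 = p := by rw [F1.reg _ (by decide), hp]
    have e : ∀ x, x ≠ 9 → s₁.arr x = s.arr x := fun x hx => by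
      funext j
      rw [← hs1]
      simp [hx]
    have bel1 : ∀ X, Below X s s₁ := fun X =>
      below_of_arr_eq (e 10 (by decide)) (e 11 (by decide)) (e 12 (by decide))
    have hmp : ∀ v : Fin n, s₁.arr 9 (p * n + v) = f v := fun v => by
      rw [← hs1]
      simp
    have hmq : ∀ q, q ≠ (p : ℕ) → ∀ v : Fin n, s₁.arr 9 (q * n + v) = s.arr 9 (q * n + v) := by
      intro q hq v
      have := hblock q hq v v.2
      rw [← hs1]
      simp [this]
    have M1 : MasksBool n m s₁ := by
      intro q hq v
      by_cases hqp : q = p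
      · subst hqp
        rw [hmp]
        have := hmask p p.2.le v
        simp only [f]
        split_ifs <;> omega
      · rw [hmq q hqp]
        exact hmask q hq v
    have mp : maskSet n s₁ p = maskSet n s p ∪ maskSet n s a := by
      ext v
      rw [mem_maskSet, hmp, Finset.mem_union, mem_maskSet, mem_maskSet]
      simp only [f]
      split_ifs with h
      · simp [h]
      · simp only [ne_eq, not_not] at h
        simp [h]
    have mq : ∀ q, q ≠ (p : ℕ) → maskSet n s₁ q = maskSet n s q := by
      intro q hq
      ext v
      rw [mem_maskSet, hmq q hq, mem_maskSet]
    let cand : ℕ → ℕ → Finset (Fin n) := fun i j =>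
      rowSet n s₁ (la + n * i) ∩ maskSet n s₁ a ∪ rowSet n s₁ (lb + n * j) \ maskSet n s₁ a
    have rowe : ∀ b, rowSet n s₁ b = rowSet n s b := fun b =>
      (bel1 (b + n)).rowSet_eq le_rfl
    have hcand : ∀ i j, cand i j =
        rowSet n s (la + n * i) ∩ maskSet n s a ∪ rowSet n s (lb + n * j) \ maskSet n s a := by
      intro i j
      simp only [cand, rowe, mq a hap]
    have loopI : ∀ {s' : State} {P k}, AbsorbInv G t K (maskSet n s₁ p) (D.bag p) cand ka kb s₁ P k s' →
        s'.reg 0 = n ∧ s'.arr 7 (s'.reg 8) = la ∧ s'.arr 8 (s'.reg 8) = la + n * ka ∧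
          s'.arr 7 (s'.reg 9) = lb ∧ s'.arr 8 (s'.reg 9) = lb + n * kb := by
      intro s' P k h
      rw [h.frame.reg 8 (by decide), h.frame.reg 9 (by decide), h.frame.arr 7 (by decide),
        h.frame.arr 8 (by decide), r8, r9, e 7 (by decide), e 8 (by decide)]
      exact ⟨(S1.frame h.frame).reg0, hla, hla', hlb, hlb'⟩
    refine Spec.weaken (Spec.seq_of (Spec.forLoop (T := 700 * B ^ 3) (l := la) (d := n) (k := ka)
      (fun i s' => s'.reg 11 = la + n * i ∧ ∃ k,
        AbsorbInv G t K (maskSet n s₁ p) (D.bag p) cand ka kb s₁ (fun i₁ _ => i₁ < i) k s')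
        hn0 ?_ ?_ ?_) ?_ (T₂ := 20)) ?_
    · refine ⟨by simp [r8, e 7, hla], 0, ?_⟩
      refine ⟨by simp, (Frame.refl _ _ _).setReg (by simp), below_of_arr_eq rfl rfl rfl, ?_, ?_, ?_,
        ?_, ?_⟩ <;> simp
    · rintro i s' - ⟨h11, k, h⟩
      exact ⟨h11, (loopI h).2.2.1⟩
    · rintro i s' hi ⟨h11, k, h⟩
      refine Spec.weaken (Spec.post (Spec.forLoop (T := 600 * B ^ 2) (l := lb) (d := n) (k := kb)
        (fun j s' => s'.reg 11 = la + n * i ∧ s'.reg 12 = lb + n * j ∧ ∃ k,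
          AbsorbInv G t K (maskSet n s₁ p) (D.bag p) cand ka kb s₁
            (fun i₁ i₂ => i₁ < i ∨ i₁ = i ∧ i₂ < j) k s') hn0 ?_ ?_ ?_) ?_) ?_
      · refine ⟨by simp [h11], ?_, k, h.setReg (by simp) (by simp) _⟩
        simp [(loopI h).2.2.2.1]
      · rintro j s'' - ⟨-, h12, k, h⟩
        exact ⟨h12, (loopI h).2.2.2.2⟩
      · rintro j s'' hj ⟨h11, h12, k, h⟩
        refine (AbsorbInv.tryRow_spec (la := la) (lb := lb) S1 r8 ham r9 r10 hn0 hn hN M1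
          (by rw [r7]; exact haR) (by rw [r7]; exact hbR)
          (fun i hi => (bel1 (la + n * i + n)).isBool le_rfl (hba i hi))
          (fun i hi => (bel1 (lb + n * i + n)).isBool le_rfl (hbb i hi))
          (fun i j => rfl) h hi hj h11 h12).post ?_
        rintro s₃ ⟨h11, h12, k, h⟩
        refine ⟨by simp [h11], ?_, k, h.setReg ?_ (by simp) _⟩
        · simp [h12, (loopI h).1]
          ring
        · intro i₁ _ i₂ _ hh
          omega
      · rintro s'' ⟨h11, -, k, h⟩
        refine ⟨?_, k, h.setReg ?_ (by simp) _⟩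
        · simp [h11, (loopI h).1]
          ring
        · intro i₁ _ i₂ _ hh
          omega
      · refine (loop_bound hB hkb le_rfl).trans ?_
        simp only [Expr.cost]
        gcongr
        omega
    · rintro s₂ ⟨-, k, h⟩
      refine Spec.weaken (Spec.seq (Spec.store (Spec.store ?_))) (by simp [Expr.cost])
      have r9' : s₂.reg 9 = p := by rw [h.frame.reg _ (by decide), r9]
      have r10' : s₂.reg 10 = s.reg 7 := by rw [h.frame.reg _ (by decide), r10, r7]
      have e9 : s₂.arr 9 = s₁.arr 9 := h.frame.arr 9 (by decide)
      refine ⟨((F1.trans (h.frame.mono (by decide) (by decide))).setArr (by simp)).setArr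
        (by simp), ?_, ?_, ?_, k, ?_, ?_, ?_, ?_, ?_, ?_, ?_, ?_⟩
      · intro i hi
        simpa using (bel1 (s.reg 7)).trans h.below r7.ge i hi
      · intro q hq v
        simpa [e9] using M1 q hq v
      · intro q hq
        have : maskSet n ((s₂.setArr 7 ((Expr.reg 9).eval s₂) ((Expr.reg 10).eval s₂)).setArr 8
            ((Expr.reg 9).eval (s₂.setArr 7 ((Expr.reg 9).eval s₂) ((Expr.reg 10).eval s₂)))
            ((Expr.reg 7).eval (s₂.setArr 7 ((Expr.reg 9).eval s₂) ((Expr.reg 10).eval s₂)))) q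
            = maskSet n s₁ q := by
          ext v
          simp [e9]
        rw [this]
        split_ifs with hqp
        · rw [hqp, mp]
        · exact mq q hqp
      · exact card_le_sigBound (D.card_bag_le p) _ h.distinct
      · simp [h.reg7, r7]
      · intro q
        have := congrFun (h.frame.arr 7 (by decide)) q
        rw [e 7 (by decide)] at this
        simp [r9', r10', this]
      · intro q
        have := congrFun (h.frame.arr 8 (by decide)) q
        rw [e 8 (by decide)] at this
        simp [r9', h.reg7, r7, this]
      · intro j hj
        have hok := h.ok j hj
        rw [r7] at hok
        refine Below.rowOK (R := s.reg 7 + n * j + n) (s := s₂) ?_ hn0 le_rfl hok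
        intro i hi
        simp
      · intro j hj
        have := h.good j hj
        rw [mp, r7] at this
        have hrow : ∀ b, rowSet n ((s₂.setArr 7 ((Expr.reg 9).eval s₂) ((Expr.reg 10).eval s₂)).setArr 8
            ((Expr.reg 9).eval (s₂.setArr 7 ((Expr.reg 9).eval s₂) ((Expr.reg 10).eval s₂)))
            ((Expr.reg 7).eval (s₂.setArr 7 ((Expr.reg 9).eval s₂) ((Expr.reg 10).eval s₂)))) b
            = rowSet n s₂ b := by
          intro b
          ext v
          simp
        rwa [hrow]
      · intro j hj
        obtain ⟨i₁, h₁, i₂, h₂, he⟩ := h.isCand j hj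
        refine ⟨i₁, h₁, i₂, h₂, ?_⟩
        rw [← hcand, ← he, r7]
        ext v
        simp
      · intro i₁ h₁ i₂ h₂ hg
        rw [← hcand] at hg ⊢
        rw [← mp] at hg
        obtain ⟨j, hj, hsig⟩ := h.complete i₁ h₁ i₂ h₂ h₁ hg
        refine ⟨j, hj, ?_⟩
        rw [r7] at hsig
        convert hsig using 1
        ext v
        simp
    · have h1 : 1 ≤ B ^ 4 := Nat.one_le_pow _ _ hB
      have h2 := loop_bound (B := B) (k := ka) (T := 700 * B ^ 3) (c := 700) (j := 3)
        (d := (get 8 (reg 8)).cost + (reg 0).cost + 6)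
        (e := (get 7 (reg 8)).cost + (get 8 (reg 8)).cost + 4) hB hka le_rfl
      simp only [Expr.cost, Nat.reduceAdd] at h2 ⊢
      omega
  · have h1 : B ≤ B ^ 4 := Nat.le_self_pow (by omega) B
    simp only [Expr.cost]
    omega

/-! ### Parts as represented families, and entering the bags -/

/-- The sets stored in the rows of part `q`. -/
def family (n : ℕ) (s : State) (q : ℕ) : Set (Finset (Fin n)) :=
  {A | ∃ i, s.arr 7 q + n * i < s.arr 8 q ∧ A = rowSet n s (s.arr 7 q + n * i)}

/-- The part `q` has vertex set `V`, and its rows represent the good sets on `V`. -/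
structure Part (G : SimpleGraph (Fin n)) (t : Fin n → ℕ) (K N : ℕ) (s : State) (q : ℕ)
    (V : Finset (Fin n)) : Prop where
  block : ∃ k ≤ N, s.arr 8 q = s.arr 7 q + n * k
  le : s.arr 8 q ≤ s.reg 7
  bool : ∀ i, s.arr 7 q + n * i < s.arr 8 q → IsBool n s (s.arr 7 q + n * i)
  mask : maskSet n s q = V
  rep : Represents G t K V (family n s q)

/-- A part whose rows have correct counts and are contained in its vertex set. -/
structure NodePart (G : SimpleGraph (Fin n)) (t : Fin n → ℕ) (K N : ℕ) (s : State) (q : ℕ)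
    (V : Finset (Fin n)) : Prop extends Part G t K N s q V where
  ok : ∀ i, s.arr 7 q + n * i < s.arr 8 q → RowOK G K s (s.arr 7 q + n * i)
  sub : ∀ A ∈ family n s q, A ⊆ V

theorem Part.row_le {N q : ℕ} {s : State} {V : Finset (Fin n)} (h : Part G t K N s q V) {i : ℕ}
    (hi : s.arr 7 q + n * i < s.arr 8 q) : s.arr 7 q + n * i + n ≤ s.reg 7 := by
  obtain ⟨k, -, hk⟩ := h.block
  have hle := h.le
  rw [hk] at hi hle
  have hik : i < k := by
    have : n * i < n * k := by omega
    exact lt_of_mul_lt_mul_left this (Nat.zero_le n)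
  have := Nat.mul_le_mul_left n (Nat.succ_le_of_lt hik)
  rw [Nat.mul_succ] at this
  omega

theorem Part.family_eq {N q : ℕ} {s s' : State} {V : Finset (Fin n)} (h : Part G t K N s q V)
    (hB : Below (s.reg 7) s s') (h7 : s'.arr 7 q = s.arr 7 q) (h8 : s'.arr 8 q = s.arr 8 q) :
    family n s' q = family n s q := by
  ext A
  simp only [family, Set.mem_ofPred_eq, h7, h8]
  refine exists_congr fun i => and_congr_right fun hi => ?_
  rw [hB.rowSet_eq (h.row_le hi)]

/-- New families are stored above all existing ones, and old rows are never moved or freed. A part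
whose mask and address range are untouched therefore keeps all its properties. -/
theorem Part.congr {N q : ℕ} {s s' : State} {V : Finset (Fin n)} (h : Part G t K N s q V)
    (hB : Below (s.reg 7) s s') (hR : s.reg 7 ≤ s'.reg 7) (h7 : s'.arr 7 q = s.arr 7 q)
    (h8 : s'.arr 8 q = s.arr 8 q) (h9 : maskSet n s' q = maskSet n s q) :
    Part G t K N s' q V where
  block := by rw [h7, h8]; exact h.block
  le := by rw [h8]; exact h.le.trans hR
  bool i hi := by
    rw [h7, h8] at hi
    rw [h7]
    exact hB.isBool (h.row_le hi) (h.bool i hi)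
  mask := by rw [h9, h.mask]
  rep := by rw [h.family_eq hB h7 h8]; exact h.rep

theorem NodePart.congr {N q : ℕ} {s s' : State} {V : Finset (Fin n)} (h : NodePart G t K N s q V)
    (hn : 0 < n) (hB : Below (s.reg 7) s s') (hR : s.reg 7 ≤ s'.reg 7)
    (h7 : s'.arr 7 q = s.arr 7 q) (h8 : s'.arr 8 q = s.arr 8 q)
    (h9 : maskSet n s' q = maskSet n s q) : NodePart G t K N s' q V where
  toPart := h.toPart.congr hB hR h7 h8 h9
  ok i hi := by
    rw [h7, h8] at hi
    rw [h7]
    exact hB.rowOK hn (h.toPart.row_le hi) (h.ok i hi)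
  sub := by rw [h.toPart.family_eq hB h7 h8]; exact h.sub

/-- What holds of the memory throughout the merging of the parts. -/
structure Mem (G : SimpleGraph (Fin n)) (t : Fin n → ℕ) (D : TreeDecomposition G m) (K : ℕ)
    (s : State) : Prop where
  static : Static G t D K s
  masks : MasksBool n m s
  auxLo : s.arr 7 m = 0
  auxHi : s.arr 8 m = n + n
  le : n + n ≤ s.reg 7
  bool0 : IsBool n s 0
  row0 : rowSet n s 0 = ∅
  bool1 : IsBool n s n
  row1 : rowSet n s n = Finset.univ

/-- The link between memory and exchange argument: the candidates are the combined family of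
`Represents.merge`, and the loops of `absorb` retain what `Represents.prune` requires. Rows of the
absorbed part are cut down to `Va` anyway, so it need not be a `NodePart`. -/
theorem absorb_parts {s : State} {B a : ℕ} {p : Fin m} {Va Vp : Finset (Fin n)}
    (hs : Mem G t D K s) (hn0 : 0 < n) (hn : n ≤ B) (hN : sigBound n K (D.width + 1) ≤ B)
    (ha : s.reg 8 = a) (ham : a ≤ m) (hp : s.reg 9 = p) (hap : a ≠ p)
    (hPa : Part G t K (sigBound n K (D.width + 1)) s a Va)
    (hPp : NodePart G t K (sigBound n K (D.width + 1)) s p Vp)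
    (hX : ∀ v ∈ Vp ∪ Va, v ∉ D.bag p → ∀ u, G.Adj v u → u ∈ Vp ∪ Va) :
    Spec absorb s (1100 * B ^ 4) fun s' =>
      Frame [7, 10, 11, 12, 13, 14, 15, 16, 17, 18] [7, 8, 9, 10, 11, 12] s s' ∧
      Mem G t D K s' ∧ NodePart G t K (sigBound n K (D.width + 1)) s' p (Vp ∪ Va) ∧
      (∀ q ≤ m, q ≠ p → maskSet n s' q = maskSet n s q) ∧
      (∀ q ≤ m, q ≠ p → ∀ V, NodePart G t K (sigBound n K (D.width + 1)) s q V →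
        NodePart G t K (sigBound n K (D.width + 1)) s' q V) := by
  obtain ⟨ka, hka, hka'⟩ := hPa.block
  obtain ⟨kb, hkb, hkb'⟩ := hPp.block
  have hlt : ∀ {l i k : ℕ}, l + n * i < l + n * k ↔ i < k := by
    intro l i k
    rw [Nat.add_lt_add_iff_left, Nat.mul_lt_mul_left hn0]
  refine (absorb_spec (la := s.arr 7 a) (lb := s.arr 7 p) hs.static ha ham hp hap hn0 hn hN hs.masks
    rfl hka' rfl hkb' (hka.trans hN) (hkb.trans hN) (hka' ▸ hPa.le) (hkb' ▸ hPp.le)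
    (fun i hi => hPa.bool i (by rw [hka']; exact hlt.2 hi))
    (fun i hi => hPp.bool i (by rw [hkb']; exact hlt.2 hi))).post ?_
  rintro s' ⟨hF, hB, hM, hmask, k, hk, hR, h7, h8, hok, hgood, hcand, hcomp⟩
  rw [hPp.mask, hPa.mask] at hgood hcomp
  rw [hPa.mask] at hcand
  have hRle : s.reg 7 ≤ s'.reg 7 := by omega
  have hmq : ∀ q ≤ m, q ≠ (p : ℕ) → maskSet n s' q = maskSet n s q := fun q hq hqp => by
    rw [hmask q hq, if_neg hqp]
  have hmp : (m : ℕ) ≠ p := p.2.ne'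
  have hsl := hs.le
  have hcandSub : ∀ i₂ < kb, ∀ A : Finset (Fin n),
      A ∩ Va ∪ rowSet n s (s.arr 7 p + n * i₂) \ Va ⊆ Vp ∪ Va := by
    intro i₂ h₂ A
    have := hPp.sub _ ⟨i₂, by rw [hkb']; exact hlt.2 h₂, rfl⟩
    intro v hv
    simp only [Finset.mem_union, Finset.mem_inter, Finset.mem_sdiff] at hv ⊢
    rcases hv with hv | hv
    · exact .inr hv.2
    · exact .inl (this hv.1)
  have h7p : s'.arr 7 p = s.reg 7 := by rw [h7, if_pos rfl]
  have h8p : s'.arr 8 p = s.reg 7 + n * k := by rw [h8, if_pos rfl]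
  refine ⟨hF, ?_, ?_, hmq, ?_⟩
  · exact ⟨hs.static.frame hF, hM, by rw [h7, if_neg hmp, hs.auxLo], by rw [h8, if_neg hmp, hs.auxHi],
      hs.le.trans hRle, hB.isBool (by omega) hs.bool0,
      by rw [hB.rowSet_eq (by omega), hs.row0], hB.isBool hs.le hs.bool1,
      by rw [hB.rowSet_eq hs.le, hs.row1]⟩
  · have hfam : ∀ j < k, rowSet n s' (s.reg 7 + n * j) ∈ family n s' p := fun j hj =>
      ⟨j, by rw [h7p, h8p]; exact hlt.2 hj, by rw [h7p]⟩
    have hsub : ∀ j < k, rowSet n s' (s.reg 7 + n * j) ⊆ Vp ∪ Va := by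
      intro j hj
      obtain ⟨i₁, -, i₂, h₂, he⟩ := hcand j hj
      rw [he]
      exact hcandSub i₂ h₂ _
    refine ⟨⟨⟨k, hk, by rw [h7p, h8p]⟩, by rw [h8p, hR], fun i hi => ?_, ?_, ?_⟩, fun i hi => ?_, ?_⟩
    · rw [h7p, h8p, hlt] at hi
      rw [h7p]
      exact (hok i hi).bool
    · rw [hmask p p.2.le, if_pos rfl, hPp.mask, hPa.mask]
    · refine (hPa.rep.merge hPp.rep).prune hX ?_ ?_
      · rintro _ ⟨A, -, C, ⟨i, hi, rfl⟩, rfl⟩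
        rw [hkb', hlt] at hi
        exact hcandSub i hi A
      · rintro _ ⟨A, ⟨i₁, h₁, rfl⟩, C, ⟨i₂, h₂, rfl⟩, rfl⟩ hg
        rw [hka', hlt] at h₁
        rw [hkb', hlt] at h₂
        obtain ⟨j, hj, hsig⟩ := hcomp i₁ h₁ i₂ h₂ hg
        exact ⟨_, hfam j hj, hsub j hj, hgood j hj, hsig⟩
    · rw [h7p, h8p, hlt] at hi
      rw [h7p]
      exact hok i hi
    · rintro _ ⟨i, hi, rfl⟩
      rw [h7p, h8p, hlt] at hi
      rw [h7p]
      exact hsub i hi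
  · intro q hq hqp V hV
    exact hV.congr hn0 hB hRle (by rw [h7, if_neg hqp]) (by rw [h8, if_neg hqp]) (hmq q hq hqp)

/-- Enter the vertex in register `20` into the part of the node in register `19`. -/
def enterVertex : Prog :=
  seq (store 9 (add (get 5 (reg 1)) (reg 20)) (const 1)) (seq (assign 8 (reg 1)) (seq
    (assign 9 (reg 19)) (seq absorb (store 9 (add (get 5 (reg 1)) (reg 20)) (const 0)))))

/-- Enter the vertices of each bag into the part of the node. -/
def enterBags : Prog :=
  countLoop 19 (reg 1) (countLoop 20 (reg 0) (cond (bagAt 19 20) enterVertex skip))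

theorem Mem.setReg {s : State} (h : Mem G t D K s) {r x : ℕ}
    (hr : r ∉ [0, 1, 3, 7]) : Mem G t D K (s.setReg r x) := by
  simp only [List.mem_cons, List.not_mem_nil, or_false, not_or] at hr
  refine ⟨h.static.frame (R := [r]) (A := []) ((Frame.refl _ _ _).setReg (by simp)) ?_ (by simp),
    h.masks, h.auxLo, h.auxHi, ?_, h.bool0, h.row0, h.bool1, h.row1⟩
  · simp; omega
  · rw [State.reg_setReg, if_neg (by omega)]
    exact h.le

theorem NodePart.setReg {s : State} {N q : ℕ} {V : Finset (Fin n)} (h : NodePart G t K N s q V)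
    (hn : 0 < n) {r x : ℕ} (hr : r ≠ 7) : NodePart G t K N (s.setReg r x) q V :=
  h.congr hn (below_of_arr_eq rfl rfl rfl)
    (by rw [State.reg_setReg, if_neg (by omega)]) rfl rfl rfl

theorem mul_add_inj {q q' v v' : ℕ} (hv : v < n) (hv' : v' < n) (h : q * n + v = q' * n + v') :
    q = q' ∧ v = v' := by
  have hn : 0 < n := by omega
  have h1 : (q * n + v) / n = q := by
    rw [mul_comm, Nat.mul_add_div hn, Nat.div_eq_of_lt hv, add_zero]
  have h2 : (q' * n + v') / n = q' := by
    rw [mul_comm, Nat.mul_add_div hn, Nat.div_eq_of_lt hv', add_zero]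
  have h3 : q = q' := by rw [← h1, h, h2]
  subst h3
  exact ⟨rfl, by omega⟩

theorem maskSet_setArr {s : State} {q q' x : ℕ} (v : Fin n) :
    maskSet n (s.setArr 9 (q * n + v) x) q' =
      if q' = q then (if x = 0 then (maskSet n s q).erase v else insert v (maskSet n s q))
      else maskSet n s q' := by
  ext u
  rw [mem_maskSet, State.arr_setArr]
  by_cases hq : q' = q
  · subst hq
    by_cases huv : u = v
    · subst huv
      simp only [and_self, if_true]
      split_ifs with hx <;> simp [hx]
    · have : ¬ (u : ℕ) = v := fun h => huv (Fin.ext h)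
      simp only [true_and, Nat.add_left_cancel_iff, this, if_false, if_true]
      split_ifs <;> simp [huv]
  · have : ¬ q' * n + u = q * n + v := fun h => hq (mul_add_inj u.2 v.2 h).1
    simp [this, hq]

theorem Mem.setMask {s : State} (h : Mem G t D K s) {j x : ℕ} (hx : x ≤ 1) :
    Mem G t D K (s.setArr 9 j x) := by
  have hb : ∀ X, Below X s (s.setArr 9 j x) := fun X i _ => by simp
  refine ⟨h.static.frame (R := []) (A := [9]) ((Frame.refl _ _ _).setArr (by simp)), ?_,
    by simpa using h.auxLo, by simpa using h.auxHi, h.le, (hb n).isBool (by omega) h.bool0,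
    by rw [(hb n).rowSet_eq (by omega), h.row0], (hb (n + n)).isBool le_rfl h.bool1,
    by rw [(hb (n + n)).rowSet_eq le_rfl, h.row1]⟩
  intro q hq v
  simp only [State.arr_setArr]
  split_ifs
  · exact hx
  · exact h.masks q hq v

theorem NodePart.setMask {s : State} {N q q' x : ℕ} {V : Finset (Fin n)}
    (h : NodePart G t K N s q V) (hn : 0 < n) (hq : q ≠ q') (v : Fin n) :
    NodePart G t K N (s.setArr 9 (q' * n + v) x) q V :=
  h.congr hn (fun i _ => by simp) le_rfl (by simp) (by simp) (by rw [maskSet_setArr, if_neg hq])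

/-- The auxiliary part always has the rows `∅` and `Finset.univ`, and only its mask changes with
`v`. The full row leaves `{v}`, and `Mem` says nothing of stored counts, so only `Part` is claimed.
-/
theorem Mem.auxPart {s : State} (h : Mem G t D K s) {N : ℕ} (hN : 2 ≤ N) (hn : 0 < n) (v : Fin n)
    (hv : maskSet n s m = {v}) : Part G t K N s m {v} := by
  have hi : ∀ i, s.arr 7 m + n * i < s.arr 8 m → i = 0 ∨ i = 1 := by
    intro i hi
    rw [h.auxLo, h.auxHi] at hi
    have : n * i < n * 2 := by omega
    have := lt_of_mul_lt_mul_left this (Nat.zero_le n)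
    omega
  refine ⟨⟨2, hN, by rw [h.auxLo, h.auxHi]; omega⟩, by rw [h.auxHi]; exact h.le, ?_, hv, ?_⟩
  · intro i hi'
    rcases hi i hi' with rfl | rfl
    · simpa [h.auxLo] using h.bool0
    · simpa [h.auxLo] using h.bool1
  · refine represents_singleton v ⟨0, ?_, ?_⟩ ⟨1, ?_, ?_⟩
    · rw [h.auxLo, h.auxHi]; omega
    · simpa [h.auxLo] using h.row0.symm
    · rw [h.auxLo, h.auxHi]; omega
    · simpa [h.auxLo] using h.row1.symm

theorem two_le_sigBound (n K W : ℕ) (hn : 0 < n) : 2 ≤ sigBound n K W := by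
  unfold sigBound
  have : 1 ≤ (2 * (K + 1)) ^ W := Nat.one_le_pow _ _ (by omega)
  nlinarith

/-- The auxiliary mask is `{v}` during the call of `absorb` and empty again afterwards. All vertices
involved lie in the bag of `p`, so there is no vertex outside the bag to which the separation
hypothesis of pruning could apply. -/
theorem enterVertex_spec {s : State} {B : ℕ} {p : Fin m} {v : Fin n} {Vp : Finset (Fin n)}
    (hs : Mem G t D K s) (hn0 : 0 < n) (hn : n ≤ B) (hN : sigBound n K (D.width + 1) ≤ B)
    (haux : maskSet n s m = ∅) (h19 : s.reg 19 = p) (h20 : s.reg 20 = v) (hv : v ∈ D.bag p)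
    (hVp : Vp ⊆ D.bag p) (hPp : NodePart G t K (sigBound n K (D.width + 1)) s p Vp) :
    Spec enterVertex s (1120 * B ^ 4) fun s' => s'.reg 19 = p ∧ s'.reg 20 = v ∧
      s'.arr 13 = s.arr 13 ∧ Mem G t D K s' ∧ maskSet n s' m = ∅ ∧
      NodePart G t K (sigBound n K (D.width + 1)) s' p (Vp ∪ {v}) ∧
      ∀ q : Fin m, q ≠ p → ∀ V, NodePart G t K (sigBound n K (D.width + 1)) s q V →
        NodePart G t K (sigBound n K (D.width + 1)) s' q V := by
  have hB : 1 ≤ B := by omega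
  have hmulm := hs.static.muln m (by omega)
  let s₀ := ((s.setArr 9 (m * n + v) 1).setReg 8 m).setReg 9 p
  have M0 : Mem G t D K s₀ := ((hs.setMask (by simp)).setReg (by simp)).setReg (by simp)
  have P0 : ∀ (q : Fin m) V, NodePart G t K (sigBound n K (D.width + 1)) s q V →
      NodePart G t K (sigBound n K (D.width + 1)) s₀ q V := fun q V h =>
    ((h.setMask (q' := m) hn0 q.2.ne v).setReg hn0 (by decide)).setReg hn0 (by decide)
  have mask0 : maskSet n s₀ m = {v} := by
    refine (maskSet_setArr (s := s) v).trans ?_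
    rw [if_pos rfl, if_neg one_ne_zero, haux]
    rfl
  refine Spec.weaken (Spec.seq (Spec.store (Spec.seq (Spec.assign (Spec.seq (Spec.assign
    (Spec.congr_state (s := s₀) ?_ (Spec.seq_of (absorb_parts (t := t) (a := m) (p := p)
      (Va := {v}) (Vp := Vp) (B := B) M0 hn0 hn hN ?_ le_rfl ?_ p.2.ne'
      (M0.auxPart (two_le_sigBound _ _ _ hn0) hn0 v mask0) (P0 p _ hPp) ?_)
      ?_ (T₂ := 10))))))))) ?_
  · simp [s₀, hs.static.reg1, hmulm, h19, h20]
  · simp [s₀]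
  · simp [s₀]
  · intro u hu hu'
    exfalso
    apply hu'
    rcases Finset.mem_union.1 hu with hu | hu
    · exact hVp hu
    · rw [Finset.mem_singleton.1 hu]
      exact hv
  · rintro s₂ ⟨hF, hM₂, hPp, hmq, hPq⟩
    have r19 : s₂.reg 19 = p := by rw [hF.reg 19 (by decide)]; simp [s₀, h19]
    have r20 : s₂.reg 20 = v := by rw [hF.reg 20 (by decide)]; simp [s₀, h20]
    refine Spec.weaken (Spec.store ?_) (by simp [Expr.cost])
    have e1 : (add (get 5 (reg 1)) (reg 20)).eval s₂ = m * n + v := by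
      simp [hM₂.static.reg1, r20, hM₂.static.muln m (by omega)]
    have e2 : (Expr.const 0).eval s₂ = 0 := rfl
    rw [e1, e2]
    refine ⟨r19, r20, ?_, hM₂.setMask (by simp), ?_, hPp.setMask hn0 p.2.ne v, fun q hq V hV => ?_⟩
    · funext x
      have := congrFun (hF.arr 13 (by decide)) x
      simp [this, s₀]
    · rw [maskSet_setArr, if_pos rfl, if_pos rfl, hmq m le_rfl p.2.ne', mask0]
      simp
    · exact (hPq q q.2.le (fun h => hq (Fin.ext h)) V (P0 q V hV)).setMask hn0 q.2.ne v
  · have : 1 ≤ B ^ 4 := Nat.one_le_pow _ _ hB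
    simp only [Expr.cost]
    omega

theorem enterBags_spec {s : State} {B : ℕ} (hs : Mem G t D K s) (hn0 : 0 < n) (hn : n ≤ B)
    (hm : m ≤ B) (hN : sigBound n K (D.width + 1) ≤ B) (haux : maskSet n s m = ∅)
    (hparts : ∀ q : Fin m, NodePart G t K (sigBound n K (D.width + 1)) s q ∅) :
    Spec enterBags s (1200 * B ^ 6) fun s' => s'.arr 13 = s.arr 13 ∧ Mem G t D K s' ∧
      ∀ q : Fin m, NodePart G t K (sigBound n K (D.width + 1)) s' q (D.bag q) := by
  have hB : 1 ≤ B := by omega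
  set N := sigBound n K (D.width + 1) with hNdef
  -- `V i j q` is what has been entered into part `q` when the double loop reaches node `i` and
  -- vertex `j`.
  let V : ℕ → ℕ → Fin m → Finset (Fin n) := fun i j q =>
    (D.bag q).filter fun v => (q : ℕ) < i ∨ (q : ℕ) = i ∧ (v : ℕ) < j
  let I : ℕ → ℕ → State → Prop := fun i j s' => s'.arr 13 = s.arr 13 ∧ Mem G t D K s' ∧
    maskSet n s' m = ∅ ∧ ∀ q : Fin m, NodePart G t K N s' q (V i j q)
  have hIset : ∀ {i j s' r x}, I i j s' → r = 19 ∨ r = 20 → I i j (s'.setReg r x) := by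
    rintro i j s' r x ⟨h13, hM, ha, hP⟩ hr
    exact ⟨h13, hM.setReg (by rcases hr with rfl | rfl <;> simp), ha,
      fun q => (hP q).setReg hn0 (by omega)⟩
  refine Spec.weaken (Spec.post (Spec.countLoop (T := 1170 * B ^ 5) (k := m)
    (fun i s' => s'.reg 19 = i ∧ I i 0 s') ?_ ?_ ?_) ?_) ?_
  · refine ⟨by simp, hIset ⟨rfl, hs, haux, fun q => ?_⟩ (by simp)⟩
    have : V 0 0 q = ∅ := by simp [V]
    rw [this]
    exact hparts q
  · rintro i s' - ⟨h19, h⟩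
    exact ⟨h19, h.2.1.static.reg1⟩
  · rintro i s' hi ⟨h19, h⟩
    refine Spec.weaken (Spec.post (Spec.countLoop (T := 1150 * B ^ 4) (k := n)
      (fun j s' => s'.reg 19 = i ∧ s'.reg 20 = j ∧ I i j s') ?_ ?_ ?_) ?_) ?_
    · exact ⟨by simp [h19], by simp, hIset h (by simp)⟩
    · rintro j s' - ⟨-, h20, h⟩
      exact ⟨h20, h.2.1.static.reg0⟩
    · rintro j s' hj ⟨h19, h20, h⟩
      obtain ⟨h13, hM, ha, hP⟩ := h
      have hmuli := hM.static.muln i (by omega)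
      let p : Fin m := ⟨i, hi⟩
      let v : Fin n := ⟨j, hj⟩
      have hbag := hM.static.bag p v
      have hVne : ∀ q : Fin m, q ≠ p → V i (j + 1) q = V i j q := by
        intro q hq
        have : (q : ℕ) ≠ i := fun h => hq (Fin.ext h)
        simp [V, this]
      refine Spec.weaken (Spec.cond (T := 1120 * B ^ 4) (fun hc => ?_) (fun hc => ?_)) ?_
      · have hv : v ∈ D.bag p := by
          by_contra hv
          rw [if_neg hv] at hbag
          simp only [p, v] at hbag
          simp [h19, h20, hmuli, hbag] at hc
        refine (enterVertex_spec (p := p) (v := v) hM hn0 hn hN ha h19 h20 hv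
          (Finset.filter_subset _ _) (hP p)).post ?_
        rintro s₂ ⟨r19, r20, h13', hM₂, ha₂, hPp, hPq⟩
        refine ⟨by simp [r19, p], by simp [r20, v], hIset ⟨h13'.trans h13, hM₂, ha₂, fun q => ?_⟩
          (by simp)⟩
        by_cases hq : q = p
        · subst hq
          have : V i (j + 1) p = V i j p ∪ {v} := by
            ext u
            simp only [V, Finset.mem_filter, Finset.mem_union, Finset.mem_singleton]
            constructor
            · rintro ⟨h1, h2⟩
              by_cases huv : u = v
              · exact .inr huv
              · refine .inl ⟨h1, ?_⟩
                have : (u : ℕ) ≠ j := fun h => huv (Fin.ext h)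
                omega
            · rintro (⟨h1, h2⟩ | rfl)
              · exact ⟨h1, by omega⟩
              · exact ⟨hv, .inr ⟨rfl, Nat.lt_succ_self j⟩⟩
          rw [this]
          exact hPp
        · rw [hVne q hq]
          exact hPq q hq _ (hP q)
      · have hv : v ∉ D.bag p := by
          intro hv
          rw [if_pos hv] at hbag
          simp only [p, v] at hbag
          simp [h19, h20, hmuli, hbag] at hc
        refine Spec.weaken (Spec.skip ⟨by simp [h19], by simp [h20], hIset ⟨h13, hM, ha, fun q => ?_⟩
          (by simp)⟩) ?_
        · by_cases hq : q = p
          · subst hq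
            have : V i (j + 1) p = V i j p := by
              refine Finset.filter_congr fun u hu => ?_
              have : (u : ℕ) ≠ j := by
                intro h
                have : u = v := Fin.ext h
                exact hv (this ▸ hu)
              omega
            rw [this]
            exact hP p
          · rw [hVne q hq]
            exact hP q
        · have : 1 ≤ B ^ 4 := Nat.one_le_pow _ _ hB
          omega
      · have : 1 ≤ B ^ 4 := Nat.one_le_pow _ _ hB
        simp only [Expr.cost]
        omega
    · rintro s' ⟨h19, -, h⟩
      refine ⟨by simp [h19], ?_⟩
      obtain ⟨h13, hM, ha, hP⟩ := h
      refine hIset ⟨h13, hM, ha, fun q => ?_⟩ (by simp)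
      have : V (i + 1) 0 q = V i n q := Finset.filter_congr fun u _ => by
        have := u.2
        omega
      rw [this]
      exact hP q
    · refine (loop_bound hB hn le_rfl).trans ?_
      simp only [Expr.cost]
      gcongr
      omega
  · rintro s' ⟨-, h13, hM, -, hP⟩
    refine ⟨h13, hM, fun q => ?_⟩
    have : V m 0 q = D.bag q := by simp [V]
    rw [← this]
    exact hP q
  · refine (loop_bound hB hm le_rfl).trans ?_
    simp only [Expr.cost]
    gcongr
    omega

/-! ### Contracting the tree -/

/-- The eliminated nodes. -/
def deadSet (m : ℕ) (s : State) : Set (Fin m) := {x | s.arr 13 x ≠ 0}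

theorem mem_deadSet {s : State} {x : Fin m} : x ∈ deadSet m s ↔ s.arr 13 x ≠ 0 := Iff.rfl

/-- The node `a` has not been eliminated, and `b` is its only neighbour of this kind. -/
def IsLeafAt (T : SimpleGraph (Fin m)) (dead : Set (Fin m)) (a b : Fin m) : Prop :=
  (T.Adj a b ∧ b ∉ dead) ∧ ∀ y, T.Adj a y → y ∉ dead → y = b

/-- Nonzero iff the node in register `14` is a neighbour of the one in register `r` and
not eliminated. -/
abbrev treeGuard (r : ℕ) : Expr := sub (get 2 (add (get 6 (reg r)) (reg 14))) (get 13 (reg 14))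

/-- Find a leaf among the remaining nodes and write it to register `8`, or `m` if there is none. -/
def findLeaf : Prog :=
  seq (assign 8 (reg 1)) (countLoop 20 (reg 1) (cond (get 13 (reg 20)) skip
    (seq (assign 15 (const 0)) (seq (sumLoop 14 15 (reg 1) (treeGuard 20) (const 1))
      (cond (absDiff (reg 15) (const 1)) skip (assign 8 (reg 20)))))))

/-- Write the remaining neighbour of the leaf in register `8` to register `9`. -/
def findNeighbour : Prog :=
  seq (assign 9 (const 0)) (sumLoop 14 9 (reg 1) (treeGuard 8) (reg 14))

/-- Merge a leaf into its neighbour. -/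
def contractLeaf : Prog :=
  seq findLeaf (cond (sub (reg 1) (reg 8))
    (seq findNeighbour (seq absorb (store 13 (reg 8) (const 1)))) skip)

/-- Merge leaves into their neighbours until one node is left. -/
def contractTree : Prog := countLoop 19 (reg 1) contractLeaf

open Classical in
theorem sum_treeGuard {s : State} (hs : Static G t D K s) (a : Fin m) (f : ℕ → ℕ) :
    (∑ y ∈ Finset.range m, if s.arr 2 (a * m + y) - s.arr 13 y ≠ 0 then f y else 0) =
      ∑ y ∈ Finset.univ.filter (fun y : Fin m => D.tree.Adj a y ∧ y ∉ deadSet m s), f y := by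
  rw [Finset.sum_range (fun y => if s.arr 2 (a * m + y) - s.arr 13 y ≠ 0 then f y else 0),
    Finset.sum_filter]
  refine Finset.sum_congr rfl fun y _ => ?_
  rw [hs.tree, mem_deadSet]
  by_cases h : D.tree.Adj a y
  · simp only [h, if_true, true_and]
    refine if_congr ?_ rfl rfl
    omega
  · simp [h]

open Classical in
-- The sum counts the neighbours of `a` that have not been eliminated; leaves are the nodes with
-- exactly one.
theorem exists_isLeafAt_iff {s : State} (hs : Static G t D K s) (a : Fin m) :
    (∃ b, IsLeafAt D.tree (deadSet m s) a b) ↔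
      (∑ y ∈ Finset.range m, if s.arr 2 (a * m + y) - s.arr 13 y ≠ 0 then 1 else 0) = 1 := by
  rw [sum_treeGuard hs a (fun _ => 1), ← Finset.card_eq_sum_ones, Finset.card_eq_one]
  refine exists_congr fun b => ?_
  simp only [IsLeafAt, Finset.ext_iff, Finset.mem_filter, Finset.mem_univ, true_and,
    Finset.mem_singleton]
  constructor
  · rintro ⟨h1, h2⟩ y
    exact ⟨fun h => h2 y h.1 h.2, by rintro rfl; exact h1⟩
  · intro h
    exact ⟨(h b).2 rfl, fun y h1 h2 => (h y).1 ⟨h1, h2⟩⟩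

theorem findLeaf_spec {s : State} {B : ℕ} (hs : Static G t D K s) (hm : m ≤ B) (hB : 1 ≤ B) :
    Spec findLeaf s (110 * B ^ 2) fun s' => Frame [8, 14, 15, 20] [] s s' ∧
      ((∃ a : Fin m, s'.reg 8 = a ∧ a ∉ deadSet m s ∧ ∃ b, IsLeafAt D.tree (deadSet m s) a b) ∨
        (s'.reg 8 = m ∧
          ∀ a : Fin m, a ∉ deadSet m s → ¬ ∃ b, IsLeafAt D.tree (deadSet m s) a b)) := by
  have h1 : 1 ≤ B ^ 2 := Nat.one_le_pow _ _ hB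
  have key := loop_bound (B := B) (k := m) (T := 80 * B ^ 1) (c := 80) (j := 1) (d := 8) (e := 6)
    hB hm le_rfl
  refine Spec.weaken (Spec.seq (Spec.assign (Spec.post (Spec.countLoop (T := 80 * B ^ 1) (k := m)
    (fun i s' => s'.reg 20 = i ∧ Frame [8, 14, 15, 20] [] s s' ∧
      ((∃ a : Fin m, s'.reg 8 = a ∧ a ∉ deadSet m s ∧ ∃ b, IsLeafAt D.tree (deadSet m s) a b) ∨
        (s'.reg 8 = m ∧
          ∀ a : Fin m, (a : ℕ) < i → a ∉ deadSet m s →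
            ¬ ∃ b, IsLeafAt D.tree (deadSet m s) a b))) ?_ ?_ ?_) ?_))) ?_
  · refine ⟨by simp, ((Frame.refl _ _ _).setReg (by simp)).setReg (by simp), .inr ⟨?_, ?_⟩⟩
    · simp [hs.reg1]
    · intro a ha
      omega
  · rintro i s' - ⟨h20, hF, -⟩
    exact ⟨h20, (hs.frame hF).reg1⟩
  · rintro i s' hi ⟨h20, hF, h⟩
    have hs' := hs.frame hF
    have harr : s'.arr = s.arr := funext fun a => hF.arr a (by simp)
    have hmul := hs.mulm i (by omega)
    let a : Fin m := ⟨i, hi⟩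
    have hskip : (a ∈ deadSet m s ∨ ¬ ∃ b, IsLeafAt D.tree (deadSet m s) a b) →
        (∃ a : Fin m, s'.reg 8 = a ∧ a ∉ deadSet m s ∧ ∃ b, IsLeafAt D.tree (deadSet m s) a b) ∨
        (s'.reg 8 = m ∧
          ∀ a : Fin m, (a : ℕ) < i + 1 → a ∉ deadSet m s →
            ¬ ∃ b, IsLeafAt D.tree (deadSet m s) a b) := by
      intro ha
      refine h.imp_right fun ⟨h8, hno⟩ => ⟨h8, fun x hx hxd => ?_⟩
      rcases Nat.lt_succ_iff_lt_or_eq.1 hx with hx | hx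
      · exact hno x hx hxd
      · obtain rfl : x = a := Fin.ext hx
        rcases ha with ha | ha
        · exact absurd ha hxd
        · exact ha
    refine Spec.weaken (Spec.cond (T := 70 * B) (fun hc => ?_) (fun hc => ?_)) ?_
    · refine Spec.weaken (Spec.skip ⟨by simp [h20], hF.setReg (by simp), ?_⟩) (by omega)
      have := hskip (.inl (by simpa [mem_deadSet, a, harr, h20] using hc))
      simpa using this
    · have ha : a ∉ deadSet m s := by
        simpa [mem_deadSet, a, harr, h20] using hc
      refine Spec.weaken (Spec.seq (Spec.assign (Spec.seq (Spec.sumLoop (k := m)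
        (fun y => if s.arr 2 (i * m + y) - s.arr 13 y ≠ 0 then 1 else 0) (by decide) ?_ ?_
        (Spec.cond (T := 2) (fun hd => ?_) (fun hd => ?_)))))) ?_
      · intro j x
        simp [hs'.reg1]
      · intro j x hj
        simp [harr, h20, hmul]
      · refine Spec.weaken (Spec.skip ⟨by simp [h20], (((hF.setReg (by simp)).setReg
          (by simp)).setReg (by simp)).setReg (by simp), ?_⟩) (by omega)
        have hl : ¬ ∃ b, IsLeafAt D.tree (deadSet m s) a b := by
          rw [exists_isLeafAt_iff hs]
          intro h1
          simp only [a] at h1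
          simp only [Expr.eval, State.reg_setReg] at hd
          norm_num at hd h1
          rw [h1] at hd
          simp at hd
        simpa using hskip (.inr hl)
      · refine Spec.weaken (Spec.assign ⟨by simp [h20], ((((hF.setReg (by simp)).setReg
          (by simp)).setReg (by simp)).setReg (by simp)).setReg (by simp), .inl ⟨a, ?_, ha, ?_⟩⟩)
          (by simp [Expr.cost])
        · simp [h20, a]
        · rw [exists_isLeafAt_iff hs]
          simp only [a]
          simp only [Expr.eval, State.reg_setReg] at hd
          norm_num at hd ⊢
          omega
      · simp only [Expr.cost]
        omega
    · simp only [Expr.cost, pow_one]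
      omega
  · rintro s' ⟨-, hF, h⟩
    refine ⟨hF, h.imp_right fun ⟨h8, hno⟩ => ⟨h8, fun a ha => hno a a.2 ha⟩⟩
  · simp only [Expr.cost, Nat.reduceAdd] at key ⊢
    omega

open Classical in
-- Summing the indices of the remaining neighbours yields the neighbour itself, as there is only
-- one.
theorem findNeighbour_spec {s : State} {B : ℕ} (hs : Static G t D K s) (hm : m ≤ B) (hB : 1 ≤ B)
    {a b : Fin m} (ha : s.reg 8 = a) (hab : IsLeafAt D.tree (deadSet m s) a b) :
    Spec findNeighbour s (40 * B) fun s' => Frame [9, 14] [] s s' ∧ s'.reg 9 = b := by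
  have hmul := hs.mulm a (by omega)
  have hsum : (∑ y ∈ Finset.range m, if s.arr 2 (a * m + y) - s.arr 13 y ≠ 0 then y else 0) = b := by
    rw [sum_treeGuard hs a (fun y => y)]
    have : Finset.univ.filter (fun y : Fin m => D.tree.Adj a y ∧ y ∉ deadSet m s) = {b} := by
      ext y
      simp only [Finset.mem_filter, Finset.mem_univ, true_and, Finset.mem_singleton]
      exact ⟨fun h => hab.2 y h.1 h.2, by rintro rfl; exact hab.1⟩
    rw [this, Finset.sum_singleton]
  refine Spec.weaken (Spec.seq (Spec.assign (Spec.sumLoop (k := m)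
    (fun y => if s.arr 2 (a * m + y) - s.arr 13 y ≠ 0 then y else 0) (by decide) ?_ ?_ ⟨?_, ?_⟩))) ?_
  · intro i x
    simp [hs.reg1]
  · intro i x hi
    simp [ha, hmul]
  · exact (((Frame.refl _ _ _).setReg (by simp)).setReg (by simp)).setReg (by simp)
  · simpa using hsum
  · simp only [Expr.cost]
    omega

/-- State of the contraction of the tree. -/
def Contracted (G : SimpleGraph (Fin n)) (t : Fin n → ℕ) (D : TreeDecomposition G m) (K : ℕ)
    (s : State) : Prop :=
  Mem G t D K s ∧ ∃ ρ, D.tree.Elimination (deadSet m s) ρ ∧ ∀ q : Fin m, q ∉ deadSet m s →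
    NodePart G t K (sigBound n K (D.width + 1)) s q (partVerts D ρ q)

theorem Mem.frame {s s' : State} {R : List ℕ} (h : Mem G t D K s) (hF : Frame R [] s s')
    (hR : ∀ r ∈ [0, 1, 3, 7], r ∉ R := by decide) : Mem G t D K s' := by
  have harr : s'.arr = s.arr := funext fun a => hF.arr a (by simp)
  have hb : ∀ X, Below X s s' := fun X =>
    below_of_arr_eq (by rw [harr]) (by rw [harr]) (by rw [harr])
  exact ⟨h.static.frame hF (fun r hr => hR r (by simp at hr ⊢; omega)) (by simp),
    by rw [MasksBool, harr]; exact h.masks,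
    by rw [harr, h.auxLo], by rw [harr, h.auxHi], by rw [hF.reg 7 (hR 7 (by simp))]; exact h.le,
    (hb n).isBool (by omega) h.bool0, by rw [(hb n).rowSet_eq (by omega), h.row0],
    (hb (n + n)).isBool le_rfl h.bool1, by rw [(hb (n + n)).rowSet_eq le_rfl, h.row1]⟩

theorem NodePart.frame {s s' : State} {R A : List ℕ} {N q : ℕ} {V : Finset (Fin n)}
    (h : NodePart G t K N s q V) (hn : 0 < n) (hF : Frame R A s s') (hR : 7 ∉ R := by decide)
    (hA : ∀ a ∈ [7, 8, 9, 10, 11, 12], a ∉ A := by decide) : NodePart G t K N s' q V :=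
  h.congr hn (below_of_arr_eq (hF.arr _ (hA 10 (by simp))) (hF.arr _ (hA 11 (by simp)))
    (hF.arr _ (hA 12 (by simp)))) (hF.reg 7 hR).ge (by rw [hF.arr _ (hA 7 (by simp))])
    (by rw [hF.arr _ (hA 8 (by simp))]) (maskSet_congr (hF.arr _ (hA 9 (by simp))) q)

theorem Mem.setDead {s : State} (h : Mem G t D K s) (j x : ℕ) : Mem G t D K (s.setArr 13 j x) := by
  have hb : ∀ X, Below X s (s.setArr 13 j x) := fun X i _ => by simp
  refine ⟨h.static.frame (R := []) (A := [13]) ((Frame.refl _ _ _).setArr (by simp)), ?_,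
    by simpa using h.auxLo, by simpa using h.auxHi, h.le, (hb n).isBool (by omega) h.bool0,
    by rw [(hb n).rowSet_eq (by omega), h.row0], (hb (n + n)).isBool le_rfl h.bool1,
    by rw [(hb (n + n)).rowSet_eq le_rfl, h.row1]⟩
  intro q hq v
  simpa using h.masks q hq v

theorem deadSet_setArr {s : State} (a : Fin m) :
    deadSet m (s.setArr 13 a 1) = insert a (deadSet m s) := by
  ext x
  rw [mem_deadSet, Set.mem_insert_iff, mem_deadSet]
  by_cases h : x = a
  · simp [h]
  · have : (x : ℕ) ≠ a := fun h' => h (Fin.ext h')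
    simp [h, this]

/-- After merging the leaf `a` into `b`, the vertex set of part `b` is the union of the two old
ones, and the new elimination state provides the separation needed for pruning. If the search finds
no leaf, `Elimination.exists_leaf` shows that at most one node is left. -/
theorem contractLeaf_spec {s : State} {B : ℕ} (hs : Contracted G t D K s) (hn0 : 0 < n)
    (hn : n ≤ B) (hm : m ≤ B) (hN : sigBound n K (D.width + 1) ≤ B) :
    Spec contractLeaf s (1300 * B ^ 4) fun s' => s'.reg 19 = s.reg 19 ∧ Contracted G t D K s' ∧
      ((deadSet m s')ᶜ.ncard + 1 ≤ (deadSet m s)ᶜ.ncard ∨ (deadSet m s')ᶜ.ncard ≤ 1) := by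
  have hB : 1 ≤ B := by omega
  obtain ⟨hM, ρ, hE, hP⟩ := hs
  refine Spec.weaken (Spec.seq_of (findLeaf_spec hM.static hm hB) ?_ (T₂ := 1180 * B ^ 4)) ?_
  · rintro s₁ ⟨hF₁, hcase⟩
    have hM₁ := hM.frame hF₁
    have d₁ : deadSet m s₁ = deadSet m s := by
      rw [deadSet, hF₁.arr 13 (by simp), deadSet]
    have r19 : s₁.reg 19 = s.reg 19 := hF₁.reg 19 (by decide)
    refine Spec.weaken (Spec.cond (T := 1160 * B ^ 4) (fun hc => ?_) (fun hc => ?_)) ?_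
    · obtain ⟨a, ha, had, b, hab⟩ : ∃ a : Fin m, s₁.reg 8 = a ∧ a ∉ deadSet m s ∧
          ∃ b, IsLeafAt D.tree (deadSet m s) a b := by
        rcases hcase with h | ⟨h8, -⟩
        · exact h
        · simp [hM₁.static.reg1, h8] at hc
      have hne : a ≠ b := hab.1.1.ne
      refine Spec.weaken (Spec.seq_of (findNeighbour_spec hM₁.static hm hB ha (d₁ ▸ hab)) ?_
        (T₂ := 1110 * B ^ 4)) ?_
      · rintro s₂ ⟨hF₂, h9⟩
        have hM₂ := hM₁.frame hF₂
        have hP₂ : ∀ q : Fin m, q ∉ deadSet m s →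
            NodePart G t K (sigBound n K (D.width + 1)) s₂ q (partVerts D ρ q) := fun q hq =>
          ((hP q hq).frame hn0 hF₁).frame hn0 hF₂
        have hE' := hE.step hab.1.2 hab.1.1 hab.2
        set ρ' : Fin m → Fin m := fun x => if ρ x = a then b else ρ x with hρ'
        have hpart : partVerts D ρ' b = partVerts D ρ b ∪ partVerts D ρ a := by
          ext v
          rw [Finset.mem_union, mem_partVerts, mem_partVerts, mem_partVerts]
          constructor
          · rintro ⟨x, hx, hv⟩
            by_cases hxa : ρ x = a
            · exact .inr ⟨x, hxa, hv⟩
            · simp only [hρ', if_neg hxa] at hx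
              exact .inl ⟨x, hx, hv⟩
          · rintro (⟨x, hx, hv⟩ | ⟨x, hx, hv⟩)
            · exact ⟨x, by simp [hρ', hx, hne.symm], hv⟩
            · exact ⟨x, by simp [hρ', hx], hv⟩
        refine Spec.weaken (Spec.seq_of (absorb_parts (a := a) (p := b) hM₂ hn0 hn hN
          (by rw [hF₂.reg 8 (by decide), ha]) a.2.le h9 (fun h => hne (Fin.ext h))
          (hP₂ a had).toPart (hP₂ b hab.1.2) ?_) ?_ (T₂ := 4)) ?_
        · rw [← hpart]
          intro v hv hvb u hu
          exact mem_partVerts_of_adj hE' hv hvb hu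
        · rintro s₃ ⟨hF₃, hM₃, hPb, -, hPq⟩
          have r8 : s₃.reg 8 = a := by rw [hF₃.reg 8 (by decide), hF₂.reg 8 (by decide), ha]
          have d₃ : deadSet m s₃ = deadSet m s := by
            rw [deadSet, hF₃.arr 13 (by simp), hF₂.arr 13 (by simp), hF₁.arr 13 (by simp), deadSet]
          refine Spec.weaken (Spec.store ?_) (by simp [Expr.cost])
          simp only [Expr.eval, r8]
          have d₄ := deadSet_setArr (s := s₃) a
          rw [d₃] at d₄
          refine ⟨?_, ⟨hM₃.setDead _ _, ρ', ?_, fun q hq => ?_⟩, .inl ?_⟩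
          · rw [State.reg_setArr, hF₃.reg 19 (by decide), hF₂.reg 19 (by decide), r19]
          · rw [d₄]
            exact hE'
          · rw [d₄, Set.mem_insert_iff, not_or] at hq
            refine NodePart.frame (s := s₃) (R := []) (A := [13]) ?_ hn0
              ((Frame.refl _ _ _).setArr (by simp))
            by_cases hqb : q = b
            · subst hqb
              rw [hpart]
              exact hPb
            · have : partVerts D ρ' q = partVerts D ρ q := by
                ext v
                rw [mem_partVerts, mem_partVerts]
                refine exists_congr fun x => and_congr_left fun _ => ?_
                by_cases hxa : ρ x = a
                · simp [hρ', hxa, Ne.symm hqb, Ne.symm hq.1]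
                · simp [hρ', hxa]
              rw [this]
              exact hPq q q.2.le (fun h => hqb (Fin.ext h)) _ (hP₂ q hq.2)
          · rw [d₄]
            have : (insert a (deadSet m s))ᶜ = (deadSet m s)ᶜ \ {a} := by
              ext x
              simp only [Set.mem_compl_iff, Set.mem_insert_iff, not_or, Set.mem_sdiff,
                Set.mem_singleton_iff]
              tauto
            rw [this, Set.ncard_sdiff_singleton_add_one had (Set.toFinite _)]
        · have : 1 ≤ B ^ 4 := Nat.one_le_pow _ _ hB
          omega
      · have : B ≤ B ^ 4 := Nat.le_self_pow (by omega) B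
        omega
    · have hno : ∀ a : Fin m, a ∉ deadSet m s → ¬ ∃ b, IsLeafAt D.tree (deadSet m s) a b := by
        rcases hcase with ⟨a, ha, -⟩ | ⟨-, h⟩
        · simp only [Expr.eval, hM₁.static.reg1, ha] at hc
          have := a.2
          omega
        · exact h
      refine Spec.weaken (Spec.skip ⟨r19, ⟨hM₁, ρ, by rw [d₁]; exact hE, fun q hq => ?_⟩,
        .inr ?_⟩) ?_
      · rw [d₁] at hq
        exact (hP q hq).frame hn0 hF₁
      · rw [d₁, Set.ncard_le_one_iff]
        intro x y hx hy
        by_contra hxy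
        obtain ⟨a, ha, b, hb⟩ := hE.exists_leaf D.isTree hx hy hxy
        exact hno a ha ⟨b, hb⟩
      · have : 1 ≤ B ^ 4 := Nat.one_le_pow _ _ hB
        omega
    · have : 1 ≤ B ^ 4 := Nat.one_le_pow _ _ hB
      simp only [Expr.cost]
      omega
  · have : B ^ 2 ≤ B ^ 4 := Nat.pow_le_pow_right hB (by omega)
    omega

/-- Each of the `m` rounds either removes a node or ends with at most one remaining, and `ρ` always
takes alive values. So exactly one node survives; every node has been merged into it, and its part
contains every vertex because the bags cover the graph. -/
theorem contractTree_spec {s : State} {B : ℕ} (hs : Contracted G t D K s) (hn0 : 0 < n)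
    (hn : n ≤ B) (hm : m ≤ B) (hN : sigBound n K (D.width + 1) ≤ B) :
    Spec contractTree s (1320 * B ^ 5) fun s' => Static G t D K s' ∧ ∃ a : Fin m,
      a ∉ deadSet m s' ∧ (∀ q, q ∉ deadSet m s' → q = a) ∧
      NodePart G t K (sigBound n K (D.width + 1)) s' a Finset.univ := by
  have hB : 1 ≤ B := by omega
  refine Spec.weaken (Spec.post (Spec.countLoop (T := 1300 * B ^ 4) (k := m) (fun i s' =>
    s'.reg 19 = i ∧ Contracted G t D K s' ∧
      ((deadSet m s')ᶜ.ncard + i ≤ m ∨ (deadSet m s')ᶜ.ncard ≤ 1)) ?_ ?_ ?_) ?_) ?_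
  · have hF : Frame [19] [] s (s.setReg 19 0) := (Frame.refl _ _ _).setReg (by simp)
    obtain ⟨hM, ρ, hE, hP⟩ := hs
    refine ⟨by simp, ⟨hM.frame hF, ρ, hE, fun q hq => (hP q hq).frame hn0 hF⟩, .inl ?_⟩
    have := Set.ncard_le_ncard (Set.subset_univ (deadSet m (s.setReg 19 0))ᶜ) (Set.toFinite _)
    rw [Set.ncard_univ, Nat.card_fin] at this
    exact this
  · rintro i s' - ⟨h19, hC, -⟩
    exact ⟨h19, hC.1.static.reg1⟩
  · rintro i s' hi ⟨h19, hC, hcard⟩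
    refine (contractLeaf_spec hC hn0 hn hm hN).post ?_
    rintro s₂ ⟨r19, ⟨hM, ρ, hE, hP⟩, hcard'⟩
    have hF : Frame [19] [] s₂ (s₂.setReg 19 (s₂.reg 19 + 1)) :=
      (Frame.refl _ _ _).setReg (by simp)
    refine ⟨by simp [r19, h19], ⟨hM.frame hF, ρ, hE, fun q hq => (hP q hq).frame hn0 hF⟩, ?_⟩
    change (deadSet m s₂)ᶜ.ncard + (i + 1) ≤ m ∨ (deadSet m s₂)ᶜ.ncard ≤ 1
    omega
  · rintro s' ⟨-, ⟨hM, ρ, hE, hP⟩, hcard⟩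
    have hpos : 0 < (deadSet m s')ᶜ.ncard := by
      rw [Set.ncard_pos (Set.toFinite _)]
      exact ⟨_, hE.alive D.root⟩
    have h1 : (deadSet m s')ᶜ.ncard ≤ 1 := by omega
    rw [Set.ncard_le_one_iff] at h1
    refine ⟨hM.static, ρ D.root, hE.alive _, fun q hq => h1 hq (hE.alive _), ?_⟩
    have : partVerts D ρ (ρ D.root) = Finset.univ := by
      refine Finset.eq_univ_of_forall fun v => ?_
      obtain ⟨x, hx⟩ := D.cover_vertex v
      exact mem_partVerts.2 ⟨x, h1 (hE.alive _) (hE.alive _), hx⟩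
    rw [← this]
    exact hP _ (hE.alive _)
  · refine (loop_bound hB hm le_rfl).trans ?_
    simp only [Expr.cost]
    gcongr
    omega

/-! ### Selecting the best good row -/

/-- Copy the row at `11` to the output if it is a good set and better than the current output. -/
def selectRow : Prog :=
  seq (assign 16 (const 0)) (seq (sumLoop 13 16 (reg 0) (sub (const 1) (rowAt 11 13))
    (sub (get 1 (reg 13)) (cntAt 11 13))) (cond (reg 16) skip
    (cond (sub (reg 21) (get 12 (reg 11))) (seq (assign 21 (get 12 (reg 11)))
      (fillLoop 13 4 (reg 0) (const 0) (const 1) (rowAt 11 13) (const 0))) skip)))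

/-- Output the best row of the remaining parts. -/
def select : Prog :=
  seq (assign 21 (add (reg 0) (const 1))) (countLoop 19 (reg 1) (cond (get 13 (reg 19)) skip
    (forLoop 11 (get 7 (reg 19)) (get 8 (reg 19)) (reg 0) selectRow)))

theorem selectRow_spec {s : State} {B b : ℕ} (hs : Static G t D K s) (hn : n ≤ B) (hB : 1 ≤ B)
    (hb : s.reg 11 = b) (hok : RowOK G K s b) :
    Spec selectRow s (120 * B) fun s' => Frame [13, 16, 21] [4] s s' ∧ s'.reg 21 ≤ s.reg 21 ∧
      (KGood G t K (rowSet n s b) → s'.reg 21 ≤ (rowSet n s b).card) ∧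
      ((s'.reg 21 = s.reg 21 ∧ s'.arr 4 = s.arr 4) ∨ (KGood G t K (rowSet n s b) ∧
        s'.reg 21 = (rowSet n s b).card ∧ output n s' = rowSet n s b)) := by
  have hgood : (∑ v ∈ Finset.range n, if 1 - s.arr 10 (b + v) ≠ 0 then
      s.arr 1 v - s.arr 11 (b + v) else 0) = 0 ↔ KGood G t K (rowSet n s b) := by
    rw [sum_range_eq_zero_iff]
    refine forall_congr' fun v => ?_
    have := hok.bool v
    rw [hs.thr, hok.cnt, mem_rowSet]
    split_ifs <;> omega
  refine Spec.weaken (Spec.seq (Spec.assign (Spec.seq (Spec.sumLoop (k := n)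
    (fun v => if 1 - s.arr 10 (b + v) ≠ 0 then s.arr 1 v - s.arr 11 (b + v) else 0) (by decide)
    ?_ ?_ (Spec.cond (T := 50 * B) (fun hc => ?_) (fun hc => ?_)))))) ?_
  · intro i x
    simp [hs.reg0]
  · intro i x hi
    simp [hb]
  · have hbad : ¬ KGood G t K (rowSet n s b) := by
      rw [← hgood]
      simpa using hc
    refine Spec.weaken (Spec.skip ⟨(((Frame.refl _ _ _).setReg (by simp)).setReg (by simp)).setReg
      (by simp), by simp, fun h => absurd h hbad, .inl ⟨by simp, rfl⟩⟩) (by omega)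
  · have hgd : KGood G t K (rowSet n s b) := by
      rw [← hgood]
      simpa using hc
    have hsz := hok.size
    refine Spec.weaken (Spec.cond (T := 40 * B) (fun hd => ?_) (fun hd => ?_)) ?_
    · have hlt : (rowSet n s b).card < s.reg 21 := by
        simp [hb, hsz] at hd
        omega
      refine Spec.weaken (Spec.seq (Spec.assign (Spec.fillLoop (k := n) (b := 0)
        (fun v => s.arr 10 (b + v)) ?_ ?_ ?_ ⟨?_, ?_, ?_, .inr ⟨hgd, ?_, ?_⟩⟩))) ?_
      · intro i hi
        simp [hs.reg0]
      · intro i hi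
        simp
      · intro i hi
        simp [hb]
      · exact (((((Frame.refl _ _ _).setReg (by simp)).setReg (by simp)).setReg (by simp)).setReg
          (by simp)).fill (by simp) (by simp)
      · simp [hb, hsz, hlt.le]
      · intro _
        simp [hb, hsz]
      · simp [hb, hsz]
      · ext v
        simp [output]
      · simp only [Expr.cost]
        omega
    · have hle : s.reg 21 ≤ (rowSet n s b).card := by
        simp [hb, hsz] at hd
        omega
      refine Spec.weaken (Spec.skip ⟨(((Frame.refl _ _ _).setReg (by simp)).setReg (by simp)).setReg
        (by simp), by simp, fun _ => by simpa using hle, .inl ⟨by simp, rfl⟩⟩) (by omega)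
    · simp only [Expr.cost]
      omega
  · simp only [Expr.cost]
    omega

/-- Invariant of `select`: the sets in `P` have been treated. -/
structure SelectInv (G : SimpleGraph (Fin n)) (t : Fin n → ℕ) (K : ℕ) (s₀ : State)
    (P : Finset (Fin n) → Prop) (s : State) : Prop where
  frame : Frame [11, 13, 16, 19, 21] [4] s₀ s
  le : ∀ A, P A → KGood G t K A → s.reg 21 ≤ A.card
  out : s.reg 21 = n + 1 ∨ KGood G t K (output n s) ∧ (output n s).card = s.reg 21

theorem SelectInv.setReg {s₀ s : State} {P P' : Finset (Fin n) → Prop}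
    (h : SelectInv G t K s₀ P s) (hP : ∀ A, P' A → P A) {r x : ℕ} (hr : r = 11 ∨ r = 19) :
    SelectInv G t K s₀ P' (s.setReg r x) := by
  have h21 : (s.setReg r x).reg 21 = s.reg 21 := by
    rw [State.reg_setReg, if_neg (by omega)]
  exact ⟨h.frame.setReg (by rcases hr with rfl | rfl <;> simp),
    fun A hA hg => by rw [h21]; exact h.le A (hP A hA) hg, by rw [h21]; exact h.out⟩

theorem select_spec {s : State} {B : ℕ} (hs : Static G t D K s) (hn0 : 0 < n) (hn : n ≤ B)
    (hm : m ≤ B) (hN : sigBound n K (D.width + 1) ≤ B) {V : Fin m → Finset (Fin n)}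
    (hP : ∀ q : Fin m, q ∉ deadSet m s →
      NodePart G t K (sigBound n K (D.width + 1)) s q (V q)) :
    Spec select s (200 * B ^ 3) fun s' => ∀ q : Fin m, q ∉ deadSet m s → ∀ A ∈ family n s q,
      KGood G t K A → KGood G t K (output n s') ∧ (output n s').card ≤ A.card := by
  have hB : 1 ≤ B := by omega
  have key := loop_bound (B := B) (k := m) (T := 160 * B ^ 2) (c := 160) (j := 2) (d := 8) (e := 6)
    hB hm le_rfl
  refine Spec.weaken (Spec.seq (Spec.assign (Spec.post (Spec.countLoop (T := 160 * B ^ 2) (k := m)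
    (fun i s' => s'.reg 19 = i ∧ SelectInv G t K s
      (fun A => ∃ q : Fin m, (q : ℕ) < i ∧ q ∉ deadSet m s ∧ A ∈ family n s q) s')
      ?_ ?_ ?_) ?_))) ?_
  · refine ⟨by simp, ((Frame.refl _ _ _).setReg (by simp)).setReg (by simp), ?_, .inl ?_⟩
    · rintro A ⟨q, hq, -⟩
      omega
    · simp [hs.reg0]
  · rintro i s' - ⟨h19, h⟩
    exact ⟨h19, (hs.frame h.frame).reg1⟩
  · rintro i s' hi ⟨h19, h⟩
    let q : Fin m := ⟨i, hi⟩
    have e13 := h.frame.arr 13 (by decide)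
    refine Spec.weaken (Spec.cond (T := 150 * B ^ 2) (fun hc => ?_) (fun hc => ?_)) ?_
    · have hq : q ∈ deadSet m s := by
        simpa [mem_deadSet, q, h19, e13] using hc
      refine Spec.weaken (Spec.skip ⟨by simp [h19], h.setReg ?_ (by simp)⟩) ?_
      · rintro A ⟨q', h1, h2, h3⟩
        refine ⟨q', ?_, h2, h3⟩
        have : (q' : ℕ) ≠ i := fun h => h2 (by rwa [show q' = q from Fin.ext h])
        omega
      · have : 1 ≤ B ^ 2 := Nat.one_le_pow _ _ hB
        omega
    · have hq : q ∉ deadSet m s := by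
        simpa [mem_deadSet, q, h19, e13] using hc
      have hPq := hP q hq
      obtain ⟨k, hk, hblk⟩ := hPq.block
      have hlt : ∀ {j : ℕ}, s.arr 7 q + n * j < s.arr 8 q ↔ j < k := by
        intro j
        rw [hblk, Nat.add_lt_add_iff_left, Nat.mul_lt_mul_left hn0]
      refine Spec.weaken (Spec.post (Spec.forLoop (T := 120 * B ^ 1) (l := s.arr 7 q) (d := n)
        (k := k) (fun j s' => s'.reg 11 = s.arr 7 q + n * j ∧ s'.reg 19 = i ∧ SelectInv G t K s
          (fun A => (∃ q : Fin m, (q : ℕ) < i ∧ q ∉ deadSet m s ∧ A ∈ family n s q) ∨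
            ∃ i' < j, A = rowSet n s (s.arr 7 q + n * i')) s') hn0 ?_ ?_ ?_) ?_) ?_
      · refine ⟨?_, by simp [h19], h.setReg (by simp) (by simp)⟩
        simp [h19, h.frame.arr 7, q]
      · rintro j s₂ - ⟨h11, h19, h⟩
        refine ⟨h11, ?_⟩
        rw [← hblk]
        simp [h19, h.frame.arr 8, q]
      · rintro j s₂ hj ⟨h11, h19, h⟩
        have hF' := h.frame
        have hb : ∀ X, Below X s s₂ := fun X => below_of_arr_eq (hF'.arr _ (by decide))
          (hF'.arr _ (by decide)) (hF'.arr _ (by decide))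
        have hrow : ∀ b, rowSet n s₂ b = rowSet n s b := fun b => (hb (b + n)).rowSet_eq le_rfl
        refine Spec.weaken (Spec.post (selectRow_spec (hs.frame h.frame) hn hB h11
          ((hb _).rowOK hn0 le_rfl (hPq.ok j (hlt.2 hj)))) ?_) (by rw [pow_one])
        rintro s₃ ⟨hF, hle, hbest, hcase⟩
        rw [hrow] at hbest hcase
        refine ⟨?_, ?_, SelectInv.setReg (P := fun A => (∃ q : Fin m, (q : ℕ) < i ∧
          q ∉ deadSet m s ∧ A ∈ family n s q) ∨ ∃ i' < j + 1, A = rowSet n s (s.arr 7 q + n * i'))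
          ⟨h.frame.trans (hF.mono (by decide) (by decide)), ?_, ?_⟩ (fun _ => id) (by simp)⟩
        · simp [hF.reg 11, hF.reg 0, h11, hF'.reg 0, hs.reg0]
          ring
        · simp [hF.reg 19, h19]
        · rintro A hA hg
          rcases hA with hA | ⟨i', hi', rfl⟩
          · exact hle.trans (h.le A (.inl hA) hg)
          · rcases Nat.lt_succ_iff_lt_or_eq.1 hi' with hi' | rfl
            · exact hle.trans (h.le _ (.inr ⟨i', hi', rfl⟩) hg)
            · exact hbest hg
        · rcases hcase with ⟨h1, h2⟩ | ⟨h1, h2, h3⟩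
          · have : output n s₃ = output n s₂ := by rw [output, h2, output]
            rw [h1, this]
            exact h.out
          · right
            rw [h3, h2]
            exact ⟨h1, rfl⟩
      · rintro s₂ ⟨-, h19, h⟩
        refine ⟨by simp [h19], h.setReg ?_ (by simp)⟩
        rintro A ⟨q', h1, h2, h3⟩
        rcases Nat.lt_succ_iff_lt_or_eq.1 h1 with h1 | h1
        · exact .inl ⟨q', h1, h2, h3⟩
        · obtain rfl : q' = q := Fin.ext h1
          obtain ⟨j, hj, rfl⟩ := h3
          exact .inr ⟨j, hlt.1 hj, rfl⟩
      · refine (loop_bound hB (hk.trans hN) le_rfl).trans ?_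
        simp only [Expr.cost]
        gcongr
        omega
    · have : 1 ≤ B ^ 2 := Nat.one_le_pow _ _ hB
      simp only [Expr.cost]
      omega
  · rintro s' ⟨-, h⟩ q hq A hA hg
    have h1 := h.le A ⟨q, q.2, hq, hA⟩ hg
    have h2 := Finset.card_le_univ A
    rw [Fintype.card_fin] at h2
    -- The initial value `n + 1` of register `21` stands for infinity: it exceeds the cardinality of
    -- every vertex set, so it cannot persist once a good row has been seen.
    rcases h.out with h3 | ⟨h3, h4⟩
    · omega
    · exact ⟨h3, h4 ▸ h1⟩
  · have : 1 ≤ B ^ 3 := Nat.one_le_pow _ _ hB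
    simp only [Expr.cost, Nat.reduceAdd] at key ⊢
    omega

/-! ### Preprocessing, and the whole program -/

/-- Write the multiples `0, x, …, (n + m) x` of the contents `x` of register `r` to array `a`. -/
def multiples (a r : ℕ) : Prog :=
  fillLoop 13 a (add (add (reg 0) (reg 1)) (const 1)) (const 0) (reg 13)
    (add (get a (sub (reg 13) (const 1))) (reg r)) (const 0)

/-- Write the maximal size of a bag to register `4`. -/
def maxBag : Prog :=
  countLoop 13 (reg 1) (seq (assign 15 (const 0)) (seq
    (sumLoop 14 15 (reg 0) (bagAt 13 14) (const 1))
    (assign 4 (add (reg 4) (sub (reg 15) (reg 4))))))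

/-- Write the logarithm of `n` to the base `2`, rounded up, to register `5`. -/
def logN : Prog :=
  seq (assign 6 (const 1)) (countLoop 13 (reg 0) (cond (sub (reg 0) (reg 6))
    (seq (assign 6 (add (reg 6) (reg 6))) (assign 5 (add (reg 5) (const 1)))) skip))

/-- Compute the cap on the neighbour counts. -/
def computeCap : Prog :=
  seq (sumLoop 14 12 (reg 4) (const 1) (reg 5)) (sumLoop 14 3 (reg 4) (const 1) (reg 12))

/-- Set up the families of the parts. -/
def initParts : Prog :=
  seq (fillLoop 13 8 (add (reg 1) (const 1)) (const 0) (sub (reg 1) (reg 13)) (reg 0)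
    (add (reg 0) (reg 0))) (seq
  (fillLoop 13 10 (reg 0) (reg 0) (const 1) (const 1) (const 0))
  (assign 7 (add (reg 0) (reg 0))))

/-- Preprocessing. -/
def prepare : Prog :=
  seq (multiples 5 0) (seq (multiples 6 1) (seq maxBag (seq logN (seq computeCap initParts))))

/-- The approximation algorithm for vector dominating set. -/
def vdsProg : Prog := seq prepare (seq enterBags (seq contractTree select))

theorem multiples_spec {s : State} {a r x B : ℕ} (h0 : s.reg 0 = n) (h1 : s.reg 1 = m)
    (hr : s.reg r = x) (hr13 : r ≠ 13) (hB : n + m + 1 ≤ B) :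
    Spec (multiples a r) s (40 * B) fun s' => s' = s.fill 13 a 0 (n + m + 1) (fun i => i * x) := by
  refine Spec.weaken (Spec.fillLoop (b := 0) (k := n + m + 1) (fun i => i * x) ?_ ?_ ?_ rfl) ?_
  · intro i hi
    simp [h0, h1]
  · intro i hi
    simp
  · intro i hi
    rcases i with _ | i
    · simp
    · simp [hr, hr13]
      ring
  · simp only [Expr.cost]
    omega

theorem maxBag_spec {s : State} {B : ℕ} (h0 : s.reg 0 = n) (h1 : s.reg 1 = m) (h4 : s.reg 4 = 0)
    (hmul : ∀ p, p ≤ n + m → s.arr 5 p = p * n)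
    (hbag : ∀ (x : Fin m) (v : Fin n), s.arr 3 (x * n + v) = if v ∈ D.bag x then 1 else 0)
    (hn : n ≤ B) (hm : m ≤ B) (hB : 1 ≤ B) (hw : 1 ≤ D.width) :
    Spec maxBag s (80 * B ^ 2) fun s' => Frame [4, 13, 14, 15] [] s s' ∧
      s'.reg 4 = D.width + 1 := by
  let f : ℕ → ℕ := fun i => if h : i < m then (D.bag ⟨i, h⟩).card else 0
  refine Spec.weaken (Spec.post (Spec.countLoop (T := 50 * B ^ 1) (k := m) (fun i s' =>
    s'.reg 13 = i ∧ Frame [4, 13, 14, 15] [] s s' ∧ s'.reg 4 = (Finset.range i).sup f)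
    ?_ ?_ ?_) ?_) ?_
  · exact ⟨by simp, (Frame.refl _ _ _).setReg (by simp), by simp [h4]⟩
  · rintro i s' - ⟨h13, hF, -⟩
    exact ⟨h13, by simp [hF.reg 1, h1]⟩
  · rintro i s' hi ⟨h13, hF, h4⟩
    have harr : s'.arr = s.arr := funext fun a => hF.arr a (by simp)
    have r0 : s'.reg 0 = n := by rw [hF.reg 0 (by decide), h0]
    refine Spec.weaken (Spec.seq (Spec.assign (Spec.seq (Spec.sumLoop (k := n)
      (fun v => if s.arr 3 (i * n + v) ≠ 0 then 1 else 0) (by decide) ?_ ?_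
      (Spec.assign ⟨?_, ?_, ?_⟩))))) ?_
    · intro j x
      simp [r0]
    · intro j x hj
      simp [harr, h13, hmul i (by omega)]
    · simp [h13]
    · exact ((((hF.setReg (by simp)).setReg (by simp)).setReg (by simp)).setReg (by simp)).setReg
        (by simp)
    · have hsum : (∑ v ∈ Finset.range n, if s.arr 3 (i * n + v) ≠ 0 then 1 else 0) = f i := by
        rw [Finset.sum_range (fun v => if s.arr 3 (i * n + v) ≠ 0 then 1 else 0)]
        have hb := hbag ⟨i, hi⟩
        simp only at hb
        simp only [hb, f, hi, dif_pos]
        simp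
      rw [Finset.range_add_one, Finset.sup_insert]
      simp only [Expr.eval, State.reg_setReg]
      norm_num at hsum ⊢
      rw [hsum, h4]
      omega
    · simp only [Expr.cost, pow_one]
      omega
  · rintro s' ⟨-, hF, h4⟩
    refine ⟨hF, ?_⟩
    have : (Finset.range m).sup f = Finset.univ.sup (fun α : Fin m => (D.bag α).card) := by
      apply le_antisymm
      · refine Finset.sup_le fun i hi => ?_
        have hi := Finset.mem_range.1 hi
        simp only [f, hi, dif_pos]
        exact Finset.le_sup (f := fun α : Fin m => (D.bag α).card) 
          (Finset.mem_univ (⟨i, hi⟩ : Fin m))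
      · refine Finset.sup_le fun α _ => ?_
        have := Finset.le_sup (f := f) (Finset.mem_range.2 α.2)
        simpa [f] using this
    rw [h4, this]
    -- Positive width excludes the truncated case, in which the maximal bag size is not width plus
    -- one.
    unfold TreeDecomposition.width at hw ⊢
    omega
  · refine (loop_bound hB hm le_rfl).trans ?_
    simp only [Expr.cost]
    gcongr
    omega

theorem logN_spec {s : State} {B : ℕ} (h0 : s.reg 0 = n) (h5 : s.reg 5 = 0) (hn : n ≤ B)
    (hB : 1 ≤ B) :
    Spec logN s (50 * B) fun s' => Frame [5, 6, 13] [] s s' ∧ s'.reg 5 = Nat.clog 2 n := by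
  refine Spec.weaken (Spec.seq (Spec.assign (Spec.post (Spec.countLoop (T := 20) (k := n)
    (fun i s' => s'.reg 13 = i ∧ Frame [5, 6, 13] [] s s' ∧ s'.reg 6 = 2 ^ s'.reg 5 ∧
      s'.reg 5 = min i (Nat.clog 2 n)) ?_ ?_ ?_) ?_))) ?_
  · exact ⟨by simp, ((Frame.refl _ _ _).setReg (by simp)).setReg (by simp), by simp [h5],
      by simp [h5]⟩
  · rintro i s' - ⟨h13, hF, -⟩
    exact ⟨h13, by simp [hF.reg 0, h0]⟩
  · rintro i s' hi ⟨h13, hF, h6, h5⟩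
    have r0 : s'.reg 0 = n := by rw [hF.reg 0 (by decide), h0]
    refine Spec.weaken (Spec.cond (T := 8) (fun hc => ?_) (fun hc => ?_)) (by simp [Expr.cost])
    · have hlt : s'.reg 5 < Nat.clog 2 n := by
        rw [Nat.lt_clog_iff_pow_lt one_lt_two]
        simp only [Expr.eval, r0, h6] at hc
        omega
      refine Spec.weaken (Spec.seq (Spec.assign (Spec.assign ⟨by simp [h13],
        ((hF.setReg (by simp)).setReg (by simp)).setReg (by simp), ?_, ?_⟩))) (by simp [Expr.cost])
      · simp [h6]
        ring
      · simp
        omega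
    · have hle : Nat.clog 2 n ≤ s'.reg 5 := by
        rw [Nat.clog_le_iff_le_pow one_lt_two]
        simp only [Expr.eval, r0, h6] at hc
        omega
      refine Spec.weaken (Spec.skip ⟨by simp [h13], hF.setReg (by simp), by simp [h6], ?_⟩)
        (by omega)
      simp
      omega
  · rintro s' ⟨-, hF, -, h⟩
    refine ⟨hF, ?_⟩
    -- The loop runs `n` rounds, which is enough for the doubling to reach `n`.
    have : Nat.clog 2 n ≤ n := by
      rw [Nat.clog_le_iff_le_pow one_lt_two]
      exact Nat.lt_two_pow_self.le
    omega
  · simp only [Expr.cost]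
    omega

/-- Repeated addition replaces the two multiplications; the number of rounds `W` is at most `B`. -/
theorem computeCap_spec {s : State} {B W L : ℕ} (h4 : s.reg 4 = W) (h5 : s.reg 5 = L)
    (h12 : s.reg 12 = 0) (h3 : s.reg 3 = 0) (hW : W ≤ B) (hB : 1 ≤ B) :
    Spec computeCap s (60 * B) fun s' => Frame [3, 12, 14] [] s s' ∧ s'.reg 3 = W * (W * L) := by
  refine Spec.weaken (Spec.seq (Spec.sumLoop (k := W) (fun _ => L) (by decide) ?_ ?_
    (Spec.sumLoop (k := W) (fun _ => W * L) (by decide) ?_ ?_ ⟨?_, ?_⟩))) ?_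
  · intro i x
    simp [h4]
  · intro i x hi
    simp [h5]
  · intro i x
    simp [h4]
  · intro i x hi
    simp [h12]
  · exact ((((Frame.refl _ _ _).setReg (by simp)).setReg (by simp)).setReg (by simp)).setReg
      (by simp)
  · simp [h3]
  · simp only [Expr.cost]
    omega

theorem initParts_spec {s : State} {B : ℕ} (hs : Static G t D K s) (hn0 : 0 < n)
    (hB : n + m + 1 ≤ B) (hzero : ∀ a, 7 ≤ a → ∀ i, s.arr a i = 0) :
    Spec initParts s (60 * B) fun s' => Mem G t D K s' ∧ maskSet n s' m = ∅ ∧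
      deadSet m s' = ∅ ∧ ∀ q : Fin m, NodePart G t K (sigBound n K (D.width + 1)) s' q ∅ := by
  refine Spec.weaken (Spec.seq (Spec.fillLoop (b := 0) (k := m + 1)
    -- All address ranges begin at `0`. A genuine part `i < m` starts with the single row `∅`, the
    -- auxiliary part `m` with the two rows `∅` and `Finset.univ`.
    (fun i => if m - i ≠ 0 then n else n + n) ?_ ?_ ?_ (Spec.seq (Spec.fillLoop (b := n) (k := n)
    (fun _ => 1) ?_ ?_ ?_ (Spec.assign ?_))))) ?_
  · intro i hi
    simp [hs.reg1]
  · intro i hi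
    simp
  · intro i hi
    simp [hs.reg1, hs.reg0]
  · intro i hi
    simp [hs.reg0]
  · intro i hi
    simp [hs.reg0]
  · intro i hi
    simp
  · generalize hs' : State.setReg _ 7 _ = s'
    have hF : Frame [7, 13] [8, 10] s s' := by
      rw [← hs']
      exact (((Frame.refl _ _ _).fill (by simp) (by simp)).fill (by simp) (by simp)).setReg (by simp)
    have r7 : s'.reg 7 = n + n := by
      rw [← hs']
      simp [hs.reg0]
    have e8 : ∀ i, i ≤ m → s'.arr 8 i = if m - i ≠ 0 then n else n + n := by
      intro i hi
      have : i < m + 1 := by omega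
      rw [← hs']
      simp [this]
    have e10 : ∀ i, s'.arr 10 i = if n ≤ i ∧ i < n + n then 1 else 0 := by
      intro i
      rw [← hs']
      simp [hzero]
    have e7 : ∀ i, s'.arr 7 i = 0 := fun i => by rw [hF.arr 7 (by decide), hzero 7 (by omega)]
    have e9 : ∀ i, s'.arr 9 i = 0 := fun i => by rw [hF.arr 9 (by decide), hzero 9 (by omega)]
    have e11 : ∀ i, s'.arr 11 i = 0 := fun i => by rw [hF.arr 11 (by decide), hzero 11 (by omega)]
    have e12 : ∀ i, s'.arr 12 i = 0 := fun i => by rw [hF.arr 12 (by decide), hzero 12 (by omega)]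
    have e13 : ∀ i, s'.arr 13 i = 0 := fun i => by rw [hF.arr 13 (by decide), hzero 13 (by omega)]
    have bool : ∀ b, IsBool n s' b := fun b v => by
      rw [e10]
      split_ifs <;> omega
    have row0 : rowSet n s' 0 = ∅ := by
      ext v
      simp [e10]
    have mask : ∀ q, maskSet n s' q = ∅ := fun q => by
      ext v
      simp [e9]
    refine ⟨⟨hs.frame hF, fun q _ v => by rw [e9]; omega, e7 m, by rw [e8 m le_rfl]; simp, r7.ge,
      bool 0, row0, bool n, ?_⟩, mask m, ?_, fun q => ?_⟩
    · ext v
      simp [e10]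
    · ext x
      rw [mem_deadSet, e13]
      simp
    · have h8 : s'.arr 8 q = n := by
        rw [e8 q q.2.le, if_pos]
        have := q.2
        omega
      have hi : ∀ i, s'.arr 7 q + n * i < s'.arr 8 q → i = 0 := by
        intro i hi
        rw [e7, h8] at hi
        have : n * i < n * 1 := by omega
        have := lt_of_mul_lt_mul_left this (Nat.zero_le n)
        omega
      refine ⟨⟨⟨1, (two_le_sigBound _ _ _ hn0).trans' (by omega), by rw [e7, h8]; omega⟩,
        by rw [h8, r7]; omega, fun _ _ => bool _, mask q,
        represents_empty ⟨_, 0, by rw [e7, h8]; omega, rfl⟩⟩, fun i hi' => ?_, ?_⟩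
      · obtain rfl := hi i hi'
        rw [e7]
        -- Counts and cardinality of the row `∅` are zero, so the untouched memory already holds the
        -- right values.
        refine ⟨bool _, fun v => ?_, ?_⟩
        · rw [e11, mul_zero, add_zero, row0]
          simp [cnt]
        · rw [e12, mul_zero, add_zero, row0]
          rfl
      · rintro _ ⟨i, hi', rfl⟩
        obtain rfl := hi i hi'
        rw [e7, mul_zero, add_zero, row0]
  · simp only [Expr.cost]
    omega

open Classical in
theorem input_entry {k l : ℕ} (P : Fin k → Fin l → Prop) (x : Fin k) (y : Fin l) :
    (if ∃ (u : Fin k) (v : Fin l), (x : ℕ) * l + y = u * l + v ∧ P u v then 1 else 0) =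
      if P x y then 1 else 0 := by
  refine if_congr ⟨?_, fun h => ⟨x, y, rfl, h⟩⟩ rfl rfl
  rintro ⟨u, v, h, hP⟩
  obtain ⟨h1, h2⟩ := mul_add_inj y.2 v.2 h
  rw [Fin.ext h1, Fin.ext h2]
  exact hP

theorem prepare_spec {B : ℕ} (hn0 : 0 < n) (hB : n + m + 1 ≤ B) (hw : 1 ≤ D.width)
    (hK : K = (D.width + 1) * ((D.width + 1) * Nat.clog 2 n)) :
    Spec prepare (input G t D) (400 * B ^ 2) fun s' => Mem G t D K s' ∧ maskSet n s' m = ∅ ∧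
      deadSet m s' = ∅ ∧ ∀ q : Fin m, NodePart G t K (sigBound n K (D.width + 1)) s' q ∅ := by
  have hW : D.width + 1 ≤ B := by
    have : D.width ≤ n := by
      unfold TreeDecomposition.width
      refine (Nat.sub_le _ _).trans (Finset.sup_le fun α _ => ?_)
      exact (Finset.card_le_univ _).trans_eq (Fintype.card_fin n)
    omega
  generalize hs : input G t D = s
  have r0 : s.reg 0 = n := by rw [← hs]; rfl
  have r1 : s.reg 1 = m := by rw [← hs]; rfl
  have r3 : s.reg 3 = 0 := by rw [← hs]; rfl
  have r4 : s.reg 4 = 0 := by rw [← hs]; rfl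
  have r5 : s.reg 5 = 0 := by rw [← hs]; rfl
  have r12 : s.reg 12 = 0 := by rw [← hs]; rfl
  have hzero : ∀ a, 7 ≤ a → ∀ i, s.arr a i = 0 := by
    intro a ha i
    rw [← hs]
    obtain ⟨b, rfl⟩ := Nat.exists_eq_add_of_le' ha
    rfl
  refine Spec.weaken (Spec.seq_of (multiples_spec r0 r1 r0 (by decide) hB) ?_
    (T₂ := 40 * B + (80 * B ^ 2 + (50 * B + (60 * B + 60 * B))))) ?_
  · rintro s₁ rfl
    refine Spec.seq_of (multiples_spec (n := n) (m := m) (x := m) (by simp [r0]) (by simp [r1])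
      (by simp [r1]) (by decide) hB) ?_
    intro s₂ hs₂
    have F2 : Frame [13] [5, 6] s s₂ := by
      rw [hs₂]
      exact ((Frame.refl _ _ _).fill (by simp) (by simp)).fill (by simp) (by simp)
    have m5 : ∀ p, p ≤ n + m → s₂.arr 5 p = p * n := fun p hp => by
      have : p < n + m + 1 := by omega
      rw [hs₂]
      simp [this]
    have m6 : ∀ p, p ≤ n + m → s₂.arr 6 p = p * m := fun p hp => by
      have : p < n + m + 1 := by omega
      rw [hs₂]
      simp [this]
    have hbag : ∀ (x : Fin m) (v : Fin n),
        s₂.arr 3 (x * n + v) = if v ∈ D.bag x then 1 else 0 := by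
      classical
      intro x v
      rw [F2.arr 3 (by decide), ← hs]
      convert input_entry (fun (x : Fin m) (v : Fin n) => v ∈ D.bag x) x v using 1
      · simp only [input]
        congr
      · congr
    refine Spec.seq_of (maxBag_spec (D := D) (by rw [F2.reg 0 (by decide), r0])
      (by rw [F2.reg 1 (by decide), r1]) (by rw [F2.reg 4 (by decide), r4]) m5 hbag (by omega)
      (by omega) (by omega) hw) ?_
    rintro s₃ ⟨F3, h4⟩
    refine Spec.seq_of (logN_spec (n := n)
      (by rw [F3.reg 0 (by decide), F2.reg 0 (by decide), r0])
      (by rw [F3.reg 5 (by decide), F2.reg 5 (by decide), r5]) (by omega) (by omega)) ?_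
    rintro s₄ ⟨F4, h5⟩
    refine Spec.seq_of (computeCap_spec (B := B) (by rw [F4.reg 4 (by decide), h4]) h5
      (by rw [F4.reg 12 (by decide), F3.reg 12 (by decide), F2.reg 12 (by decide), r12])
      (by rw [F4.reg 3 (by decide), F3.reg 3 (by decide), F2.reg 3 (by decide), r3]) hW
      (by omega)) ?_
    rintro s₅ ⟨F5, h3⟩
    have F25 : Frame [3, 4, 5, 6, 12, 13, 14, 15] [] s₂ s₅ :=
      ((F3.mono (by decide) (by decide)).trans (F4.mono (by decide) (by decide))).trans
        (F5.mono (by decide) (by decide))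
    refine initParts_spec (K := K) ⟨?_, ?_, ?_, ?_, ?_, ?_, ?_, ?_, ?_⟩ hn0 hB ?_
    · rw [F25.reg 0 (by decide), F2.reg 0 (by decide), r0]
    · rw [F25.reg 1 (by decide), F2.reg 1 (by decide), r1]
    · rw [h3, hK]
    · intro u v
      rw [F25.arr 0 (by decide), F2.arr 0 (by decide), ← hs]
      exact input_entry (fun u v => G.Adj u v) u v
    · intro v
      rw [F25.arr 1 (by decide), F2.arr 1 (by decide), ← hs]
      simp [input]
    · intro u v
      rw [F25.arr 2 (by decide), F2.arr 2 (by decide), ← hs]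
      exact input_entry (fun u v => D.tree.Adj u v) u v
    · rw [F25.arr 3 (by decide)]
      intro x v
      rw [hbag]
    · rw [F25.arr 5 (by decide)]
      exact m5
    · rw [F25.arr 6 (by decide)]
      exact m6
    · intro a ha i
      rw [F25.arr a (by simp), F2.arr a (by simp; omega)]
      exact hzero a ha i
  · have : B ≤ B ^ 2 := Nat.le_self_pow (by omega) B
    omega

/-- The surviving part has all vertices as its vertex set, and there representation means that each
good set has the same size as some good member of the family. The power six comes from entering the
bags: at most B² vertex-node pairs, each with an `absorb` of cost O(B⁴). -/
theorem vdsProg_spec {B : ℕ} (hn0 : 0 < n) (hw : 1 ≤ D.width)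
    (hK : K = (D.width + 1) * ((D.width + 1) * Nat.clog 2 n))
    (hB : n + m + 1 + sigBound n K (D.width + 1) ≤ B) :
    Spec vdsProg (input G t D) (4000 * B ^ 6) fun s' => ∀ S, KGood G t K S →
      KGood G t K (output n s') ∧ (output n s').card ≤ S.card := by
  have hB1 : 1 ≤ B := by omega
  refine Spec.weaken (Spec.seq_of (prepare_spec (B := B) hn0 (by omega) hw hK) ?_
    (T₂ := 1200 * B ^ 6 + (1320 * B ^ 5 + 200 * B ^ 3))) ?_
  · rintro s₁ ⟨hM, haux, hd, hP⟩
    refine Spec.seq_of (enterBags_spec hM hn0 (by omega) (by omega) (by omega) haux hP) ?_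
    rintro s₂ ⟨h13, hM₂, hP₂⟩
    have hd₂ : deadSet m s₂ = ∅ := by rw [deadSet, h13, ← hd, deadSet]
    refine Spec.seq_of (contractTree_spec (B := B) ⟨hM₂, id, ?_, fun q _ => ?_⟩ hn0 (by omega)
      (by omega) (by omega)) ?_
    · rw [hd₂]
      exact .start _
    · have : partVerts D id q = D.bag q := by
        ext v
        simp [mem_partVerts]
      rw [this]
      exact hP₂ q
    · rintro s₃ ⟨hS₃, a, ha, hqa, hPa⟩
      refine (select_spec (V := fun _ => Finset.univ) hS₃ hn0 (by omega) (by omega) (by omega)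
        (fun q hq => by rw [hqa q hq]; exact hPa)).post ?_
      intro s' h S hS
      obtain ⟨A, hA, hg, hc⟩ := hPa.rep S hS
      have : S \ Finset.univ ∪ A ∩ Finset.univ = A := by simp
      rw [this] at hg hc
      rw [← hc]
      exact h a ha A hA hg
  · have h2 : B ^ 2 ≤ B ^ 6 := Nat.pow_le_pow_right hB1 (by omega)
    have h3 : B ^ 3 ≤ B ^ 6 := Nat.pow_le_pow_right hB1 (by omega)
    have h5 : B ^ 5 ≤ B ^ 6 := Nat.pow_le_pow_right hB1 (by omega)
    omega

end VDS

/-! ### Numerical estimates and the theorem -/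

namespace VDS

theorem logb_le_clog {n : ℕ} (hn : 3 ≤ n) : Real.logb 2 n ≤ Nat.clog 2 n := by
  have hn' : (0 : ℝ) < n := by positivity
  rw [Real.logb_le_iff_le_rpow one_lt_two hn', Real.rpow_natCast]
  exact_mod_cast Nat.le_pow_clog one_lt_two n

/-- This is √8 ≤ 3. Together with √2 ≤ 3/2 it keeps log log n at least 1/2 for n ≥ 3, which allows
constants to be absorbed into the exponent. -/
theorem three_halves_le_logb {n : ℕ} (hn : 3 ≤ n) : 3 / 2 ≤ Real.logb 2 n := by
  have hn' : (3 : ℝ) ≤ n := by exact_mod_cast hn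
  rw [Real.le_logb_iff_rpow_le one_lt_two (by linarith)]
  refine le_trans ?_ hn'
  rw [show (3 / 2 : ℝ) = 3 * (1 / 2) by norm_num, Real.rpow_mul two_pos.le, ← Real.sqrt_eq_rpow]
  rw [Real.sqrt_le_left (by norm_num)]
  norm_num

theorem half_le_logb_logb {n : ℕ} (hn : 3 ≤ n) : 1 / 2 ≤ Real.logb 2 (Real.logb 2 n) := by
  have h := three_halves_le_logb hn
  rw [Real.le_logb_iff_rpow_le one_lt_two (by linarith)]
  refine le_trans ?_ h
  rw [← Real.sqrt_eq_rpow, Real.sqrt_le_left (by norm_num)]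
  norm_num

theorem logb_logb_le_clog {n : ℕ} (hn : 3 ≤ n) :
    Real.logb 2 (Real.logb 2 n) ≤ Nat.clog 2 n := by
  have h := three_halves_le_logb hn
  rw [Real.logb_le_iff_le_rpow one_lt_two (by linarith), Real.rpow_natCast]
  refine (logb_le_clog hn).trans ?_
  exact_mod_cast Nat.lt_two_pow_self.le

theorem clog_le_two_mul_logb {n : ℕ} (hn : 3 ≤ n) : (Nat.clog 2 n : ℝ) ≤ 2 * Real.logb 2 n := by
  have h := three_halves_le_logb hn
  have h1 : ((Nat.clog 2 n - 1 : ℕ) : ℝ) ≤ Real.logb 2 n := by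
    rw [Real.le_logb_iff_rpow_le one_lt_two (by positivity), Real.rpow_natCast]
    exact_mod_cast (Nat.pow_pred_clog_lt_self one_lt_two (by omega)).le
  have h2 : (Nat.clog 2 n : ℝ) ≤ ((Nat.clog 2 n - 1 : ℕ) : ℝ) + 1 := by
    exact_mod_cast (by omega : Nat.clog 2 n ≤ Nat.clog 2 n - 1 + 1)
  linarith

/-- The number of signatures on a bag of `w + 1` vertices is small enough. -/
theorem signatures_le {n m w : ℕ} (hn : 3 ≤ n) (hw : 1 ≤ w) :
    (((2 * ((w + 1) * ((w + 1) * Nat.clog 2 n) + 1)) ^ (w + 1) : ℕ) : ℝ) ^ 6 ≤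
      (2 : ℝ) ^ (180 * ((w : ℝ) ^ 5 * Real.logb 2 w * Real.logb 2 (Real.logb 2 n))) *
        ((n : ℝ) + m) ^ 60 := by
  have hl := three_halves_le_logb hn
  have hll := half_le_logb_logb hn
  have hL := clog_le_two_mul_logb hn
  have hL1 : (1 : ℝ) ≤ Nat.clog 2 n := by linarith [logb_le_clog hn]
  have hw' : (1 : ℝ) ≤ w := by exact_mod_cast hw
  have hn' : (3 : ℝ) ≤ n := by exact_mod_cast hn
  have hm' : (0 : ℝ) ≤ m := by positivity
  set l := Real.logb 2 n with hl_def
  set L : ℝ := ((Nat.clog 2 n : ℕ) : ℝ)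
  -- As (w+1)²L ≥ 1, the left side is at most 4(w+1)²L, and L ≤ 2l.
  have hbase : (2 * (((w : ℝ) + 1) * ((w + 1) * L) + 1)) ≤ 8 * (w + 1) ^ 2 * l := by
    have h1 : 1 ≤ ((w : ℝ) + 1) ^ 2 * L := by nlinarith
    have h2 : ((w : ℝ) + 1) ^ 2 * L ≤ (w + 1) ^ 2 * (2 * l) := by gcongr
    nlinarith
  have hbase0 : 0 ≤ (2 * (((w : ℝ) + 1) * ((w + 1) * L) + 1)) := by positivity
  push_cast
  rcases Nat.lt_or_ge 1 w with hw2 | hw2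
  · have hw2' : (2 : ℝ) ≤ w := by exact_mod_cast hw2
    have hlw : 1 ≤ Real.logb 2 w := by
      rw [Real.le_logb_iff_rpow_le one_lt_two (by linarith), Real.rpow_one]
      exact hw2'
    have hlw1 : Real.logb 2 (w + 1) ≤ 2 * Real.logb 2 w := by
      have : (2 : ℝ) * Real.logb 2 w = Real.logb 2 ((w : ℝ) ^ 2) := by
        rw [Real.logb_pow]
        norm_num
      rw [this]
      refine Real.logb_le_logb_of_le one_lt_two (by linarith) ?_
      nlinarith
    set x := Real.logb 2 w
    set y := Real.logb 2 l
    -- The exponent is 3 + 2 log(w+1) + y ≤ 3 + 4x + y. As x ≥ 1 and y ≥ 1/2, the three terms are at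
    -- most 6xy, 8xy and xy, which add up to 15xy.
    have hexp : 8 * ((w : ℝ) + 1) ^ 2 * l ≤ (2 : ℝ) ^ (15 * (x * y)) := by
      have e1 : (2 : ℝ) ^ (3 : ℝ) = 8 := by norm_num
      have e2 : (2 : ℝ) ^ (Real.logb 2 (w + 1) * 2) = (w + 1) ^ 2 := by
        rw [Real.rpow_mul two_pos.le, Real.rpow_logb two_pos (by norm_num) (by linarith)]
        norm_num
      have e3 : (2 : ℝ) ^ y = l := Real.rpow_logb two_pos (by norm_num) (by linarith)
      rw [← e1, ← e2]
      nth_rewrite 1 [← e3]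
      rw [← Real.rpow_add two_pos, ← Real.rpow_add two_pos]
      refine Real.rpow_le_rpow_of_exponent_le one_lt_two.le ?_
      nlinarith
    have h1 : (((2 * (((w : ℝ) + 1) * ((w + 1) * L) + 1)) ^ (w + 1)) ^ 6) ≤
        (2 : ℝ) ^ (180 * ((w : ℝ) ^ 5 * x * y)) := by
      calc (((2 * (((w : ℝ) + 1) * ((w + 1) * L) + 1)) ^ (w + 1)) ^ 6)
          ≤ (((2 : ℝ) ^ (15 * (x * y))) ^ (w + 1)) ^ 6 := by
            gcongr
            exact hbase.trans hexp
        _ = (2 : ℝ) ^ (15 * (x * y) * (((w + 1 : ℕ) : ℝ) * ((6 : ℕ) : ℝ))) := by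
            rw [← pow_mul, ← Nat.cast_mul, Real.rpow_mul two_pos.le (15 * (x * y)), Real.rpow_natCast]
        _ ≤ _ := by
            refine Real.rpow_le_rpow_of_exponent_le one_lt_two.le ?_
            push_cast
            -- The constant 180 arises from 15 · 6 · (w+1) ≤ 180w ≤ 180w⁵.
            have hxy : 0 ≤ x * y := by nlinarith
            have h5 : (w : ℝ) ≤ (w : ℝ) ^ 5 := by
              calc (w : ℝ) = (w : ℝ) ^ 1 := (pow_one _).symm
                _ ≤ (w : ℝ) ^ 5 := pow_le_pow_right₀ hw' (by norm_num)
            nlinarith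
    refine h1.trans (le_mul_of_one_le_right (by positivity) ?_)
    exact one_le_pow₀ (by linarith)
  -- For width one log w vanishes, and the polynomial factor must do all the work: the base is at
  -- most 32 log n ≤ (n+m)⁵, whose twelfth power is (n+m)⁶⁰.
  · obtain rfl : w = 1 := by omega
    simp only [Nat.cast_one, Real.logb_one, mul_zero, zero_mul, Real.rpow_zero, one_mul] at *
    have hlY : l ≤ n + m := by
      have : l ≤ n := by
        rw [hl_def, Real.logb_le_iff_le_rpow one_lt_two (by linarith), Real.rpow_natCast]
        exact_mod_cast Nat.lt_two_pow_self.le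
      linarith
    have hY : (3 : ℝ) ≤ n + m := by linarith
    set Y : ℝ := n + m
    have h32 : 8 * ((1 : ℝ) + 1) ^ 2 * l ≤ Y ^ 5 := by
      have : (3 : ℝ) ^ 4 ≤ Y ^ 4 := by gcongr
      calc 8 * ((1 : ℝ) + 1) ^ 2 * l ≤ 3 ^ 4 * l := by nlinarith
        _ ≤ Y ^ 4 * Y := by gcongr
        _ = Y ^ 5 := by ring
    calc (((2 * (((1 : ℝ) + 1) * ((1 + 1) * L) + 1)) ^ (1 + 1)) ^ 6)
        ≤ ((Y ^ 5) ^ (1 + 1)) ^ 6 := by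
          gcongr
          exact hbase.trans h32
      _ = Y ^ 60 := by ring

theorem time_le {n m w : ℕ} (hn : 3 ≤ n) (hw : 1 ≤ w) {T : ℕ}
    (hT : T ≤ 4000 * (n + m + 1 +
      sigBound n ((w + 1) * ((w + 1) * Nat.clog 2 n)) (w + 1)) ^ 6) :
    (T : ℝ) ≤ (2 : ℝ) ^ ((180 : ℝ) * ((w : ℝ) ^ 5 * Real.logb 2 w * Real.logb 2 (Real.logb 2 n))) *
      ((n : ℝ) + (m : ℝ)) ^ (180 : ℝ) := by
  have hsig := signatures_le (m := m) hn hw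
  unfold sigBound at hT
  have hZ1 : 1 ≤ (2 * ((w + 1) * ((w + 1) * Nat.clog 2 n) + 1)) ^ (w + 1) :=
    Nat.one_le_pow _ _ (by omega)
  generalize (2 * ((w + 1) * ((w + 1) * Nat.clog 2 n) + 1)) ^ (w + 1) = Z at hsig hT hZ1
  have hY3 : 3 ≤ n + m := by omega
  have hYr : (1 : ℝ) ≤ (n : ℝ) + m := by exact_mod_cast (by omega : 1 ≤ n + m)
  have hcast : ((n + m : ℕ) : ℝ) = (n : ℝ) + m := by push_cast; rfl
  have hnY : n ≤ n + m := by omega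
  generalize n + m = Y at hT hY3 hcast hnY
  rw [← hcast] at hsig hYr ⊢
  -- The left side is at most 2(Y+1)Z, and 2(Y+1) ≤ Y² because Y ≥ 3.
  have h1 : Y + 1 + (n + 1) * Z ≤ Y ^ 2 * Z := by
    have h2 : (n + 1) * Z ≤ (Y + 1) * Z := by gcongr
    have h3 : Y + 1 ≤ (Y + 1) * Z := Nat.le_mul_of_pos_right _ hZ1
    have h4 : 2 * (Y + 1) ≤ Y ^ 2 := by nlinarith
    have h5 := Nat.mul_le_mul_right Z h4
    linarith
  have h2 : T ≤ Y ^ 20 * Z ^ 6 := by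
    -- Since 3⁸ = 6561, the constant 4000 is absorbed into Y⁸.
    have h8 : 4000 ≤ Y ^ 8 := le_trans (by norm_num) (Nat.pow_le_pow_left hY3 8)
    calc T ≤ 4000 * (Y + 1 + (n + 1) * Z) ^ 6 := hT
      _ ≤ Y ^ 8 * (Y ^ 2 * Z) ^ 6 := Nat.mul_le_mul h8 (Nat.pow_le_pow_left h1 6)
      _ = Y ^ 20 * Z ^ 6 := by ring
  have h3 : (T : ℝ) ≤ (Y : ℝ) ^ 20 * (Z : ℝ) ^ 6 := by exact_mod_cast h2
  have h4 : (Y : ℝ) ^ 80 ≤ (Y : ℝ) ^ (180 : ℝ) := by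
    rw [← Real.rpow_natCast]
    exact Real.rpow_le_rpow_of_exponent_le hYr (by norm_num)
  have hE : 0 ≤ (2 : ℝ) ^ ((180 : ℝ) *
    ((w : ℝ) ^ 5 * Real.logb 2 w * Real.logb 2 (Real.logb 2 n))) := by positivity
  generalize (2 : ℝ) ^ ((180 : ℝ) *
    ((w : ℝ) ^ 5 * Real.logb 2 w * Real.logb 2 (Real.logb 2 n))) = E at hE hsig ⊢
  calc (T : ℝ) ≤ (Y : ℝ) ^ 20 * (Z : ℝ) ^ 6 := h3
    _ ≤ (Y : ℝ) ^ 20 * (E * (Y : ℝ) ^ 60) := mul_le_mul_of_nonneg_left hsig (by positivity)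
    _ = E * (Y : ℝ) ^ 80 := by ring
    _ ≤ _ := mul_le_mul_of_nonneg_left h4 hE

end VDS

/-- One program `P` and constants `c > 0`, `C` work for all instances.  The number `m` of nodes of
the given tree counts as part of the input size, next to the number `n` of vertices. -/
theorem theorem2 :
    ∃ (P : RAM.Prog) (c C : ℝ), 0 < c ∧ 0 < C ∧
      ∀ (n m w : ℕ) (G : SimpleGraph (Fin n)) (t : Fin n → ℕ) (D : VDS.TreeDecomposition G m),
        3 ≤ n → 1 ≤ w → D.width = w →
        ∃ (T : ℕ) (s : RAM.State),
          RAM.RunsIn P (VDS.input G t D) T s ∧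
          (T : ℝ) ≤ (2 : ℝ) ^ (C * ((w : ℝ) ^ 5 * Real.logb 2 w * Real.logb 2 (Real.logb 2 n))) *
            ((n : ℝ) + (m : ℝ)) ^ C ∧
          VDS.IsSolution G t (VDS.output n s) ∧
          ((VDS.output n s).card : ℝ) ≤
            (1 + 1 / ((w : ℝ) * Real.logb 2 (Real.logb 2 n)) ^ c) * (VDS.opt G t : ℝ) := by
  -- The exponent of 2 requires 180; the power of `n + m` would need only 80.
  refine ⟨VDS.vdsProg, 1, 180, one_pos, by norm_num, ?_⟩
  rintro n m w G t D hn hw rfl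
  obtain ⟨T, s, hrun, hT, hout⟩ := VDS.vdsProg_spec (G := G) (t := t) (D := D) (by omega) hw rfl
    le_rfl
  have hL1 : 1 ≤ Nat.clog 2 n := Nat.clog_pos one_lt_two (by omega)
  -- With q = wL the cap suffices, because wq + w = w²L + w ≤ (w+1)²L when L ≥ 1, and the loss is
  -- the factor 1 + 1/q.
  obtain ⟨S, hS, hcard⟩ := VDS.exists_kGood D t (q := D.width * Nat.clog 2 n)
    (K := (D.width + 1) * ((D.width + 1) * Nat.clog 2 n)) (by nlinarith)
  obtain ⟨hgood, hle⟩ := hout S hS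
  refine ⟨T, s, hrun, VDS.time_le hn hw hT, hgood.isSolution, ?_⟩
  have hw' : (1 : ℝ) ≤ D.width := by exact_mod_cast hw
  have hll := VDS.half_le_logb_logb hn
  have hq : (D.width : ℝ) * Real.logb 2 (Real.logb 2 n) ≤ D.width * Nat.clog 2 n := by
    gcongr
    exact VDS.logb_logb_le_clog hn
  have hpos : 0 < (D.width : ℝ) * Real.logb 2 (Real.logb 2 n) := by positivity
  have hqpos := hpos.trans_le hq
  have hcard' : (D.width : ℝ) * (D.width * Nat.clog 2 n) * S.card ≤
      D.width * (D.width * Nat.clog 2 n + 1) * VDS.opt G t := by exact_mod_cast hcard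
  have h1 : (D.width * Nat.clog 2 n : ℝ) * S.card ≤
      (D.width * Nat.clog 2 n + 1) * VDS.opt G t := by
    rw [mul_assoc (D.width : ℝ), mul_assoc (D.width : ℝ) (_ + _)] at hcard'
    exact le_of_mul_le_mul_left hcard' (by positivity)
  rw [Real.rpow_one]
  calc ((VDS.output n s).card : ℝ) ≤ S.card := by exact_mod_cast hle
    _ ≤ (1 + 1 / (D.width * Nat.clog 2 n : ℝ)) * VDS.opt G t := by
      rw [← mul_le_mul_iff_right₀ hqpos]
      refine h1.trans_eq ?_
      field_simp
    _ ≤ _ := by gcongr
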